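/- **Conventions.** A map is a 2-cell embedding of a finite connected multigraph (loops and multiple edges allowed) on a closed surface. It is described by its finite set of flags with the fixed-point-free involutions $r_0,r_1,r_2$ ($r_i f$ is the flag $i$-adjacent to $f$), where $r_0r_2=r_2r_0$ is fixed-point-free and $\langle r_0,r_1,r_2\rangle$ is transitive. Vertices, edges and faces are the orbits of $\langle r_1,r_2\rangle$, $\langle r_0,r_2\rangle$, $\langle r_0,r_1\rangle$. $\Gamma(M)$ is the group of permutations of the flags commuting with all $r_i$; $M$ is a $k$-orbit map if $\Gamma(M)$ has $k$ orbits on flags, regular if $k=1$, and chiral if $k=2$ and adjacent flags are always in different orbits. Type $\{p,q\}$ means that all faces have co-degree $p$ and all vertices degree $q$. A type graph is a set $V$ with three involutions $t_0,t_1,t_2$ (fixed points being semi-edges); $M$ has type graph $T$ if the set of flag orbits with the induced involutions is isomorphic to $T$. $M$ is $T$-admissible if there is a labelling $\ell$ of the flags by $V$ with $\ell(r_if)=t_i\ell(f)$ such that flags with equal labels are in the same $\Gamma(M)$-orbit; its admissible group is then $G=\{\varphi\in\Gamma(M):\ell\varphi=\ell\}$. The types $2_{01}$ and $2_0$ have two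 vertices: in $2_{01}$, $t_0,t_1$ are trivial and $t_2$ is the swap; in $2_0$, $t_0$ is trivial and $t_1,t_2$ are the swap. For a base flag $\Phi$ let $\rho_0,\rho_1,\rho_{212},\sigma_{12}$ denote the automorphisms with $\rho_0\Phi=r_0\Phi$, $\rho_1\Phi=r_1\Phi$, $\rho_{212}\Phi=r_2r_1r_2\Phi$, $\sigma_{12}\Phi=r_2r_1\Phi$. The type graphs (B), (C), (D) have vertices $1,\dots,14$ with $t_1=(14\,1)(2\,3)(4\,5)(6\,7)(8\,9)(10\,11)(12\,13)$, $t_2=(1\,2)(3\,4)(5\,6)(7\,8)(9\,10)(11\,12)(13\,14)$, and $t_0$ equal to (B) $(1\,2)(3\,10)(4\,9)(5\,6)(7\,8)(11\,14)(12\,13)$, (C) $(1\,2)(3\,10)(4\,9)(5\,7)(6\,8)(11\,14)(12\,13)$, (D) $(1\,5)(2\,6)(3\,9)(4\,10)(7\,8)(11\,14)(12\,13)$. **Operations.** $Du$ interchanges $r_0$ and $r_2$; $Pe$ replaces $r_0$ by $r_0r_2$; $Tr$ is truncation, whose inherited edges are those corresponding to edges of the original map. *Collapsing* with respect to an orbit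 $\mathcal F$ of triangles under a group of automorphisms is defined if every vertex is incident to no face of $\mathcal F$, one, two sharing an edge, or three two of which share an edge, if each triangle of $\mathcal F$ shares precisely one edge with another one of $\mathcal F$, and if every triangle of $\mathcal F$ has three distinct vertices and any two sharing an edge have four. Each pair of triangles $uvx$, $uvw$ of $\mathcal F$ sharing $uv$ is deleted by identifying $x$ with $w$, $ux$ with $uw$ and $vx$ with $vw$. In the inverse operation the vertex $x=w$ is split and the edges $ux=uw$, $vx=vw$ at it are doubled. *Rebelting* is defined for a map of type $\{3,8\}$ some of whose triangles are on belts, so that around every vertex there are two triangles not on belts, separated on both sides by exactly three triangles on belts. The new vertices are the centres of the triangles not on belts; the new edges are, for every edge shared by two belt triangles $t,t'$, an edge through its midpoint joining the centres of the two triangles not on belts adjacent to $t$ and $t'$, and, for every old vertex, an edge through it joining the centres of the two triangles not on belts at that vertex. The latter edges bound the new belts. **Construction.** Let $M$ be either $2_{01}$-admissible (case (B)) with $\rho_0\rho_1\rho_{212}$ of order $3$, or $2_0$-admissible (cases (C), (D)) with $\rho_0\sigma_{12}^2$ of order $3$, and $G$ its admissible group. Let $M''=Du(Pe(Tr(M)))$;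 let $M^{(3)}$ be obtained from $M''$ by inverse rebelting with respect to the belts bounded by the edges of $M''$ dual to the inherited edges. Label the flags of $M^{(3)}$ (admissibly, the triangles not on belts having the labels $12,13$) by the eight-vertex type graph, with involutions $s_0,s_1,s_2$, obtained in the respective case from (B), (C), (D) by removing the labels $1,2,3,10,11,14$ in cases (B), (C), and $2,3,6,7,8,9$ in case (D); here $s_0,s_1$ are the restrictions of $t_0,t_1$, and $s_2$ is $(4\,13)(5\,6)(7\,8)(9\,12)$ in cases (B), (C) and $(1\,4)(5\,10)(11\,12)(13\,14)$ in case (D). Choose $k\in\{12,13\}$ in cases (B), (C), and $k\in\{1,10\}$ in case (D). Finally let $\bar M$ be obtained from $M^{(3)}$ by the inverse of collapsing, where the split vertices and the edges doubled at them are those of the flags labelled $k$. **Theorem.** (1) Let $\bar M$ be a vertex-transitive map of type $\{3,7\}$ that is neither regular nor chiral. Then $\bar M$ has exactly $14$ flag orbits, its type graph is exactly one of (B), (C), (D), and $\bar M$ is obtained by the construction, in the respective case, from a $2_{01}$-admissible map $M$ with $\rho_0\rho_1\rho_{212}$ of order $3$ (case (B)) or a $2_0$-admissible map $M$ with $\rho_0\sigma_{12}^2$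 of order $3$ (cases (C), (D)). Here the collapsed triangles form the $\Gamma(\bar M)$-orbit of triangles whose flags have the removed labels, and the flags of $M^{(3)}$ keep their labels. Moreover $\Gamma(\bar M)\cong G$, and the surface of $\bar M$ has Euler characteristic $-|G|/6$, which is minus one third of the number of edges of $M$. (2) Conversely, for every such $M$, $M''$ has type $\{3,9\}$, all steps of the construction can be carried out for every admissible choice of labelling and of $k$ (the collapsed triangles forming an orbit of a group of automorphisms of $\bar M$ isomorphic to $G$), and every resulting map $\bar M$ is a vertex-transitive map of type $\{3,7\}$, admissible for the type graph of the case, on a surface of Euler characteristic $-|G|/6$ (minus one third of the number of edges of $M$). The group $G$ embeds in $\Gamma(\bar M)$, and either $\bar M$ is a $14$-orbit map with the type graph of the case and $|\Gamma(\bar M)|=|G|$, or $\bar M$ is chiral and $|\Gamma(\bar M)|=7|G|$, or $\bar M$ is regular and $|\Gamma(\bar M)|=14|G|$. -/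

import Mathlib

/-!
Maps on closed surfaces are described by their flags.  A map with flag set `F` is a triple of
fixed-point-free involutions `r 0`, `r 1`, `r 2` of the finite set `F`, where `r i f` is the flag
that is `i`-adjacent to `f`.  Each edge carries exactly four flags, that is, `r 0` and `r 2` commute
and their product has no fixed point; the surface is connected.
-/

/-- A map (2-cell embedding of a finite connected multigraph on a closed surface), given by the
adjacency involutions on its finite set of flags. -/
structure FlagMap (F : Type*) where
  /-- `r i f` is the flag `i`-adjacent to `f`. -/
  r : Fin 3 → Equiv.Perm F
  finite : Finite F
  nonempty : Nonempty F
  invol : ∀ i f, r i (r i f) = f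
  no_fix : ∀ i f, r i f ≠ f
  comm : ∀ f, r 0 (r 2 f) = r 2 (r 0 f)
  no_fix_edge : ∀ f, r 0 (r 2 f) ≠ f
  connected : ∀ f g, Relation.ReflTransGen (fun a b => ∃ i, r i a = b) f g

namespace FlagMap

variable {F : Type*} (M : FlagMap F)

/-- `M.cell i f g`: the flags `f` and `g` belong to the same vertex (`i = 0`), edge (`i = 1`) or
face (`i = 2`), i.e. they are joined by a path of `j`-adjacencies with `j ≠ i`. -/
def cell (i : Fin 3) : Setoid F :=
  MulAction.orbitRel (Subgroup.closure (M.r '' {i}ᶜ)) F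

/-- The number of vertices (`i = 0`), edges (`i = 1`), faces (`i = 2`). -/
noncomputable def numCells (i : Fin 3) : ℕ := Nat.card (Quotient (M.cell i))

/-- Euler characteristic `v - e + f` of the underlying surface. -/
noncomputable def eulerChar : ℤ := (M.numCells 0 : ℤ) - M.numCells 1 + M.numCells 2

/-- Degree of the vertex of the flag `f`: the number of rotation steps around it. -/
noncomputable def degree (f : F) : ℕ := Function.minimalPeriod (fun g => M.r 1 (M.r 2 g)) f

/-- Co-degree (number of edges) of the face of the flag `f`. -/
noncomputable def codegree (f : F) : ℕ := Function.minimalPeriod (fun g => M.r 0 (M.r 1 g)) f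

/-- Equivelar of Schläfli type `{p, q}`. -/
def IsEquivelar (p q : ℕ) : Prop := ∀ f, M.codegree f = p ∧ M.degree f = q

/-- The automorphism group: permutations of the flags preserving all adjacencies. -/
def aut : Subgroup (Equiv.Perm F) := Subgroup.centralizer (Set.range M.r)

/-- Two flags in the same orbit of the automorphism group. -/
def SameOrbit (f g : F) : Prop := ∃ φ ∈ M.aut, φ f = g

/-- `M` is a `k`-orbit map for `k = M.numOrbits`. -/
noncomputable def numOrbits : ℕ := Nat.card (Quotient (MulAction.orbitRel M.aut F))

def IsVertexTransitive : Prop := ∀ f g, ∃ φ ∈ M.aut, M.cell 0 (φ f) g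

def IsRegular : Prop := M.numOrbits = 1

def IsChiral : Prop := M.numOrbits = 2 ∧ ∀ i f, ¬ M.SameOrbit f (M.r i f)

end FlagMap

/-! ### Type graphs -/

/-- A type graph with vertex set `V`: every vertex has exactly one edge or semi-edge of each label
`0, 1, 2`.  `T i x` is the other end of the edge labelled `i` at `x`; `T i x = x` for a
semi-edge. -/
abbrev TypeGraph (V : Type*) := Fin 3 → Equiv.Perm V

namespace FlagMap

variable {F : Type*} (M : FlagMap F) {V : Type*}

/-- A labelling of the flags by the vertices of `T` that is compatible with all adjacencies and
such that flags with the same label lie in the same orbit. -/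
def IsLabelling (T : TypeGraph V) (l : F → V) : Prop :=
  (∀ i f, l (M.r i f) = T i (l f)) ∧ ∀ f g, l f = l g → M.SameOrbit f g

/-- `T`-admissible maps. -/
def IsAdmissible (T : TypeGraph V) : Prop := ∃ l : F → V, M.IsLabelling T l

/-- The labels are exactly the flag orbits, so that `l` identifies the type graph of `M`
with `T`. -/
def IsTypeLabelling (T : TypeGraph V) (l : F → V) : Prop :=
  Function.Surjective l ∧ (∀ i f, l (M.r i f) = T i (l f)) ∧
    ∀ f g, l f = l g ↔ M.SameOrbit f g

/-- `M` is a map of type `T`: its type graph is isomorphic to `T`. -/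
def IsOfType (T : TypeGraph V) : Prop := ∃ l : F → V, M.IsTypeLabelling T l

/-- For an admissible labelling `l`, the group of automorphisms preserving the labels
(the admissible group). -/
def labelGroup (l : F → V) : Subgroup (Equiv.Perm F) where
  carrier := {φ | φ ∈ M.aut ∧ ∀ f, l (φ f) = l f}
  mul_mem' := by
    rintro φ ψ ⟨h1, h2⟩ ⟨h3, h4⟩
    exact ⟨M.aut.mul_mem h1 h3, fun f => by rw [Equiv.Perm.mul_apply, h2, h4]⟩
  one_mem' := ⟨M.aut.one_mem, fun _ => rfl⟩
  inv_mem' := by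
    rintro φ ⟨h1, h2⟩
    refine ⟨M.aut.inv_mem h1, fun f => ?_⟩
    have h := h2 (φ⁻¹ f)
    rw [← Equiv.Perm.mul_apply, mul_inv_cancel, Equiv.Perm.one_apply] at h
    exact h.symm

end FlagMap

/-- The type `2_0`: flags are `0`-adjacent to flags of the same orbit, and `1`- and `2`-adjacent to
flags of the other orbit. -/
def type20 : TypeGraph (Fin 2) := ![1, Equiv.swap 0 1, Equiv.swap 0 1]

/-- The type `2_{01}`: flags are `0`- and `1`-adjacent to flags of the same orbit, and
`2`-adjacent to flags of the other orbit. -/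
def type201 : TypeGraph (Fin 2) := ![1, 1, Equiv.swap 0 1]

/-- With respect to some base flag, the automorphisms `ρ₀`, `ρ₁`, `ρ₂₁₂` (sending the base flag to
its `0`-adjacent flag, its `1`-adjacent flag, and the flag reached by changing `2`, `1`, `2`) exist
and `ρ₀ ρ₁ ρ₂₁₂` has order `3`. -/
def FlagMap.Relation201 {F : Type*} (M : FlagMap F) : Prop :=
  ∃ (f : F) (ρ₀ ρ₁ ρ₂₁₂ : Equiv.Perm F), ρ₀ ∈ M.aut ∧ ρ₁ ∈ M.aut ∧ ρ₂₁₂ ∈ M.aut ∧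
    ρ₀ f = M.r 0 f ∧ ρ₁ f = M.r 1 f ∧ ρ₂₁₂ f = M.r 2 (M.r 1 (M.r 2 f)) ∧
    orderOf (ρ₀ * ρ₁ * ρ₂₁₂) = 3

/-- With respect to some base flag, the automorphisms `ρ₀`, `σ₁₂` (sending the base flag to its
`0`-adjacent flag, and to the flag reached by changing `1` and then `2`) exist and `ρ₀ σ₁₂²` has
order `3`. -/
def FlagMap.Relation20 {F : Type*} (M : FlagMap F) : Prop :=
  ∃ (f : F) (ρ₀ σ₁₂ : Equiv.Perm F), ρ₀ ∈ M.aut ∧ σ₁₂ ∈ M.aut ∧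
    ρ₀ f = M.r 0 f ∧ σ₁₂ f = M.r 2 (M.r 1 f) ∧ orderOf (ρ₀ * σ₁₂ ^ 2) = 3

/-! ### Operations -/

namespace FlagMap

variable {F : Type*} (M : FlagMap F)

/-- Dual: interchange `0`- and `2`-adjacencies. -/
def dual : FlagMap F where
  r := ![M.r 2, M.r 1, M.r 0]
  finite := M.finite
  nonempty := M.nonempty
  invol i f := by fin_cases i <;> exact M.invol _ f
  no_fix i f := by fin_cases i <;> exact M.no_fix _ f
  comm f := (M.comm f).symm
  no_fix_edge f := by
    change M.r 2 (M.r 0 f) ≠ f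
    rw [← M.comm]; exact M.no_fix_edge f
  connected f g := by
    refine Relation.ReflTransGen.mono ?_ _ _ (M.connected f g)
    rintro a b ⟨i, rfl⟩
    fin_cases i
    · exact ⟨2, rfl⟩
    · exact ⟨1, rfl⟩
    · exact ⟨0, rfl⟩

/-- Petrial: the regions around the vertices are kept and reglued along the edges with reversed
orientation, so that `0`-adjacency becomes the composite of `0`- and `2`-adjacency. -/
def petrial : FlagMap F where
  r := ![M.r 0 * M.r 2, M.r 1, M.r 2]
  finite := M.finite
  nonempty := M.nonempty
  invol i f := by
    fin_cases i
    · change M.r 0 (M.r 2 (M.r 0 (M.r 2 f))) = f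
      rw [M.comm, M.invol, M.invol]
    · exact M.invol _ f
    · exact M.invol _ f
  no_fix i f := by
    fin_cases i
    · exact M.no_fix_edge f
    · exact M.no_fix _ f
    · exact M.no_fix _ f
  comm f := by
    change M.r 0 (M.r 2 (M.r 2 f)) = M.r 2 (M.r 0 (M.r 2 f))
    rw [M.comm (M.r 2 f)]
  no_fix_edge f := by
    change M.r 0 (M.r 2 (M.r 2 f)) ≠ f
    rw [M.invol]; exact M.no_fix 0 f
  connected f g := by
    refine Relation.ReflTransGen.lift' id ?_ _ _ (M.connected f g)
    rintro a b ⟨i, rfl⟩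
    fin_cases i
    · refine (Relation.ReflTransGen.single ⟨2, rfl⟩).trans (Relation.ReflTransGen.single ⟨0, ?_⟩)
      change M.r 0 (M.r 2 (M.r 2 a)) = M.r 0 a
      rw [M.invol]
    · exact Relation.ReflTransGen.single ⟨1, rfl⟩
    · exact Relation.ReflTransGen.single ⟨2, rfl⟩

/-- Adjacencies of the truncation.  A flag `f` of `M` with vertex `v`, edge `e` and face `p` is
divided into three flags, all at the new vertex near `v` on `e`: `(f, 0)` lies on the inherited edge
and in the old face `p`, `(f, 1)` lies on the new edge cutting off `v` and in the old face `p`, and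
`(f, 2)` lies on that new edge and in the new face around `v`. -/
def truncAdj : Fin 3 → F × Fin 3 → F × Fin 3
  | 0, (f, 0) => (M.r 0 f, 0)
  | 0, (f, 1) => (M.r 1 f, 1)
  | 0, (f, 2) => (M.r 1 f, 2)
  | 1, (f, 0) => (f, 1)
  | 1, (f, 1) => (f, 0)
  | 1, (f, 2) => (M.r 2 f, 2)
  | 2, (f, 0) => (M.r 2 f, 0)
  | 2, (f, 1) => (f, 2)
  | 2, (f, 2) => (f, 1)

theorem truncAdj_invol (i : Fin 3) : Function.Involutive (M.truncAdj i) := by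
  rintro ⟨f, j⟩
  fin_cases i <;> fin_cases j <;> simp [truncAdj, M.invol]

/-- Truncation. -/
def truncation : FlagMap (F × Fin 3) where
  r i := (M.truncAdj_invol i).toPerm
  finite := by
    have := M.finite
    infer_instance
  nonempty := M.nonempty.elim fun f => ⟨(f, 0)⟩
  invol i x := M.truncAdj_invol i x
  no_fix := by
    rintro i ⟨f, j⟩
    fin_cases i <;> fin_cases j <;> simp [truncAdj, M.no_fix]
  comm := by
    rintro ⟨f, j⟩
    fin_cases j <;> simp [truncAdj, M.comm]
  no_fix_edge := by
    rintro ⟨f, j⟩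
    fin_cases j <;> simp [truncAdj, M.no_fix_edge]
  connected := by
    have step : ∀ (i : Fin 3) (a b : F × Fin 3), M.truncAdj i a = b → Relation.ReflTransGen
        (fun a b => ∃ i, M.truncAdj i a = b) a b :=
      fun i a b h => Relation.ReflTransGen.single ⟨i, h⟩
    have up : ∀ (f : F) (j : Fin 3), Relation.ReflTransGen
        (fun a b => ∃ i, M.truncAdj i a = b) (f, 0) (f, j) := by
      intro f j
      fin_cases j
      · exact Relation.ReflTransGen.refl
      · exact step 1 _ _ rfl
      · exact (step 1 (f, 0) (f, 1) rfl).trans (step 2 (f, 1) (f, 2) rfl)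
    have down : ∀ (f : F) (j : Fin 3), Relation.ReflTransGen
        (fun a b => ∃ i, M.truncAdj i a = b) (f, j) (f, 0) := by
      intro f j
      fin_cases j
      · exact Relation.ReflTransGen.refl
      · exact step 1 (f, 1) (f, 0) rfl
      · exact (step 2 (f, 2) (f, 1) rfl).trans (step 1 (f, 1) (f, 0) rfl)
    rintro ⟨f, j⟩ ⟨g, k⟩
    refine (down f j).trans (Relation.ReflTransGen.trans ?_ (up g k))
    refine Relation.ReflTransGen.lift' (fun f => (f, (0 : Fin 3))) ?_ _ _ (M.connected f g)
    rintro a b ⟨i, rfl⟩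
    fin_cases i
    · exact step 0 (a, 0) (M.r 0 a, 0) rfl
    · exact ((step 1 (a, 0) (a, 1) rfl).trans (step 0 (a, 1) (M.r 1 a, 1) rfl)).trans
        (step 1 (M.r 1 a, 1) (M.r 1 a, 0) rfl)
    · exact step 2 (a, 0) (M.r 2 a, 0) rfl

end FlagMap

/-- The flags of the truncation lying on inherited edges. -/
def inheritedFlags (F : Type*) : Set (F × Fin 3) := {x | x.2 = 0}

/-- `N` is obtained from `M` by collapsing the set of triangles with flag set `T`, which is an
orbit of faces under the group `H` of automorphisms of `M`.

The flags of `N` are those of `M` outside `T`, through the injection `e`.  When two triangles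
`F₁ = uvx` and `F₂ = uvw` of `T` sharing the edge `uv` are deleted, the flags outside `T` along `ux`
and `uw` become `2`-adjacent, and so do those along `vx` and `vw`; `x` and `w` are identified.

`S` records where the collapsing took place: it is the set of flags of `N` whose vertex is one of
the vertices arising from the identification of `x` with `w`, and whose edge is one
of the edges arising from the identification of `ux` with `uw` or of `vx` with `vw`.  In the inverse
operation the vertex is split in two, and the two edges of `S` at it are doubled. -/
structure IsCollapsing {X Y : Type*} (M : FlagMap X) (H : Subgroup (Equiv.Perm X)) (T : Set X)
    (N : FlagMap Y) (S : Set Y) (e : Y → X) : Prop where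
  le_aut : H ≤ M.aut
  orbit : ∃ x₀, ∀ x, x ∈ T ↔ ∃ φ ∈ H, M.cell 2 (φ x₀) x
  triangle : ∀ x ∈ T, M.codegree x = 3
  /-- Every vertex is incident to no face of `T`, one face, two faces sharing an edge, or three
  faces two of which share an edge (each incident face contributes two flags at the vertex). -/
  at_vertex : ∀ x,
    {y | M.cell 0 x y ∧ y ∈ T}.ncard = 0 ∨ {y | M.cell 0 x y ∧ y ∈ T}.ncard = 2 ∨
    (({y | M.cell 0 x y ∧ y ∈ T}.ncard = 4 ∨ {y | M.cell 0 x y ∧ y ∈ T}.ncard = 6) ∧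
      ∃ y, M.cell 0 x y ∧ y ∈ T ∧ M.r 2 y ∈ T)
  /-- Each triangle of `T` shares precisely one of its three edges with a face of `T`. -/
  one_edge : ∀ x ∈ T, ∃! j : Fin 3, M.r 2 (![x, M.r 1 x, M.r 1 (M.r 0 x)] j) ∈ T
  /-- Each triangle of `T` has three distinct vertices. -/
  three_vertices : ∀ x ∈ T, ¬ M.cell 0 x (M.r 0 x) ∧ ¬ M.cell 0 x (M.r 0 (M.r 1 x)) ∧
    ¬ M.cell 0 (M.r 0 x) (M.r 0 (M.r 1 x))
  /-- Two triangles of `T` sharing an edge have four distinct vertices. -/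
  four_vertices : ∀ x ∈ T, M.r 2 x ∈ T →
    ¬ M.cell 0 (M.r 0 (M.r 1 x)) (M.r 0 (M.r 1 (M.r 2 x)))
  injective : Function.Injective e
  range_eq : Set.range e = Tᶜ
  map_zero : ∀ y, e (N.r 0 y) = M.r 0 (e y)
  map_one : ∀ y, e (N.r 1 y) = M.r 1 (e y)
  map_two : ∀ y, M.r 2 (e y) ∉ T → e (N.r 2 y) = M.r 2 (e y)
  /-- The vertex of `e y` is `u` or `v`. -/
  map_two_near : ∀ y, M.r 2 (e y) ∈ T → M.r 2 (M.r 1 (M.r 2 (e y))) ∈ T →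
    e (N.r 2 y) = M.r 2 (M.r 1 (M.r 2 (M.r 1 (M.r 2 (e y)))))
  /-- The vertex of `e y` is `x` or `w`. -/
  map_two_far : ∀ y, M.r 2 (e y) ∈ T → M.r 2 (M.r 1 (M.r 2 (e y))) ∉ T →
    e (N.r 2 y) = M.r 2 (M.r 0 (M.r 1 (M.r 2 (M.r 1 (M.r 0 (M.r 2 (e y)))))))
  mem_split : ∀ y, y ∈ S ↔ M.r 2 (e y) ∈ T ∧ M.r 2 (M.r 1 (M.r 2 (e y))) ∉ T

/-- `N` is obtained from `M` by rebelting, where `B` is the set of flags of the triangles of `M`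
arranged in belts, and `E` is the set of flags of `N` on the edges bounding the new belts.

A belt triangle `t` has exactly one edge, its base, shared with a triangle outside the belts; the
opposite vertex `a` is its apex.  The triangle of `N` that replaces `t` has one vertex at the centre
`c` of the triangle outside the belts at the base of `t`, the opposite edge has its midpoint at
`a`, and the two other edges pass through the midpoints of the sides of `t`.  Its six
flags are identified through `e` with those of `t`: a flag of `t` on a side `s` corresponds to
the flag on the new edge through the midpoint of `s`, at `c` if and only if the old
flag is at an endpoint of the base, and the flags on the base of `t` correspond to the flags on the
new edge through `a`. -/
structure IsRebelting {X Y : Type*} (M : FlagMap X) (B : Set X)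
    (N : FlagMap Y) (E : Set Y) (e : Y → X) : Prop where
  equivelar : M.IsEquivelar 3 8
  /-- `B` is a union of faces. -/
  faces : ∀ x, (M.r 0 x ∈ B ↔ x ∈ B) ∧ (M.r 1 x ∈ B ↔ x ∈ B)
  /-- Around every vertex there are triangles outside the belts. -/
  off_belt : ∀ x, ∃ y ∉ B, M.cell 0 x y
  /-- Going around a vertex from a triangle outside the belts, one meets three triangles on belts
  and then a triangle outside the belts. -/
  fan : ∀ x ∉ B, (fun z => M.r 1 (M.r 2 z))^[1] x ∈ B ∧ (fun z => M.r 1 (M.r 2 z))^[2] x ∈ B ∧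
    (fun z => M.r 1 (M.r 2 z))^[3] x ∈ B ∧ (fun z => M.r 1 (M.r 2 z))^[4] x ∉ B
  injective : Function.Injective e
  range_eq : Set.range e = B
  mem_bounding : ∀ y, y ∈ E ↔ M.r 2 (e y) ∉ B
  map_zero : ∀ y, e (N.r 0 y) = M.r 0 (e y)
  /-- Flags on the base. -/
  map_one_base : ∀ y, M.r 2 (e y) ∉ B → e (N.r 1 y) = M.r 0 (M.r 1 (e y))
  /-- Flags on a side, at the apex. -/
  map_one_apex : ∀ y, M.r 2 (e y) ∈ B → M.r 2 (M.r 1 (e y)) ∈ B →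
    e (N.r 1 y) = M.r 1 (M.r 0 (e y))
  /-- Flags on a side, at an endpoint of the base. -/
  map_one_side : ∀ y, M.r 2 (e y) ∈ B → M.r 2 (M.r 1 (e y)) ∉ B →
    e (N.r 1 y) = M.r 1 (M.r 0 (M.r 1 (e y)))
  map_two_side : ∀ y, M.r 2 (e y) ∈ B → e (N.r 2 y) = M.r 2 (e y)
  /-- The two new triangles at a bounding edge come from the two belt triangles with the same apex
  on both sides of it. -/
  map_two_base : ∀ y, M.r 2 (e y) ∉ B → e (N.r 2 y) =
    M.r 1 (M.r 0 (M.r 2 (M.r 1 (M.r 2 (M.r 1 (M.r 2 (M.r 1 (M.r 2 (M.r 0 (M.r 1 (e y)))))))))))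

/-! ### The three type graphs -/

/-- The three symmetry types (B), (C), (D). -/
inductive Case
  | B
  | C
  | D

namespace Case

open Equiv

/-- The type graphs (B), (C), (D).  Their vertices are the labels `1, …, 14` (with `14 = 0` in
`Fin 14`) in cyclic order around a vertex of the map. -/
def graph (c : Case) : TypeGraph (Fin 14) :=
  ![match c with
    | B => swap 1 2 * swap 3 10 * swap 4 9 * swap 5 6 * swap 7 8 * swap 11 14 * swap 12 13
    | C => swap 1 2 * swap 3 10 * swap 4 9 * swap 5 7 * swap 6 8 * swap 11 14 * swap 12 13
    | D => swap 1 5 * swap 2 6 * swap 3 9 * swap 4 10 * swap 7 8 * swap 11 14 * swap 12 13,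
    swap 14 1 * swap 2 3 * swap 4 5 * swap 6 7 * swap 8 9 * swap 10 11 * swap 12 13,
    swap 1 2 * swap 3 4 * swap 5 6 * swap 7 8 * swap 9 10 * swap 11 12 * swap 13 14]

/-- The labels of the triangles deleted by the collapsing. -/
def deleted : Case → Set (Fin 14)
  | B => {1, 2, 3, 10, 11, 14}
  | C => {1, 2, 3, 10, 11, 14}
  | D => {2, 3, 6, 7, 8, 9}

/-- The type graphs of the maps of type `{3, 8}`, on the eight labels not in `c.deleted` (the
deleted labels, which are not used, are fixed by the three permutations). -/
def graphEight : Case → TypeGraph (Fin 14)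
  | B => ![swap 4 9 * swap 5 6 * swap 7 8 * swap 12 13,
      swap 4 5 * swap 6 7 * swap 8 9 * swap 12 13,
      swap 4 13 * swap 5 6 * swap 7 8 * swap 9 12]
  | C => ![swap 4 9 * swap 5 7 * swap 6 8 * swap 12 13,
      swap 4 5 * swap 6 7 * swap 8 9 * swap 12 13,
      swap 4 13 * swap 5 6 * swap 7 8 * swap 9 12]
  | D => ![swap 1 5 * swap 4 10 * swap 11 14 * swap 12 13,
      swap 1 14 * swap 4 5 * swap 10 11 * swap 12 13,
      swap 1 4 * swap 5 10 * swap 11 12 * swap 13 14]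

/-- The two possible labels `k` determining the places of the inverse collapsing. -/
def splitLabels : Case → Set (Fin 14)
  | B => {12, 13}
  | C => {12, 13}
  | D => {1, 10}

/-- The type of the map the construction starts with. -/
def graphTwo : Case → TypeGraph (Fin 2)
  | B => type201
  | C => type20
  | D => type20

/-- The relation required of the map the construction starts with. -/
def StartRelation {F : Type*} (M : FlagMap F) : Case → Prop
  | B => M.Relation201
  | C => M.Relation20
  | D => M.Relation20

end Case

/-- `M₃`, with belts `B`, is obtained from `M` by truncation, Petrial, dual, and the inverse of
rebelting with respect to the belts bounded by the edges dual to the inherited edges. -/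
def IsUnbelted {F Y : Type*} (M : FlagMap F) (M₃ : FlagMap Y) (B : Set Y) : Prop :=
  ∃ e : F × Fin 3 → Y, IsRebelting M₃ B M.truncation.petrial.dual (inheritedFlags F) e

/-- An admissible labelling of `M₃` for the case `c`, the labels `12` and `13` being those of the
triangles outside the belts. -/
def IsCaseLabelling {Y : Type*} (c : Case) (M₃ : FlagMap Y) (B : Set Y) (l : Y → Fin 14) : Prop :=
  M₃.IsLabelling c.graphEight l ∧ (∀ y, l y ∉ c.deleted) ∧ ∀ y, y ∉ B ↔ l y = 12 ∨ l y = 13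

/-- The flags of `M₃` on the edges `e_Φ` at the vertices `v_Φ`, for the flags `Φ` labelled `k`. -/
def splitFlags {Y : Type*} (c : Case) (l : Y → Fin 14) (k : Fin 14) : Set Y :=
  {y | l y = k ∨ l y = c.graphEight 2 k}

universe u

set_option linter.unusedSimpArgs false

namespace FlagMap

variable {F : Type*} (M : FlagMap F)

/-! Everything is reduced to group theory. If the flags of a map are labelled by a type graph with
vertex set `V`, the group `G` of label-preserving automorphisms acts freely on the flags and
transitively on each label class. After the choice of one flag per label, the flag set is `G × V`
and every adjacency multiplies the first coordinate on the right by a voltage depending only on the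
label (`IsLabelling.exists_voltage`).

For the 14-vertex graphs (B), (C), (D) the representatives can be taken consecutively around one
vertex, so only the `0`-adjacencies carry voltages. The triangle relations then reduce these to
words in elements `a`, `b`, `d` which generate `G`, with `a` an involution and `abd` of order 3; `b`
and `d` are involutions in case (B), and `d = b` otherwise. This is a `Datum`. A map of type
`2_{01}` or `2_0` satisfying the order-3 relation carries exactly the same information
(`IsLabelling.exists_datum_bar`, `IsLabelling.exists_datum_two`). Conversely each datum defines
three voltage maps over the same `G`: `Datum.bar` of type {3,7}, `Datum.eight` of type {3,8} and
`Datum.two`. Collapsing leads from the first to the second, and rebelting leads from the second to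
the dual of the Petrial of the truncation of the third (`Datum.isCollapsing`, `Datum.isRebelting`).
Both facts are finite checks on labels combined with word identities.

For the converse, an arbitrary outcome of the construction must be compared with the standard one.
The two inverse operations determine their results up to isomorphism (`IsRebelting.exists_isIso`,
`IsCollapsing.exists_isIso`), because the adjacencies of the larger map can be expressed through
those of the smaller map and the marked edges. The freedom in the labelling and in `k` is absorbed
by an automorphism of the 8-vertex graph and by the choice of the base flag
(`exists_standard_form`).

The classification looks at the 14 flags around a vertex, which meet every flag orbit. If two of
them at even distance are equivalent, then, 7 being prime, the map is regular or chiral. If two at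
odd distance are equivalent but none at even distance, the type graph is a path of seven labels with
respect to `r 1` and `r 2`, and no `0`-adjacency is compatible with it. Otherwise there are 14
orbits (`IsVertexTransitive.trichotomy`). The rotation of triangles permutes these 14 orbits with
trivial cube, so it has a fixed point, since 3 does not divide 14. With this point normalised, a
finite search leaves (B), (C), (D) and their mirror images (`wheel_classification`). The Euler
characteristic is a count of flags. -/

theorem r_r (i : Fin 3) (f : F) : M.r i (M.r i f) = f := M.invol i f

theorem r_eq_iff (i : Fin 3) (f g : F) : M.r i f = g ↔ f = M.r i g :=
  ⟨fun h => by rw [← h, M.invol], fun h => by rw [h, M.invol]⟩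

/-! ### Cells -/

theorem cell_r {i j : Fin 3} (h : j ≠ i) (x : F) : M.cell i x (M.r j x) := by
  apply (M.cell i).symm
  exact ⟨⟨M.r j, Subgroup.subset_closure ⟨j, h, rfl⟩⟩, rfl⟩

theorem cell_trans {i : Fin 3} {x y z : F} (h : M.cell i x y) (h' : M.cell i y z) :
    M.cell i x z := (M.cell i).trans h h'

theorem cell_symm {i : Fin 3} {x y : F} (h : M.cell i x y) : M.cell i y x := (M.cell i).symm h

theorem cell_refl {i : Fin 3} (x : F) : M.cell i x x := (M.cell i).refl x

theorem cell_step {i j : Fin 3} (h : j ≠ i) {x y : F} (hxy : M.cell i x y) :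
    M.cell i x (M.r j y) := M.cell_trans hxy (M.cell_r h y)

theorem cell_induction {i : Fin 3} {P : F → Prop} (hP : ∀ j, j ≠ i → ∀ y, P y → P (M.r j y))
    {x y : F} (h : M.cell i x y) (hx : P x) : P y := by
  have key : ∀ g ∈ Subgroup.closure (M.r '' {i}ᶜ), ∀ z, P z ↔ P (g z) := by
    intro g hg
    induction hg using Subgroup.closure_induction with
    | mem g hg =>
      obtain ⟨j, hj, rfl⟩ := hg
      exact fun z => ⟨hP j hj z, fun h => by simpa [M.invol] using hP j hj _ h⟩
    | one => exact fun z => Iff.rfl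
    | mul g g' _ _ h1 h2 => exact fun z => (h2 z).trans (h1 _)
    | inv g _ h1 => exact fun z => by simpa using (h1 (g⁻¹ z)).symm
  obtain ⟨⟨g, hg⟩, hgx⟩ := M.cell_symm h
  have := (key g hg x).1 hx
  rwa [show g x = y from hgx] at this

/-! ### Automorphisms -/

theorem mem_aut_iff {φ : Equiv.Perm F} :
    φ ∈ M.aut ↔ ∀ i x, φ (M.r i x) = M.r i (φ x) := by
  unfold aut
  rw [Subgroup.mem_centralizer_iff]
  constructor
  · intro h i x
    have := h (M.r i) ⟨i, rfl⟩
    exact (DFunLike.congr_fun this x).symm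
  · rintro h _ ⟨i, rfl⟩
    ext x
    exact (h i x).symm

theorem aut_r {φ : Equiv.Perm F} (h : φ ∈ M.aut) (i : Fin 3) (x : F) :
    φ (M.r i x) = M.r i (φ x) := M.mem_aut_iff.1 h i x

/-- A property of flags that is stable under adjacency and holds somewhere holds everywhere. -/
theorem connected_induction {P : F → Prop} (hP : ∀ i y, P y → P (M.r i y)) {x : F} (hx : P x)
    (y : F) : P y := by
  have := M.connected x y
  induction this with
  | refl => exact hx
  | tail _ h ih => obtain ⟨i, rfl⟩ := h; exact hP i _ ih

/-- Connectedness makes the action of the automorphism group free. All counts of orbits and all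
voltage coordinates rest on this. -/
theorem aut_ext {φ ψ : Equiv.Perm F} (hφ : φ ∈ M.aut) (hψ : ψ ∈ M.aut) {x : F}
    (h : φ x = ψ x) : φ = ψ := by
  ext y
  refine M.connected_induction (P := fun y => φ y = ψ y) ?_ h y
  intro i y hy
  rw [M.aut_r hφ, M.aut_r hψ, hy]

theorem cell_aut {φ : Equiv.Perm F} (h : φ ∈ M.aut) {i : Fin 3} {x y : F} (hxy : M.cell i x y) :
    M.cell i (φ x) (φ y) := by
  refine M.cell_induction (P := fun y => M.cell i (φ x) (φ y)) ?_ hxy (M.cell_refl _)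
  intro j hj y hy
  rw [M.aut_r h]
  exact M.cell_step hj hy

theorem SameOrbit.refl (x : F) : M.SameOrbit x x := ⟨1, M.aut.one_mem, rfl⟩

variable {M}

theorem SameOrbit.symm {x y : F} (h : M.SameOrbit x y) : M.SameOrbit y x := by
  obtain ⟨φ, hφ, rfl⟩ := h
  exact ⟨φ⁻¹, M.aut.inv_mem hφ, by simp⟩

theorem SameOrbit.trans {x y z : F} (h : M.SameOrbit x y) (h' : M.SameOrbit y z) :
    M.SameOrbit x z := by
  obtain ⟨φ, hφ, rfl⟩ := h
  obtain ⟨ψ, hψ, rfl⟩ := h'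
  exact ⟨ψ * φ, M.aut.mul_mem hψ hφ, rfl⟩

theorem SameOrbit.r {x y : F} (h : M.SameOrbit x y) (i : Fin 3) :
    M.SameOrbit (M.r i x) (M.r i y) := by
  obtain ⟨φ, hφ, rfl⟩ := h
  exact ⟨φ, hφ, M.aut_r hφ i x⟩

theorem orbitRel_iff {x y : F} : MulAction.orbitRel M.aut F x y ↔ M.SameOrbit x y := by
  constructor
  · rintro ⟨⟨φ, hφ⟩, h⟩
    exact SameOrbit.symm ⟨φ, hφ, h⟩
  · intro h
    obtain ⟨φ, hφ, h⟩ := h.symm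
    exact ⟨⟨φ, hφ⟩, h⟩

variable (M)

theorem card_eq_numOrbits_mul : Nat.card F = M.numOrbits * Nat.card M.aut := by
  have h : ∀ x : F, MulAction.stabilizer M.aut x = ⊥ := by
    intro x
    rw [Subgroup.eq_bot_iff_forall]
    rintro ⟨φ, hφ⟩ h
    rw [MulAction.mem_stabilizer_iff] at h
    exact Subtype.ext (M.aut_ext hφ M.aut.one_mem (x := x) h)
  rw [Nat.card_congr (MulAction.selfEquivOrbitsQuotientProd h), Nat.card_prod]
  rfl

/-! ### Sizes of cells -/

section Dihedral

variable {a b : Equiv.Perm F}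

/-- A reflection in the dihedral group of `a` and `b` is an odd alternating word. Conjugation by its
outer letter shortens it by two letters and exchanges the roles of `a` and `b`, until a single
fixed-point-free generator remains. -/
theorem reflection_ne (m : ℕ) : ∀ (a b : Equiv.Perm F), (∀ x, a (a x) = x) → (∀ x, b (b x) = x) →
    (∀ x, a x ≠ x) → (∀ x, b x ≠ x) → ∀ x, b (((a * b) ^ m) x) ≠ x := by
  induction m with
  | zero => intro a b _ _ _ hb x; simpa using hb x
  | succ m ih =>
    intro a b ha hb ha' hb' x h
    apply ih b a hb ha hb' ha' (b x)
    have h1 : ∀ m : ℕ, ((b * a) ^ m) (b x) = b (((a * b) ^ m) x) := by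
      intro m
      induction m with
      | zero => rfl
      | succ m ih => rw [pow_succ', pow_succ', Equiv.Perm.mul_apply, ih]; simp
    rw [h1]
    have h2 : ((a * b) ^ (m + 1)) x = b x := by
      rw [← h, hb]; simpa using h
    rw [pow_succ'] at h2
    simpa using h2

/-- The cell consists of the `n` rotated copies of `x` and their images under `b`. No image under
`b` is a rotated copy, since otherwise a reflection would fix a flag. -/
theorem ncard_dihedral_orbit (ha : ∀ x, a (a x) = x) (hb : ∀ x, b (b x) = x) (ha' : ∀ x, a x ≠ x)
    (hb' : ∀ x, b x ≠ x) (s : Setoid F) (hs : ∀ x, s x (a x) ∧ s x (b x))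
    (hmin : ∀ P : F → Prop, (∀ y, P y → P (a y) ∧ P (b y)) → ∀ x y, s x y → P x → P y)
    (x : F) (n : ℕ) (hn : 0 < n) (hp : Function.minimalPeriod (fun g => a (b g)) x = n) :
    Nat.card {y // s x y} = 2 * n := by
  have hfun : (fun g => a (b g)) = ⇑(a * b) := rfl
  rw [hfun] at hp
  have hper : ((a * b) ^ n) x = x := by
    have := Function.isPeriodicPt_minimalPeriod (⇑(a * b)) x
    rw [hp, Function.IsPeriodicPt, Equiv.Perm.iterate_eq_pow] at this
    exact this
  have hinj : ∀ i < n, ∀ j < n, ((a * b) ^ i) x = ((a * b) ^ j) x → i = j := by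
    intro i hi j hj h
    rw [← Equiv.Perm.iterate_eq_pow, ← Equiv.Perm.iterate_eq_pow] at h
    have := (Function.iterate_eq_iterate_iff_of_lt_minimalPeriod (f := ⇑(a * b)) (x := x)
      (by rw [hp]; exact hi) (by rw [hp]; exact hj)).1 h
    exact this
  have hmem : ∀ k, s x (((a * b) ^ k) x) := by
    intro k
    induction k with
    | zero => exact s.refl x
    | succ k ih =>
      rw [pow_succ', Equiv.Perm.mul_apply]
      exact s.trans ih (s.trans (hs _).2 (hs _).1)
  have hmix : ∀ i j, b (((a * b) ^ i) x) ≠ ((a * b) ^ j) x := by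
    intro i j h
    -- The dihedral relation: conjugation by `b` inverts the rotation.
    have e1 : ∀ k y, ((a * b) ^ k) (b (((a * b) ^ k) y)) = b y := by
      intro k
      induction k with
      | zero => intro y; rfl
      | succ k ih =>
        intro y
        rw [pow_succ (a * b) k, Equiv.Perm.mul_apply]
        have : (a * b) (b ((((a * b) ^ k) * (a * b)) y)) = b (((a * b) ^ k) y) := by
          rw [← pow_succ, pow_succ', Equiv.Perm.mul_apply, Equiv.Perm.mul_apply,
            Equiv.Perm.mul_apply, hb, ha]
        rw [this, ih]
    have h2 := congrArg ((a * b) ^ i) h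
    rw [e1, ← Equiv.Perm.mul_apply, ← pow_add] at h2
    have := reflection_ne (i + j) a b ha hb ha' hb' x
    rw [← h2, hb] at this
    exact this rfl
  let φ : Fin n × Bool → {y // s x y} := fun p =>
    ⟨if p.2 then b (((a * b) ^ (p.1 : ℕ)) x) else ((a * b) ^ (p.1 : ℕ)) x, by
      split
      · exact s.trans (hmem _) (hs _).2
      · exact hmem _⟩
  have hφ : Function.Bijective φ := by
    constructor
    · rintro ⟨i, p⟩ ⟨j, q⟩ h
      have h := congrArg Subtype.val h
      cases p <;> cases q <;> simp only [φ, if_true, Bool.false_eq_true, if_false] at h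
      · rw [Fin.ext (hinj _ i.2 _ j.2 h)]
      · exact absurd h.symm (hmix _ _)
      · exact absurd h (hmix _ _)
      · rw [Fin.ext (hinj _ i.2 _ j.2 (b.injective h))]
    · rintro ⟨y, hy⟩
      have hmod : ∀ k, ((a * b) ^ k) x = ((a * b) ^ (k % n)) x := by
        intro k
        conv_lhs => rw [← Nat.mod_add_div k n, pow_add, pow_mul, Equiv.Perm.mul_apply]
        congr 1
        induction k / n with
        | zero => rfl
        | succ m ih => rw [pow_succ, Equiv.Perm.mul_apply, hper, ih]
      have key : ∃ k, y = ((a * b) ^ k) x ∨ y = b (((a * b) ^ k) x) := by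
        refine hmin (fun y => ∃ k, y = ((a * b) ^ k) x ∨ y = b (((a * b) ^ k) x)) ?_ x y hy
          ⟨0, Or.inl rfl⟩
        rintro z ⟨k, rfl | rfl⟩
        -- Applying `a` lowers the exponent by one; modulo the period `n` the exponent `k - 1` is
        -- written `k + (n - 1)`.
        · refine ⟨⟨k + (n - 1), Or.inr ?_⟩, ⟨k, Or.inr rfl⟩⟩
          have : ((a * b) ^ k) x = (a * b) (((a * b) ^ (k + (n - 1))) x) := by
            rw [← Equiv.Perm.mul_apply, ← pow_succ', show k + (n - 1) + 1 = k + n by omega,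
              pow_add, Equiv.Perm.mul_apply, hper]
          rw [this, Equiv.Perm.mul_apply, ha]
        · exact ⟨⟨k + 1, Or.inl (by rw [pow_succ']; rfl)⟩, ⟨k, Or.inl (hb _)⟩⟩
      obtain ⟨k, hk | hk⟩ := key
      · exact ⟨(⟨k % n, Nat.mod_lt _ hn⟩, false), Subtype.ext (by simp [φ, hk, ← hmod])⟩
      · exact ⟨(⟨k % n, Nat.mod_lt _ hn⟩, true), Subtype.ext (by simp [φ, hk, ← hmod])⟩
  rw [← Nat.card_congr (Equiv.ofBijective φ hφ)]
  simp [mul_comm]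

end Dihedral

theorem card_eq_mul_card_quotient {F : Type*} [Finite F] (s : Setoid F) (n : ℕ)
    (h : ∀ x, Nat.card {y // s x y} = n) :
    Nat.card F = n * Nat.card (Quotient s) := by
  have e := Equiv.sigmaFiberEquiv (Quotient.mk s)
  have h2 : ∀ q : Quotient s, Nonempty ({x // Quotient.mk s x = q} ≃ Fin n) := by
    intro q
    induction q using Quotient.inductionOn with
    | h x =>
      have : Nat.card {y // Quotient.mk s y = Quotient.mk s x} = n := by
        rw [← h x]
        refine Nat.card_congr (Equiv.subtypeEquivRight fun y => ?_)
        rw [Quotient.eq]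
        exact ⟨s.symm, s.symm⟩
      rw [← this]
      exact ⟨Finite.equivFin _⟩
  rw [← Nat.card_congr e,
    Nat.card_congr (Equiv.sigmaCongrRight fun q => (h2 q).some),
    Nat.card_congr (Equiv.sigmaEquivProd _ _), Nat.card_prod, Nat.card_fin, mul_comm]

theorem card_eq_mul_numCells (i j k : Fin 3) (hj : j ≠ i) (hk : k ≠ i)
    (hjk : ∀ m, m ≠ i → m = j ∨ m = k) (n : ℕ) (hn : 0 < n)
    (h : ∀ x, Function.minimalPeriod (fun g => M.r j (M.r k g)) x = n) :
    Nat.card F = 2 * n * M.numCells i := by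
  have := M.finite
  refine card_eq_mul_card_quotient (M.cell i) _ fun x => ?_
  refine ncard_dihedral_orbit (M.invol j) (M.invol k) (M.no_fix j) (M.no_fix k) _
    (fun x => ⟨M.cell_r hj x, M.cell_r hk x⟩) ?_ x n hn (h x)
  intro P hP x y hxy
  refine M.cell_induction ?_ hxy
  intro m hm y hy
  rcases hjk m hm with rfl | rfl
  · exact (hP y hy).1
  · exact (hP y hy).2

theorem card_eq_four_mul_numCells : Nat.card F = 4 * M.numCells 1 := by
  refine M.card_eq_mul_numCells 1 0 2 (by decide) (by decide) (by decide) 2 (by norm_num)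
    fun x => ?_
  have := Fact.mk Nat.prime_two
  refine Function.minimalPeriod_eq_prime ?_ (M.no_fix_edge x)
  change M.r 0 (M.r 2 (M.r 0 (M.r 2 x))) = x
  rw [M.comm, M.invol, M.invol]

variable {M}

theorem IsEquivelar.card_vertices {p q : ℕ} (h : M.IsEquivelar p q) (hq : 0 < q) :
    Nat.card F = 2 * q * M.numCells 0 :=
  M.card_eq_mul_numCells 0 1 2 (by decide) (by decide) (by decide) q hq fun x => (h x).2

theorem IsEquivelar.card_faces {p q : ℕ} (h : M.IsEquivelar p q) (hp : 0 < p) :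
    Nat.card F = 2 * p * M.numCells 2 :=
  M.card_eq_mul_numCells 2 0 1 (by decide) (by decide) (by decide) p hp fun x => (h x).1

/-- There are `n` vertices, `7n/2` edges and `7n/3` faces. -/
theorem IsEquivelar.eulerChar (h : M.IsEquivelar 3 7) {n : ℕ} (hn : Nat.card F = 14 * n) :
    6 * M.eulerChar = -(n : ℤ) := by
  have h0 := h.card_vertices (by norm_num)
  have h1 := M.card_eq_four_mul_numCells
  have h2 := h.card_faces (by norm_num)
  unfold FlagMap.eulerChar
  omega

/-! ### Labellings -/

variable {V : Type*} {T : TypeGraph V} {l : F → V}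

theorem labelGroup_le_aut : M.labelGroup l ≤ M.aut := fun _ h => h.1

theorem IsLabelling.aut_label (h : M.IsLabelling T l) {φ : Equiv.Perm F} (hφ : φ ∈ M.aut) {x : F}
    (hx : l (φ x) = l x) : φ ∈ M.labelGroup l := by
  refine ⟨hφ, fun y => ?_⟩
  refine M.connected_induction (P := fun y => l (φ y) = l y) ?_ hx y
  intro i y hy
  rw [M.aut_r hφ, h.1, h.1, hy]

theorem IsLabelling.exists_mem (h : M.IsLabelling T l) {x y : F} (hxy : l x = l y) :
    ∃ φ ∈ M.labelGroup l, φ x = y := by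
  obtain ⟨φ, hφ, e⟩ := h.2 x y hxy
  exact ⟨φ, h.aut_label hφ (x := x) (by rw [e, hxy]), e⟩

theorem IsTypeLabelling.isLabelling (h : M.IsTypeLabelling T l) : M.IsLabelling T l :=
  ⟨h.2.1, fun f g => (h.2.2 f g).1⟩

theorem IsTypeLabelling.labelGroup_eq (h : M.IsTypeLabelling T l) : M.labelGroup l = M.aut := by
  refine le_antisymm labelGroup_le_aut fun φ hφ => ⟨hφ, fun f => ?_⟩
  exact ((h.2.2 f (φ f)).2 ⟨φ, hφ, rfl⟩).symm

/-! ### Isomorphisms -/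

/-- `ψ` is an isomorphism from `M` to `N`. -/
def IsIso {X Y : Type*} (M : FlagMap X) (N : FlagMap Y) (ψ : X ≃ Y) : Prop :=
  ∀ i x, ψ (M.r i x) = N.r i (ψ x)

namespace IsIso

variable {X Y : Type*} {M : FlagMap X} {N : FlagMap Y} {ψ : X ≃ Y}

theorem symm (h : M.IsIso N ψ) : N.IsIso M ψ.symm := by
  intro i y
  rw [Equiv.symm_apply_eq, h, Equiv.apply_symm_apply]

theorem cell (h : M.IsIso N ψ) {i : Fin 3} {x y : X} (hxy : M.cell i x y) :
    N.cell i (ψ x) (ψ y) := by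
  refine M.cell_induction (P := fun y => N.cell i (ψ x) (ψ y)) ?_ hxy (N.cell_refl _)
  intro j hj y hy
  rw [h]
  exact N.cell_step hj hy

theorem cell_iff (h : M.IsIso N ψ) {i : Fin 3} {x y : X} :
    N.cell i (ψ x) (ψ y) ↔ M.cell i x y :=
  ⟨fun hxy => by simpa using h.symm.cell hxy, h.cell⟩

theorem conj_mem (h : M.IsIso N ψ) {φ : Equiv.Perm X} (hφ : φ ∈ M.aut) :
    ψ.permCongr φ ∈ N.aut := by
  rw [mem_aut_iff]
  intro i y
  simp only [Equiv.permCongr_apply]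
  rw [h.symm, M.aut_r hφ, h]

theorem sameOrbit (h : M.IsIso N ψ) {x y : X} (hxy : M.SameOrbit x y) :
    N.SameOrbit (ψ x) (ψ y) := by
  obtain ⟨φ, hφ, rfl⟩ := hxy
  exact ⟨_, h.conj_mem hφ, by simp⟩

theorem isLabelling (h : M.IsIso N ψ) {V : Type*} {T : TypeGraph V} {l : Y → V}
    (hl : N.IsLabelling T l) : M.IsLabelling T (l ∘ ψ) := by
  refine ⟨fun i f => by simp [h i f, hl.1], fun f g hfg => ?_⟩
  simpa using h.symm.sameOrbit (hl.2 _ _ hfg)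

theorem minimalPeriod_eq (h : M.IsIso N ψ) (i j : Fin 3) (x : X) :
    Function.minimalPeriod (fun g => M.r i (M.r j g)) x =
      Function.minimalPeriod (fun g => N.r i (N.r j g)) (ψ x) := by
  have hs : Function.Semiconj ψ (fun g => M.r i (M.r j g)) (fun g => N.r i (N.r j g)) :=
    fun g => by simp [h _ _]
  rw [Function.minimalPeriod_eq_minimalPeriod_iff]
  intro n
  have := (hs.iterate_right n) x
  simp only [Function.IsPeriodicPt, Function.IsFixedPt]
  rw [← this]
  exact ψ.injective.eq_iff.symm

theorem codegree (h : M.IsIso N ψ) (x : X) : M.codegree x = N.codegree (ψ x) :=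
  h.minimalPeriod_eq 0 1 x

theorem degree (h : M.IsIso N ψ) (x : X) : M.degree x = N.degree (ψ x) :=
  h.minimalPeriod_eq 1 2 x

theorem isEquivelar (h : M.IsIso N ψ) {p q : ℕ} (he : N.IsEquivelar p q) : M.IsEquivelar p q :=
  fun x => ⟨(h.codegree x).trans (he _).1, (h.degree x).trans (he _).2⟩

/-- Conjugation by an isomorphism identifies the label groups. -/
def labelGroupEquiv (h : M.IsIso N ψ) {V : Type*} (l : Y → V) :
    M.labelGroup (l ∘ ψ) ≃* N.labelGroup l where
  toFun φ := ⟨ψ.permCongr φ.1, h.conj_mem φ.2.1, fun y => by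
    have := φ.2.2 (ψ.symm y)
    simpa using this⟩
  invFun φ := ⟨ψ.symm.permCongr φ.1, h.symm.conj_mem φ.2.1, fun y => by
    have := φ.2.2 (ψ y)
    simpa using this⟩
  left_inv φ := by ext; simp
  right_inv φ := by ext; simp
  map_mul' φ φ' := by ext; simp

end IsIso

/-- A relation between the flags of two maps that is compatible with all adjacencies and one-to-one
comes from an isomorphism. -/
theorem exists_isIso_of_rel {X Y : Type*} (M : FlagMap X) (N : FlagMap Y) (R : X → Y → Prop)
    (hR : ∀ i x y, R x y → R (M.r i x) (N.r i y)) (hl : ∀ x y y', R x y → R x y' → y = y')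
    (hr : ∀ x x' y, R x y → R x' y → x = x') (x₀ : X) (y₀ : Y) (h₀ : R x₀ y₀) :
    ∃ ψ : X ≃ Y, M.IsIso N ψ ∧ ∀ x y, R x y → ψ x = y := by
  have h1 : ∀ x, ∃ y, R x y :=
    M.connected_induction (P := fun x => ∃ y, R x y) (fun i x ⟨y, hy⟩ => ⟨_, hR i x y hy⟩) ⟨_, h₀⟩
  have h2 : ∀ y, ∃ x, R x y :=
    N.connected_induction (P := fun y => ∃ x, R x y) (fun i y ⟨x, hx⟩ => ⟨_, hR i x y hx⟩) ⟨_, h₀⟩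
  choose f hf using h1
  choose g hg using h2
  refine ⟨⟨f, g, fun x => hr _ _ _ (hg _) (hf x), fun y => hl _ _ _ (hf _) (hg y)⟩, ?_, ?_⟩
  · intro i x
    exact hl _ _ _ (hf _) (hR i _ _ (hf x))
  · intro x y h
    exact hl _ _ _ (hf x) h

end FlagMap

open FlagMap

/-! ### Voltage maps -/

section Voltage

variable {G V : Type*} [Group G]

/-- The adjacencies of a voltage map over the graph `T` with voltages `ν`. -/
def voltageAdj (T : Fin 3 → V → V) (ν : Fin 3 → V → G) (i : Fin 3) (x : G × V) : G × V :=
  (x.1 * ν i x.2, T i x.2)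

/-- The existence of a path between two flags of a voltage map. -/
abbrev VoltageReach (T : Fin 3 → V → V) (ν : Fin 3 → V → G) : G × V → G × V → Prop :=
  Relation.ReflTransGen (fun a b => ∃ i, voltageAdj T ν i a = b)

theorem voltageAdj_voltageAdj {T : Fin 3 → V → V} {ν : Fin 3 → V → G}
    (hinv : ∀ i v, T i (T i v) = v ∧ ν i v * ν i (T i v) = 1) (i : Fin 3) (x : G × V) :
    voltageAdj T ν i (voltageAdj T ν i x) = x := by
  obtain ⟨g, v⟩ := x
  unfold voltageAdj
  dsimp only
  rw [mul_assoc, (hinv i v).1, (hinv i v).2, mul_one]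

theorem voltageReach_symm {T : Fin 3 → V → V} {ν : Fin 3 → V → G}
    (hinv : ∀ i v, T i (T i v) = v ∧ ν i v * ν i (T i v) = 1) {x y : G × V}
    (h : VoltageReach T ν x y) : VoltageReach T ν y x := by
  induction h with
  | refl => exact Relation.ReflTransGen.refl
  | tail _ h ih =>
    obtain ⟨i, rfl⟩ := h
    exact Relation.ReflTransGen.head ⟨i, voltageAdj_voltageAdj hinv i _⟩ ih

/-- The conditions under which voltages on a graph with vertex set `V` define a map. -/
structure IsVoltage (T : Fin 3 → V → V) (ν : Fin 3 → V → G) : Prop where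
  invol : ∀ i v, T i (T i v) = v ∧ ν i v * ν i (T i v) = 1
  no_fix : ∀ i v, T i v = v → ν i v ≠ 1
  comm : ∀ v, T 0 (T 2 v) = T 2 (T 0 v) ∧ ν 2 v * ν 0 (T 2 v) = ν 0 v * ν 2 (T 0 v)
  no_fix_edge : ∀ v, T 0 (T 2 v) = v → ν 2 v * ν 0 (T 2 v) ≠ 1
  /-- Every vertex is reached from a given one, with trivial voltage. -/
  reach : ∃ v₀, (∀ v, VoltageReach T ν (1, v₀) (1, v)) ∧
    ∀ g, VoltageReach T ν (1, v₀) (g, v₀)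

theorem voltageAdj_mul (T : Fin 3 → V → V) (ν : Fin 3 → V → G) (i : Fin 3) (g h : G) (v : V) :
    voltageAdj T ν i (g * h, v) =
      (g * (voltageAdj T ν i (h, v)).1, (voltageAdj T ν i (h, v)).2) := by
  simp [voltageAdj, mul_assoc]

theorem voltageAdj_translate {T : Fin 3 → V → V} {ν : Fin 3 → V → G} (g : G) {x y : G × V}
    (h : VoltageReach T ν x y) :
    VoltageReach T ν (g * x.1, x.2) (g * y.1, y.2) := by
  refine Relation.ReflTransGen.lift (fun x : G × V => (g * x.1, x.2)) ?_ _ _ h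
  rintro a b ⟨i, rfl⟩
  exact ⟨i, voltageAdj_mul T ν i g a.1 a.2⟩

/-- The map with flag set `G × V` given by voltages. -/
def voltageMap [Finite G] [Finite V] {T : Fin 3 → V → V} {ν : Fin 3 → V → G} (h : IsVoltage T ν) :
    FlagMap (G × V) where
  r i := Function.Involutive.toPerm (voltageAdj T ν i) (voltageAdj_voltageAdj h.invol i)
  finite := inferInstance
  nonempty := ⟨(1, h.reach.choose)⟩
  invol i x := voltageAdj_voltageAdj h.invol i x
  no_fix i x hx := by
    have hx : voltageAdj T ν i x = x := hx
    exact h.no_fix i x.2 (congrArg Prod.snd hx) (by simpa [voltageAdj] using congrArg Prod.fst hx)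
  comm x := by
    change voltageAdj T ν 0 (voltageAdj T ν 2 x) = voltageAdj T ν 2 (voltageAdj T ν 0 x)
    unfold voltageAdj
    dsimp only
    rw [mul_assoc, mul_assoc, (h.comm x.2).1, (h.comm x.2).2]
  no_fix_edge x hx := by
    have hx : voltageAdj T ν 0 (voltageAdj T ν 2 x) = x := hx
    exact h.no_fix_edge x.2 (congrArg Prod.snd hx)
      (by simpa [voltageAdj, mul_assoc] using congrArg Prod.fst hx)
  connected := by
    obtain ⟨v₀, h1, h2⟩ := h.reach
    have h3 : ∀ x, VoltageReach T ν (1, v₀) x := by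
      rintro ⟨g, v⟩
      refine (h2 g).trans ?_
      simpa using voltageAdj_translate g (h1 v)
    exact fun x y => (voltageReach_symm h.invol (h3 x)).trans (h3 y)

/-- A sufficient condition for connectedness: the voltages generate `G`, and trivial voltages
connect all vertices. -/
theorem reach_of_closure {T : Fin 3 → V → V} {ν : Fin 3 → V → G}
    (hinv : ∀ i v, T i (T i v) = v ∧ ν i v * ν i (T i v) = 1) (v₀ : V)
    (h1 : ∀ v, VoltageReach T ν (1, v₀) (1, v))
    (hK : ∀ K : Subgroup G, (∀ i v, ν i v ∈ K) → K = ⊤) :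
    ∃ v₀, (∀ v, VoltageReach T ν (1, v₀) (1, v)) ∧ ∀ g, VoltageReach T ν (1, v₀) (g, v₀) := by
  refine ⟨v₀, h1, fun g => ?_⟩
  have hg : g ∈ Subgroup.closure (Set.range fun p : Fin 3 × V => ν p.1 p.2) := by
    rw [hK (Subgroup.closure (Set.range fun p : Fin 3 × V => ν p.1 p.2))
      fun i v => Subgroup.subset_closure ⟨(i, v), rfl⟩]
    exact Subgroup.mem_top g
  induction hg using Subgroup.closure_induction with
  | mem g hg =>
    obtain ⟨⟨i, v⟩, rfl⟩ := hg
    refine (h1 v).trans (Relation.ReflTransGen.head ⟨i, rfl⟩ ?_)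
    have := voltageAdj_translate (ν i v) (voltageReach_symm hinv (h1 (T i v)))
    simp only [mul_one] at this
    exact (show voltageAdj T ν i (1, v) = (ν i v, T i v) by simp [voltageAdj]) ▸ this
  | one => exact Relation.ReflTransGen.refl
  | mul g g' _ _ e e' => exact e.trans (by simpa using voltageAdj_translate g e')
  | inv g _ e => simpa using voltageReach_symm hinv (voltageAdj_translate g⁻¹ e)

/-- Left translation of the flags of a voltage map. -/
def translation (V : Type*) (g : G) : Equiv.Perm (G × V) :=
  (Equiv.mulLeft g).prodCongr (Equiv.refl V)

@[simp] theorem translation_apply (g g' : G) (v : V) : translation V g (g', v) = (g * g', v) := rfl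

/-- Left translation as a homomorphism. -/
def translationHom (G V : Type*) [Group G] : G →* Equiv.Perm (G × V) where
  toFun := translation V
  map_one' := by ext x <;> simp [translation]
  map_mul' g g' := by ext x <;> simp [translation, mul_assoc]

theorem orderOf_translation [Nonempty V] (g : G) : orderOf (translation V g) = orderOf g := by
  refine orderOf_injective (translationHom G V) ?_ g
  intro g g' hg
  have := DFunLike.congr_fun hg (1, Classical.arbitrary V)
  simpa [translationHom] using this

variable [Finite G] [Finite V] {T : Fin 3 → V → V} {ν : Fin 3 → V → G} (h : IsVoltage T ν)

@[simp] theorem voltageMap_r (i : Fin 3) (g : G) (v : V) :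
    (voltageMap h).r i (g, v) = (g * ν i v, T i v) := rfl

theorem translation_mem_aut (g : G) : translation V g ∈ (voltageMap h).aut := by
  rw [FlagMap.mem_aut_iff]
  rintro i ⟨g', v⟩
  simp [mul_assoc]

theorem translation_mem {W : Type*} (L : V → W) (g : G) :
    translation V g ∈ (voltageMap h).labelGroup (fun x => L x.2) :=
  ⟨translation_mem_aut h g, fun _ => rfl⟩

/-- Composing the projection to the vertices with an isomorphism of graphs gives a labelling. -/
theorem voltageMap_isLabelling {W : Type*} {L : V → W} (hL : Function.Injective L)
    {T' : TypeGraph W} (hT : ∀ i v, L (T i v) = T' i (L v)) :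
    (voltageMap h).IsLabelling T' (fun x => L x.2) := by
  refine ⟨fun i x => hT i x.2, ?_⟩
  rintro ⟨g, v⟩ ⟨g', v'⟩ hx
  obtain rfl := hL hx
  exact ⟨translation V (g' * g⁻¹), translation_mem_aut h _, by simp⟩

/-- The label group of a voltage map is the group of the voltages. -/
noncomputable def voltageMapLabelGroup {W : Type*} {L : V → W} (hL : Function.Injective L) :
    G ≃* (voltageMap h).labelGroup (fun x => L x.2) :=
  MulEquiv.ofBijective
    ((translationHom G V).codRestrict _ fun g => translation_mem h L g) (by
    constructor
    · intro g g' hg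
      have : g * 1 = g' * 1 := congrArg (fun φ => (φ.1 (1, h.reach.choose)).1) hg
      simpa using this
    · rintro ⟨φ, hφ⟩
      have h1 := hL (hφ.2 (1, h.reach.choose))
      refine ⟨(φ (1, h.reach.choose)).1, Subtype.ext ?_⟩
      refine (voltageMap h).aut_ext (translation_mem_aut h _) hφ.1 (x := (1, h.reach.choose)) ?_
      change ((φ (1, h.reach.choose)).1 * 1, h.reach.choose) = φ (1, h.reach.choose)
      rw [mul_one]
      exact Prod.ext rfl h1.symm)

end Voltage

/-! ### Labelled maps as voltage maps over their label groups -/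

namespace FlagMap

variable {F V : Type*} {M : FlagMap F} {T : TypeGraph V} {l : F → V}

/-- Every labelled map is a voltage map over its label group: `p` selects a flag for each label. -/
theorem IsLabelling.exists_voltage (h : M.IsLabelling T l) (p : V → F) (hp : ∀ v, l (p v) = v) :
    ∃ (ν : Fin 3 → V → M.labelGroup l) (ψ : M.labelGroup l × V ≃ F),
      (∀ g v, ψ (g, v) = g.1 (p v)) ∧
      (∀ i x, ψ (voltageAdj (fun i => T i) ν i x) = M.r i (ψ x)) ∧
      (∀ i v, p (T i v) = M.r i (p v) → ν i v = 1) := by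
  have h1 : ∀ i v, ∃ g : M.labelGroup l, g.1 (p (T i v)) = M.r i (p v) := by
    intro i v
    obtain ⟨φ, hφ, e⟩ := h.exists_mem (x := p (T i v)) (y := M.r i (p v)) (by rw [hp, h.1, hp])
    exact ⟨⟨φ, hφ⟩, e⟩
  choose ν hν using h1
  -- Injectivity is the freeness of the action; surjectivity is its transitivity on each label
  -- class.
  have hbij : Function.Bijective (fun x : M.labelGroup l × V => x.1.1 (p x.2)) := by
    constructor
    · rintro ⟨g, v⟩ ⟨g', v'⟩ e
      have e' := congrArg l e
      simp only [g.2.2, g'.2.2, hp] at e'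
      subst e'
      rw [Subtype.ext (M.aut_ext g.2.1 g'.2.1 e)]
    · intro x
      obtain ⟨φ, hφ, e⟩ := h.exists_mem (x := p (l x)) (y := x) (hp _)
      exact ⟨(⟨φ, hφ⟩, l x), e⟩
  refine ⟨ν, Equiv.ofBijective _ hbij, fun g v => rfl, ?_, ?_⟩
  · rintro i ⟨g, v⟩
    change (g.1 * (ν i v).1) (p (T i v)) = M.r i (g.1 (p v))
    rw [Equiv.Perm.mul_apply, hν, M.aut_r g.2.1]
  · intro i v e
    refine Subtype.ext (M.aut_ext (ν i v).2.1 M.aut.one_mem (x := p (T i v)) ?_)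
    rw [hν, e]
    rfl

/-- In a connected voltage map the voltages generate the group. -/
theorem closure_eq_top_of_voltage {G : Type*} [Group G] (M : FlagMap F) {T : Fin 3 → V → V}
    {ν : Fin 3 → V → G} (ψ : G × V ≃ F) (hψ : ∀ i x, ψ (voltageAdj T ν i x) = M.r i (ψ x))
    (K : Subgroup G) (hK : ∀ i v, ν i v ∈ K) : K = ⊤ := by
  rw [Subgroup.eq_top_iff']
  intro g
  obtain ⟨x⟩ := M.nonempty
  -- The left coset of `K` containing the group coordinate does not change along adjacencies, so by
  -- connectedness there is only one coset.
  have key : ∀ y, (ψ.symm y).1⁻¹ * (ψ.symm x).1 ∈ K := by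
    refine M.connected_induction (P := fun y => (ψ.symm y).1⁻¹ * (ψ.symm x).1 ∈ K) ?_ (x := x) ?_
    · intro i y hy
      obtain ⟨z, rfl⟩ := ψ.surjective y
      rw [← hψ, Equiv.symm_apply_apply]
      rw [Equiv.symm_apply_apply] at hy
      simpa [voltageAdj, mul_assoc] using K.mul_mem (K.inv_mem (hK i z.2)) hy
    · simp
  have := key (ψ ((ψ.symm x).1 * g⁻¹, (ψ.symm x).2))
  simpa using this

end FlagMap

namespace FlagMap

variable {X : Type*} {M : FlagMap X}

theorem triangle_relation {x : X} (h : M.codegree x = 3) :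
    M.r 0 (M.r 1 (M.r 0 (M.r 1 (M.r 0 (M.r 1 x))))) = x := by
  have := Function.isPeriodicPt_minimalPeriod (fun g => M.r 0 (M.r 1 g)) x
  rw [show Function.minimalPeriod (fun g => M.r 0 (M.r 1 g)) x = 3 from h] at this
  exact this

theorem triangle_braid {x : X} (h : M.codegree x = 3) :
    M.r 1 (M.r 0 (M.r 1 x)) = M.r 0 (M.r 1 (M.r 0 x)) := by
  conv_rhs => rw [← triangle_relation h]
  simp only [M.invol]

end FlagMap

/-! ### Rebelting -/

namespace IsRebelting

variable {X Y : Type*} {M : FlagMap X} {B : Set X} {N : FlagMap Y} {E : Set Y} {e : Y → X}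
  (h : IsRebelting M B N E e)

include h

theorem e_mem (y : Y) : e y ∈ B := h.range_eq ▸ ⟨y, rfl⟩

theorem exists_eq {x : X} (hx : x ∈ B) : ∃ y, e y = x := by rwa [← h.range_eq] at hx

theorem r_two_mem {x : X} (hx : x ∉ B) : M.r 2 x ∈ B := by
  have := (h.fan x hx).1
  exact (h.faces _).2.1 this

theorem r_two_r_one_mem {x : X} (hx : M.r 2 x ∉ B) : M.r 2 (M.r 1 x) ∈ B := by
  have := (h.fan _ hx).2.1
  simp only [Function.iterate_succ, Function.iterate_zero, Function.comp, M.invol, id] at this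
  exact (h.faces _).2.1 this

theorem r_two_r_zero_mem (x : X) : M.r 2 (M.r 0 x) ∈ B ↔ M.r 2 x ∈ B := by
  rw [← M.comm]; exact (h.faces _).1

theorem e_ne {y y' : Y} (hy' : y' ∈ E) : e y ≠ M.r 2 (e y') := fun hc =>
  (h.mem_bounding y').1 hy' (hc ▸ h.e_mem y)

theorem r_zero_mem_iff (y : Y) : N.r 0 y ∈ E ↔ y ∈ E := by
  rw [h.mem_bounding, h.mem_bounding, h.map_zero, h.r_two_r_zero_mem]

/-- This and the lemmas below on sides, apices and flags off the belts express every adjacency of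
`M` through `N` and `E` alone; that is why the inverse of rebelting is unique. -/
theorem r_one_of_base {y : Y} (hy : y ∈ E) : M.r 1 (e y) = e (N.r 0 (N.r 1 y)) := by
  rw [h.map_zero, h.map_one_base y ((h.mem_bounding y).1 hy), M.invol]

theorem apex_of_side {x : X} (hx : M.r 2 (M.r 1 x) ∉ B) :
    M.r 2 (M.r 1 (M.r 0 x)) ∈ B := by
  have h1 : M.r 2 (M.r 0 (M.r 1 x)) ∉ B := fun hc => hx ((h.r_two_r_zero_mem _).1 hc)
  have h2 := h.r_two_r_one_mem h1
  rw [triangle_braid (h.equivelar x).1, h.r_two_r_zero_mem] at h2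
  exact h2

theorem r_one_of_side' {y : Y} (h1 : M.r 2 (e y) ∈ B) (h2 : M.r 2 (M.r 1 (e y)) ∉ B) :
    M.r 1 (e y) = e (N.r 1 (N.r 0 y)) := by
  rw [h.map_one_apex, h.map_zero, M.invol]
  · rwa [h.map_zero, h.r_two_r_zero_mem]
  · rw [h.map_zero]; exact h.apex_of_side h2

/-- Whether a side flag lies at an endpoint of the base can be read off in `N`: one rotation step
inside the new triangle must lead to a bounding edge. -/
theorem side_iff {y : Y} (h1 : M.r 2 (e y) ∈ B) :
    M.r 2 (M.r 1 (e y)) ∉ B ↔ N.r 1 (N.r 0 y) ∈ E := by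
  constructor
  · intro h2
    rw [h.mem_bounding, ← h.r_one_of_side' h1 h2]
    exact h2
  · intro h2 h3
    rw [h.mem_bounding] at h2
    have h4 : M.r 2 (e (N.r 0 y)) ∈ B := by rwa [h.map_zero, h.r_two_r_zero_mem]
    by_cases h5 : M.r 2 (M.r 1 (e (N.r 0 y))) ∈ B
    · rw [h.map_one_apex _ h4 h5, h.map_zero, M.invol] at h2
      exact h2 h3
    · rw [h.map_one_side _ h4 h5, h.map_zero, ← triangle_braid (h.equivelar _).1, M.invol] at h2
      exact h2 ((h.r_two_r_zero_mem _).2 h3)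

theorem r_one_of_side {y : Y} (h1 : y ∉ E) (h2 : N.r 1 (N.r 0 y) ∈ E) :
    M.r 1 (e y) = e (N.r 1 (N.r 0 y)) := by
  have h1 : M.r 2 (e y) ∈ B := by simpa [h.mem_bounding] using h1
  exact h.r_one_of_side' h1 ((h.side_iff h1).2 h2)

/-- This is where each belt triangle is seen to have a base. Without one, two applications of
`map_one_apex` would make a nontrivial rotation of the triangle fix a flag, because `N.r 1` is an
involution. -/
theorem base_of_apex {y : Y} (h1 : y ∉ E) (h2 : N.r 1 (N.r 0 y) ∉ E) : N.r 1 y ∈ E := by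
  have h1 : M.r 2 (e y) ∈ B := by simpa [h.mem_bounding] using h1
  have h3 : M.r 2 (M.r 1 (e y)) ∈ B := by
    by_contra hc
    exact h2 ((h.side_iff h1).1 hc)
  have h4 := h.map_one_apex y h1 h3
  by_contra hc
  have hc : M.r 2 (e (N.r 1 y)) ∈ B := by simpa [h.mem_bounding] using hc
  by_cases h5 : M.r 2 (M.r 1 (e (N.r 1 y))) ∈ B
  · have h6 := h.map_one_apex (N.r 1 y) hc h5
    rw [N.invol, h4, ← triangle_braid (h.equivelar _).1, M.invol] at h6
    have h8 : Function.minimalPeriod (fun g => M.r 0 (M.r 1 g)) (e y) = 1 :=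
      Function.minimalPeriod_eq_one_iff_isFixedPt.2 h6.symm
    have h9 : Function.minimalPeriod (fun g => M.r 0 (M.r 1 g)) (e y) = 3 := (h.equivelar _).1
    omega
  · rw [h4, M.invol, h.r_two_r_zero_mem] at h5
    exact h5 h1

theorem r_one_of_apex {y : Y} (h1 : y ∉ E) (h2 : N.r 1 (N.r 0 y) ∉ E) :
    M.r 1 (e y) = e (N.r 1 (N.r 0 (N.r 1 y))) := by
  have h3 := h.base_of_apex h1 h2
  have h1' : M.r 2 (e y) ∈ B := by simpa [h.mem_bounding] using h1
  have h4 : M.r 2 (M.r 1 (e y)) ∈ B := by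
    by_contra hc
    exact h2 ((h.side_iff h1').1 hc)
  have h5 := h.r_one_of_base ((h.r_zero_mem_iff _).2 h3)
  rw [h.map_zero, h.map_zero, h.map_one_apex y h1' h4, ← triangle_braid (h.equivelar _).1,
    M.invol, M.r_eq_iff 0] at h5
  rw [h5, M.invol]

theorem r_two_of_side {y : Y} (hy : y ∉ E) : M.r 2 (e y) = e (N.r 2 y) :=
  (h.map_two_side y (by simpa [h.mem_bounding] using hy)).symm

/-- The other flag at the same vertex of the triangle outside the belts. -/
theorem r_one_off {y : Y} (hy : y ∈ E) :
    N.r 1 (N.r 0 (N.r 2 (N.r 1 (N.r 2 (N.r 1 (N.r 2 (N.r 0 (N.r 1 y)))))))) ∈ E ∧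
    M.r 1 (M.r 2 (e y)) =
      M.r 2 (e (N.r 1 (N.r 0 (N.r 2 (N.r 1 (N.r 2 (N.r 1 (N.r 2 (N.r 0 (N.r 1 y)))))))))) := by
  have side : ∀ x ∉ B, M.r 2 x ∈ B ∧ M.r 2 (M.r 1 (M.r 2 x)) ∈ B ∧
      M.r 2 (M.r 1 (M.r 2 (M.r 1 (M.r 2 x)))) ∈ B := by
    intro x hx
    refine ⟨h.r_two_mem hx, (h.faces _).2.1 (h.fan x hx).2.1, (h.faces _).2.1 (h.fan x hx).2.2.1⟩
  -- from a base flag to the apex flag of the middle triangle, and to its base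
  have climb : ∀ z ∈ E, ∃ w ∈ E, w = N.r 1 (N.r 2 (N.r 0 (N.r 1 z))) ∧
      z = N.r 1 (N.r 0 (N.r 2 (N.r 1 w))) ∧ e (N.r 1 w) = M.r 2 (M.r 1 (e z)) := by
    intro z hz
    have hz' := (h.mem_bounding z).1 hz
    obtain ⟨_, s2, s3⟩ := side _ hz'
    rw [M.invol] at s2 s3
    have e1 : M.r 1 (e z) = e (N.r 0 (N.r 1 z)) := h.r_one_of_base hz
    have n1 : N.r 0 (N.r 1 z) ∉ E := by
      rw [h.mem_bounding, ← e1]; exact fun hc => hc s2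
    have e2 : M.r 2 (M.r 1 (e z)) = e (N.r 2 (N.r 0 (N.r 1 z))) := by
      rw [e1, h.r_two_of_side n1]
    have n2 : N.r 2 (N.r 0 (N.r 1 z)) ∉ E := by
      rw [h.mem_bounding, ← e2, M.invol]
      exact fun hc => hc ((h.faces _).2.2 (h.e_mem _))
    have n3 : N.r 1 (N.r 0 (N.r 2 (N.r 0 (N.r 1 z)))) ∉ E := by
      rw [← h.side_iff (by simpa [h.mem_bounding] using n2), ← e2]
      exact fun hc => hc s3
    refine ⟨_, h.base_of_apex n2 n3, rfl, by simp only [N.invol], by rw [N.invol, e2]⟩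
  obtain ⟨w, hw, rfl, -, ew⟩ := climb y hy
  set w := N.r 1 (N.r 2 (N.r 0 (N.r 1 y))) with hwdef
  have hoff : M.r 1 (M.r 2 (e y)) ∉ B := fun hc => (h.mem_bounding y).1 hy ((h.faces _).2.1 hc)
  obtain ⟨y', hy'⟩ := h.exists_eq (h.r_two_mem hoff)
  have hy'E : y' ∈ E := by rw [h.mem_bounding, hy', M.invol]; exact hoff
  obtain ⟨w', hw', -, hyw, ew'⟩ := climb y' hy'E
  -- Of the three belt triangles between two triangles off the belts, `w` belongs to the middle one.
  -- At its apex `map_two_base` leads around the vertex, past the triangle off the belts, to the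
  -- opposite middle triangle. The steps from `y` up to `w` and from `y'` up to `w'` cancel the rest
  -- of the long word, leaving `N.r 2 w = w'`.
  have key := h.map_two_base w ((h.mem_bounding w).1 hw)
  have e3 : M.r 0 (M.r 1 (e w)) = M.r 2 (M.r 1 (e y)) := by
    rw [h.r_one_of_base hw, ← h.map_zero, N.invol, ew]
  have e4 : M.r 0 (M.r 1 (e w')) = M.r 2 (M.r 1 (e y')) := by
    rw [h.r_one_of_base hw', ← h.map_zero, N.invol, ew']
  rw [e3] at key
  simp only [M.invol] at key
  rw [← hy', ← e4] at key
  simp only [M.invol] at key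
  have e5 : N.r 2 w = w' := h.injective key
  have e6 : y' = N.r 1 (N.r 0 (N.r 2 (N.r 1 (N.r 2 w)))) := by rw [e5]; exact hyw
  rw [← e6]
  exact ⟨hy'E, by rw [hy', M.invol]⟩

end IsRebelting

/-- The inverse of rebelting is unique. -/
theorem IsRebelting.exists_isIso {X X' Y : Type*} {M : FlagMap X} {M' : FlagMap X'} {B : Set X}
    {B' : Set X'} {N : FlagMap Y} {E : Set Y} {e : Y → X} {e' : Y → X'}
    (h : IsRebelting M B N E e) (h' : IsRebelting M' B' N E e') :
    ∃ ψ : X ≃ X', M.IsIso M' ψ ∧ ∀ y, ψ (e y) = e' y := by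
  obtain ⟨y₀⟩ := N.nonempty
  -- The flags on belts are the `e y`, and those off belts are reached from bounding flags by `r 2`.
  -- Flags of `M` and `M'` with the same description are matched.
  suffices hR : ∃ ψ : X ≃ X', M.IsIso M' ψ ∧ ∀ x x', ((∃ y, x = e y ∧ x' = e' y) ∨
      ∃ y ∈ E, x = M.r 2 (e y) ∧ x' = M'.r 2 (e' y)) → ψ x = x' by
    obtain ⟨ψ, h1, h2⟩ := hR
    exact ⟨ψ, h1, fun y => h2 _ _ (Or.inl ⟨y, rfl, rfl⟩)⟩
  refine exists_isIso_of_rel M M' _ ?_ ?_ ?_ (e y₀) (e' y₀) (Or.inl ⟨y₀, rfl, rfl⟩)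
  · rintro i _ _ (⟨y, rfl, rfl⟩ | ⟨y, hy, rfl, rfl⟩)
    · fin_cases i
      · exact Or.inl ⟨_, (h.map_zero y).symm, (h'.map_zero y).symm⟩
      · left
        by_cases h1 : y ∈ E
        · exact ⟨_, h.r_one_of_base h1, h'.r_one_of_base h1⟩
        · by_cases h2 : N.r 1 (N.r 0 y) ∈ E
          · exact ⟨_, h.r_one_of_side h1 h2, h'.r_one_of_side h1 h2⟩
          · exact ⟨_, h.r_one_of_apex h1 h2, h'.r_one_of_apex h1 h2⟩
      · by_cases h1 : y ∈ E
        · exact Or.inr ⟨y, h1, rfl, rfl⟩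
        · exact Or.inl ⟨_, h.r_two_of_side h1, h'.r_two_of_side h1⟩
    · fin_cases i
      · refine Or.inr ⟨N.r 0 y, (h.r_zero_mem_iff y).2 hy, ?_, ?_⟩
        · rw [h.map_zero, ← M.comm]; rfl
        · rw [h'.map_zero, ← M'.comm]; rfl
      · exact Or.inr ⟨_, (h.r_one_off hy).1, (h.r_one_off hy).2, (h'.r_one_off hy).2⟩
      · exact Or.inl ⟨y, M.invol _ _, M'.invol _ _⟩
  · rintro x _ _ (⟨y, rfl, rfl⟩ | ⟨y, hy, rfl, rfl⟩) (⟨z, hz, rfl⟩ | ⟨z, hzE, hz, rfl⟩)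
    · rw [h.injective hz]
    · exact absurd hz (h.e_ne hzE)
    · exact absurd hz.symm (h.e_ne hy)
    · rw [h.injective ((M.r 2).injective hz)]
  · rintro _ _ x' (⟨y, rfl, rfl⟩ | ⟨y, hy, rfl, rfl⟩) (⟨z, rfl, hz⟩ | ⟨z, hzE, rfl, hz⟩)
    · rw [h'.injective hz]
    · exact absurd hz (h'.e_ne hzE)
    · exact absurd hz.symm (h'.e_ne hy)
    · rw [h'.injective ((M'.r 2).injective hz)]

/-- Rebelting only depends on the isomorphism class of the resulting map. -/
theorem IsRebelting.congr {X Y Y' : Type*} {M : FlagMap X} {B : Set X} {N : FlagMap Y}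
    {N' : FlagMap Y'} {E : Set Y} {e : Y → X} (h : IsRebelting M B N E e) {ψ : Y' ≃ Y}
    (hψ : N'.IsIso N ψ) : IsRebelting M B N' (ψ ⁻¹' E) (e ∘ ψ) where
  equivelar := h.equivelar
  faces := h.faces
  off_belt := h.off_belt
  fan := h.fan
  injective := h.injective.comp ψ.injective
  range_eq := by rw [Set.range_comp, ψ.range_eq_univ, Set.image_univ, h.range_eq]
  mem_bounding y := h.mem_bounding (ψ y)
  map_zero y := by simp only [Function.comp, hψ _ _, h.map_zero]
  map_one_base y hy := by simp only [Function.comp, hψ _ _]; exact h.map_one_base _ hy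
  map_one_apex y hy hy' := by simp only [Function.comp, hψ _ _]; exact h.map_one_apex _ hy hy'
  map_one_side y hy hy' := by simp only [Function.comp, hψ _ _]; exact h.map_one_side _ hy hy'
  map_two_side y hy := by simp only [Function.comp, hψ _ _]; exact h.map_two_side _ hy
  map_two_base y hy := by simp only [Function.comp, hψ _ _]; exact h.map_two_base _ hy

/-! ### Collapsing -/

theorem length_le_ncard {α : Type*} {D : Set α} (hD : D.Finite) (L : List α) (hL : L.Nodup)
    (h : ∀ x ∈ L, x ∈ D) : L.length ≤ D.ncard := by
  classical
  rw [← List.toFinset_card_of_nodup hL, ← Set.ncard_coe_finset]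
  exact Set.ncard_le_ncard (fun x hx => h x (by simpa using hx)) hD

namespace IsCollapsing

variable {X Y : Type*} {M : FlagMap X} {H : Subgroup (Equiv.Perm X)} {T : Set X} {N : FlagMap Y}
  {S : Set Y} {e : Y → X} (h : IsCollapsing M H T N S e)

include h

theorem e_not_mem (y : Y) : e y ∉ T := by
  have : e y ∈ Tᶜ := h.range_eq ▸ ⟨y, rfl⟩
  exact this

theorem r_mem {x : X} (hx : x ∈ T) {i : Fin 3} (hi : i ≠ 2) : M.r i x ∈ T := by
  obtain ⟨x₀, hx₀⟩ := h.orbit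
  obtain ⟨φ, hφ, hc⟩ := (hx₀ x).1 hx
  exact (hx₀ _).2 ⟨φ, hφ, M.cell_step hi hc⟩

theorem r_mem_iff {x : X} {i : Fin 3} (hi : i ≠ 2) : M.r i x ∈ T ↔ x ∈ T :=
  ⟨fun hx => by simpa [M.invol] using h.r_mem hx hi, fun hx => h.r_mem hx hi⟩

theorem one_edge_zero {x : X} (hx : x ∈ T) (h2 : M.r 2 x ∈ T) : M.r 2 (M.r 1 x) ∉ T := by
  intro hc
  obtain ⟨j, -, hj⟩ := h.one_edge x hx
  have h0 := hj 0 h2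
  have h1 := hj 1 hc
  exact absurd (h0.trans h1.symm) (by decide)

theorem one_edge_iff {x : X} (hx : x ∈ T) (h2 : M.r 2 x ∉ T) :
    M.r 2 (M.r 1 (M.r 0 x)) ∈ T ↔ M.r 2 (M.r 1 x) ∉ T := by
  obtain ⟨j, hj, huniq⟩ := h.one_edge x hx
  constructor
  · intro h3 h4
    exact absurd ((huniq 1 h4).trans (huniq 2 h3).symm) (by decide)
  · intro h3
    fin_cases j
    · exact absurd hj h2
    · exact absurd hj h3
    · exact hj

theorem r_two_r_zero_mem (x : X) : M.r 2 (M.r 0 x) ∈ T ↔ M.r 2 x ∈ T := by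
  rw [← M.comm]; exact h.r_mem_iff (by decide)

/-- On a healed edge `r 0` exchanges the end at the identified vertex with the end at `u` or `v`, so
`S` determines the near flags as well as the far ones. -/
theorem near_iff (y : Y) :
    N.r 0 y ∈ S ↔ M.r 2 (e y) ∈ T ∧ M.r 2 (M.r 1 (M.r 2 (e y))) ∈ T := by
  rw [h.mem_split, h.map_zero, h.r_two_r_zero_mem, ← M.comm]
  refine and_congr_right fun h1 => ?_
  have := h.one_edge_iff h1 (by rw [M.invol]; exact h.e_not_mem y)
  tauto

theorem r_two_mem_iff (y : Y) : M.r 2 (e y) ∈ T ↔ y ∈ S ∨ N.r 0 y ∈ S := by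
  rw [h.near_iff, h.mem_split]; tauto

theorem cell_e_r_two {y : Y} (hy : y ∉ S) : M.cell 0 (e y) (e (N.r 2 y)) := by
  by_cases h1 : M.r 2 (e y) ∈ T
  · rw [h.map_two_near y h1 ((h.near_iff y).1 (((h.r_two_mem_iff y).1 h1).resolve_left hy)).2]
    exact M.cell_step (by decide) (M.cell_step (by decide) (M.cell_step (by decide)
      (M.cell_step (by decide) (M.cell_r (by decide) _))))
  · rw [h.map_two y h1]
    exact M.cell_r (by decide) _

/-- Going around a vertex of `N` without crossing an edge of `S` means staying at one of the two
vertices that were identified. -/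
theorem cell_e {y z : Y}
    (hyz : Relation.ReflTransGen (fun a b => N.r 1 a = b ∨ a ∉ S ∧ N.r 2 a = b) y z) :
    M.cell 0 (e y) (e z) := by
  induction hyz with
  | refl => exact M.cell_refl _
  | tail _ hs ih =>
    rcases hs with rfl | ⟨h1, rfl⟩
    · rw [h.map_one]; exact M.cell_step (by decide) ih
    · exact M.cell_trans ih (h.cell_e_r_two h1)

/-- The two edges doubled at a split vertex are the sides of the same deleted triangle. -/
theorem r_one_far {y z : Y} (hy : y ∈ S) (hz : z ∈ S) (hne : z ≠ y)
    (hyz : Relation.ReflTransGen (fun a b => N.r 1 a = b ∨ a ∉ S ∧ N.r 2 a = b) y z) :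
    M.r 1 (M.r 2 (e y)) = M.r 2 (e z) := by
  by_contra hc
  obtain ⟨hy1, hy2⟩ := (h.mem_split y).1 hy
  obtain ⟨hz1, hz2⟩ := (h.mem_split z).1 hz
  have := M.finite
  set D := {w | M.cell 0 (e y) w ∧ w ∈ T} with hD
  have hfin : D.Finite := Set.toFinite D
  have c1 : M.cell 0 (e y) (M.r 2 (e y)) := M.cell_r (by decide) _
  have c2 : M.cell 0 (e y) (M.r 2 (e z)) := M.cell_step (by decide) (h.cell_e hyz)
  have hy3 : M.r 2 (M.r 2 (e y)) ∉ T := by rw [M.invol]; exact h.e_not_mem y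
  have hz3 : M.r 2 (M.r 2 (e z)) ∉ T := by rw [M.invol]; exact h.e_not_mem z
  have d1 : M.r 2 (e y) ∈ D := ⟨c1, hy1⟩
  have d2 : M.r 1 (M.r 2 (e y)) ∈ D := ⟨M.cell_step (by decide) c1, h.r_mem hy1 (by decide)⟩
  have d3 : M.r 2 (e z) ∈ D := ⟨c2, hz1⟩
  have d4 : M.r 1 (M.r 2 (e z)) ∈ D := ⟨M.cell_step (by decide) c2, h.r_mem hz1 (by decide)⟩
  have n12 : M.r 1 (M.r 2 (e y)) ≠ M.r 2 (e y) := M.no_fix _ _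
  have n34 : M.r 1 (M.r 2 (e z)) ≠ M.r 2 (e z) := M.no_fix _ _
  have n13 : M.r 2 (e y) ≠ M.r 2 (e z) := fun hq => hne (h.injective ((M.r 2).injective hq)).symm
  have n14 : M.r 1 (M.r 2 (e z)) ≠ M.r 2 (e y) := fun hq => hc (by rw [← hq, M.invol])
  have n24 : M.r 1 (M.r 2 (e y)) ≠ M.r 1 (M.r 2 (e z)) := fun hq => n13 ((M.r 1).injective hq)
  have l4 : 4 ≤ D.ncard := length_le_ncard hfin
    [M.r 2 (e y), M.r 1 (M.r 2 (e y)), M.r 2 (e z), M.r 1 (M.r 2 (e z))]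
    (by simp [n12.symm, n13, n14.symm, hc, n24, n34.symm]) (by simp [d1, d2, d3, d4])
  obtain ⟨hle, w, hw, hwT, hw2⟩ : D.ncard ≤ 6 ∧ ∃ w, M.cell 0 (e y) w ∧ w ∈ T ∧ M.r 2 w ∈ T := by
    rcases h.at_vertex (e y) with h1 | h1 | ⟨h1 | h1, h2⟩
    · rw [← hD] at h1; omega
    · rw [← hD] at h1; omega
    · rw [← hD] at h1; exact ⟨by omega, h2⟩
    · rw [← hD] at h1; exact ⟨by omega, h2⟩
  have hw1 := h.one_edge_zero hwT hw2
  -- If the two edges belonged to different deleted triangles, each triangle would contribute two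
  -- flags here with no neighbour in `T` across an edge at this vertex. The adjacent pair required
  -- by `at_vertex` supplies three further flags, making seven where at most six are allowed.
  have far : ∀ x, M.r 2 x ∉ T → M.r 2 (M.r 1 x) ∉ T → x ≠ w ∧ x ≠ M.r 2 w ∧ x ≠ M.r 1 w := by
    intro x h1 h2
    refine ⟨?_, ?_, ?_⟩ <;> rintro rfl
    · exact h1 hw2
    · rw [M.invol] at h1; exact h1 hwT
    · rw [M.invol] at h2; exact h2 hw2
  obtain ⟨a1, a2, a3⟩ := far _ hy3 hy2
  obtain ⟨b1, b2, b3⟩ := far _ hy2 (by rw [M.invol]; exact hy3)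
  obtain ⟨f1, f2, f3⟩ := far _ hz3 hz2
  obtain ⟨g1, g2, g3⟩ := far _ hz2 (by rw [M.invol]; exact hz3)
  have k1 : M.r 2 w ≠ w := M.no_fix _ _
  have k2 : M.r 1 w ≠ w := M.no_fix _ _
  have k3 : M.r 2 w ≠ M.r 1 w := fun hq => hw1 (by rw [← hq, M.invol]; exact hwT)
  have l7 : 7 ≤ D.ncard := length_le_ncard hfin
    [M.r 2 (e y), M.r 1 (M.r 2 (e y)), M.r 2 (e z), M.r 1 (M.r 2 (e z)), w, M.r 2 w, M.r 1 w]
    (by simp [n12.symm, n13, n14.symm, hc, n24, n34.symm, a1, a2, a3, b1, b2, b3, f1, f2, f3, g1,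
          g2, g3, k1.symm, k2.symm, k3])
    (by
      have w1 : w ∈ D := ⟨hw, hwT⟩
      have w2 : M.r 2 w ∈ D := ⟨M.cell_step (by decide) hw, hw2⟩
      have w3 : M.r 1 w ∈ D := ⟨M.cell_step (by decide) hw, h.r_mem hwT (by decide)⟩
      simp [d1, d2, d3, d4, w1, w2, w3])
  omega

theorem near_r_two {y : Y} (hy : N.r 0 y ∈ S) :
    N.r 0 (N.r 2 y) ∈ S ∧ M.r 2 (M.r 1 (M.r 2 (e y))) = M.r 1 (M.r 2 (e (N.r 2 y))) := by
  obtain ⟨h1, h2⟩ := (h.near_iff y).1 hy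
  have h3 := h.map_two_near y h1 h2
  refine ⟨(h.near_iff _).2 ?_, by rw [h3, M.invol, M.invol]⟩
  rw [h3, M.invol, M.invol, M.invol]
  exact ⟨h.r_mem h2 (by decide), h.r_mem h1 (by decide)⟩

/-- The common edge of two deleted triangles leaves no trace in `N`. Its other end is found by going
around the apex of one triangle: `nxt` leads to the other doubled edge at the split vertex. -/
theorem near_r_zero {nxt : Y → Y} (hn : ∀ y ∈ S, nxt y ∈ S ∧ nxt y ≠ y ∧
      Relation.ReflTransGen (fun a b => N.r 1 a = b ∨ a ∉ S ∧ N.r 2 a = b) y (nxt y))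
    {y : Y} (hy : N.r 0 y ∈ S) : M.r 0 (M.r 1 (M.r 2 (e y))) =
      M.r 1 (M.r 2 (e (N.r 0 (nxt (N.r 0 y))))) := by
  obtain ⟨h1, h2⟩ := (h.near_iff y).1 hy
  obtain ⟨n1, n2, n3⟩ := hn _ hy
  have h3 := h.r_one_far hy n1 n2 n3
  rw [h.map_zero, ← M.comm] at h3 ⊢
  rw [← h3, ← triangle_braid (h.triangle _ h1), M.invol]

omit h in
-- The three descriptions are mutually exclusive: outside `T`, in `T` on an outer edge, and in `T`
-- on the edge shared by two deleted triangles. The roles of the two maps are symmetric, so the same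
-- lemma gives both functionality and injectivity of the matching.
theorem rel_unique {X X' Y : Type*} {M : FlagMap X} {M' : FlagMap X'}
    {H : Subgroup (Equiv.Perm X)} {H' : Subgroup (Equiv.Perm X')} {T : Set X} {T' : Set X'}
    {N : FlagMap Y} {S : Set Y} {e : Y → X} {e' : Y → X'} (h : IsCollapsing M H T N S e)
    (_ : IsCollapsing M' H' T' N S e') {x : X} {x' x'' : X'}
    (h1 : (∃ y, x = e y ∧ x' = e' y) ∨
      (∃ y, (y ∈ S ∨ N.r 0 y ∈ S) ∧ x = M.r 2 (e y) ∧ x' = M'.r 2 (e' y)) ∨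
      (∃ y, N.r 0 y ∈ S ∧ x = M.r 1 (M.r 2 (e y)) ∧ x' = M'.r 1 (M'.r 2 (e' y))))
    (h2 : (∃ y, x = e y ∧ x'' = e' y) ∨
      (∃ y, (y ∈ S ∨ N.r 0 y ∈ S) ∧ x = M.r 2 (e y) ∧ x'' = M'.r 2 (e' y)) ∨
      (∃ y, N.r 0 y ∈ S ∧ x = M.r 1 (M.r 2 (e y)) ∧ x'' = M'.r 1 (M'.r 2 (e' y)))) :
    x' = x'' := by
  have t2 : ∀ y, y ∈ S ∨ N.r 0 y ∈ S → M.r 2 (e y) ∈ T := fun y hy => (h.r_two_mem_iff y).2 hy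
  have t3 : ∀ y, N.r 0 y ∈ S → M.r 1 (M.r 2 (e y)) ∈ T := fun y hy =>
    h.r_mem (t2 y (Or.inr hy)) (by decide)
  have t3' : ∀ y, N.r 0 y ∈ S → M.r 2 (M.r 1 (M.r 2 (e y))) ∈ T := fun y hy =>
    ((h.near_iff y).1 hy).2
  rcases h1 with ⟨y, rfl, rfl⟩ | ⟨y, hy, rfl, rfl⟩ | ⟨y, hy, rfl, rfl⟩ <;>
  rcases h2 with ⟨z, hz, rfl⟩ | ⟨z, hz', hz, rfl⟩ | ⟨z, hz', hz, rfl⟩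
  · rw [h.injective hz]
  · exact absurd (hz ▸ t2 z hz') (h.e_not_mem y)
  · exact absurd (hz ▸ t3 z hz') (h.e_not_mem y)
  · exact absurd (hz ▸ t2 y hy) (h.e_not_mem z)
  · rw [h.injective ((M.r 2).injective hz)]
  · have := t3' z hz'
    rw [← hz, M.invol] at this
    exact absurd this (h.e_not_mem y)
  · exact absurd (hz ▸ t3 y hy) (h.e_not_mem z)
  · have := t3' y hy
    rw [hz, M.invol] at this
    exact absurd this (h.e_not_mem z)
  · rw [h.injective ((M.r 2).injective ((M.r 1).injective hz))]

end IsCollapsing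

/-- The inverse of collapsing is unique, provided that at every split vertex the second doubled edge
is reached by going around the vertex. -/
theorem IsCollapsing.exists_isIso {X X' Y : Type*} {M : FlagMap X} {M' : FlagMap X'}
    {H : Subgroup (Equiv.Perm X)} {H' : Subgroup (Equiv.Perm X')} {T : Set X} {T' : Set X'}
    {N : FlagMap Y} {S : Set Y} {e : Y → X} {e' : Y → X'} (h : IsCollapsing M H T N S e)
    (h' : IsCollapsing M' H' T' N S e') {nxt : Y → Y}
    (hn : ∀ y ∈ S, nxt y ∈ S ∧ nxt y ≠ y ∧
      Relation.ReflTransGen (fun a b => N.r 1 a = b ∨ a ∉ S ∧ N.r 2 a = b) y (nxt y)) :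
    ∃ ψ : X ≃ X', M.IsIso M' ψ ∧ ∀ y, ψ (e y) = e' y := by
  obtain ⟨y₀⟩ := N.nonempty
  suffices hR : ∃ ψ : X ≃ X', M.IsIso M' ψ ∧ ∀ x x', ((∃ y, x = e y ∧ x' = e' y) ∨
      (∃ y, (y ∈ S ∨ N.r 0 y ∈ S) ∧ x = M.r 2 (e y) ∧ x' = M'.r 2 (e' y)) ∨
      (∃ y, N.r 0 y ∈ S ∧ x = M.r 1 (M.r 2 (e y)) ∧ x' = M'.r 1 (M'.r 2 (e' y)))) → ψ x = x' by
    obtain ⟨ψ, h1, h2⟩ := hR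
    exact ⟨ψ, h1, fun y => h2 _ _ (Or.inl ⟨y, rfl, rfl⟩)⟩
  refine exists_isIso_of_rel M M' _ ?_ ?_ ?_ (e y₀) (e' y₀) (Or.inl ⟨y₀, rfl, rfl⟩)
  · rintro i _ _ (⟨y, rfl, rfl⟩ | ⟨y, hy, rfl, rfl⟩ | ⟨y, hy, rfl, rfl⟩)
    · fin_cases i
      · exact Or.inl ⟨_, (h.map_zero y).symm, (h'.map_zero y).symm⟩
      · exact Or.inl ⟨_, (h.map_one y).symm, (h'.map_one y).symm⟩
      · by_cases hy : y ∈ S ∨ N.r 0 y ∈ S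
        · exact Or.inr (Or.inl ⟨y, hy, rfl, rfl⟩)
        · refine Or.inl ⟨N.r 2 y, (h.map_two y ?_).symm, (h'.map_two y ?_).symm⟩
          · rwa [h.r_two_mem_iff]
          · rwa [h'.r_two_mem_iff]
    · fin_cases i
      · refine Or.inr (Or.inl ⟨N.r 0 y, ?_, ?_, ?_⟩)
        · rw [N.invol]; exact hy.symm
        · rw [h.map_zero, ← M.comm]; rfl
        · rw [h'.map_zero, ← M'.comm]; rfl
      · by_cases hyS : y ∈ S
        · obtain ⟨n1, n2, n3⟩ := hn _ hyS
          exact Or.inr (Or.inl ⟨nxt y, Or.inl n1, h.r_one_far hyS n1 n2 n3,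
            h'.r_one_far hyS n1 n2 n3⟩)
        · exact Or.inr (Or.inr ⟨y, hy.resolve_left hyS, rfl, rfl⟩)
      · exact Or.inl ⟨y, M.invol _ _, M'.invol _ _⟩
    · fin_cases i
      · refine Or.inr (Or.inr ⟨N.r 0 (nxt (N.r 0 y)), ?_, h.near_r_zero hn hy,
          h'.near_r_zero hn hy⟩)
        rw [N.invol]
        exact (hn _ hy).1
      · exact Or.inr (Or.inl ⟨y, Or.inr hy, M.invol _ _, M'.invol _ _⟩)
      · exact Or.inr (Or.inr ⟨N.r 2 y, (h.near_r_two hy).1, (h.near_r_two hy).2,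
          (h'.near_r_two hy).2⟩)
  · exact fun x _ _ => h.rel_unique h'
  · intro x x' y h1 h2
    refine h'.rel_unique h (x := y) ?_ ?_
    · simpa only [and_comm] using h1
    · simpa only [and_comm] using h2

/-- Collapsing only depends on the isomorphism class of the resulting map. -/
theorem IsCollapsing.congr {X Y Y' : Type*} {M : FlagMap X} {H : Subgroup (Equiv.Perm X)}
    {T : Set X} {N : FlagMap Y} {N' : FlagMap Y'} {S : Set Y} {e : Y → X}
    (h : IsCollapsing M H T N S e) {ψ : Y' ≃ Y} (hψ : N'.IsIso N ψ) :
    IsCollapsing M H T N' (ψ ⁻¹' S) (e ∘ ψ) where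
  le_aut := h.le_aut
  orbit := h.orbit
  triangle := h.triangle
  at_vertex := h.at_vertex
  one_edge := h.one_edge
  three_vertices := h.three_vertices
  four_vertices := h.four_vertices
  injective := h.injective.comp ψ.injective
  range_eq := by rw [Set.range_comp, ψ.range_eq_univ, Set.image_univ, h.range_eq]
  map_zero y := by simp only [Function.comp, hψ _ _, h.map_zero]
  map_one y := by simp only [Function.comp, hψ _ _, h.map_one]
  map_two y hy := by simp only [Function.comp, hψ _ _]; exact h.map_two _ hy
  map_two_near y hy hy' := by simp only [Function.comp, hψ _ _]; exact h.map_two_near _ hy hy'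
  map_two_far y hy hy' := by simp only [Function.comp, hψ _ _]; exact h.map_two_far _ hy hy'
  mem_split y := h.mem_split (ψ y)

/-- Collapsing is invariant under isomorphisms of the collapsed map. -/
theorem IsCollapsing.map {X X' Y : Type*} {M : FlagMap X} {M' : FlagMap X'}
    {H : Subgroup (Equiv.Perm X)} {H' : Subgroup (Equiv.Perm X')} {T : Set X} {T' : Set X'}
    {N : FlagMap Y} {S : Set Y} {e : Y → X} (h : IsCollapsing M H T N S e) {ψ : X ≃ X'}
    (hψ : M.IsIso M' ψ) (hH' : H' ≤ M'.aut) (hH : ∀ φ, ψ.permCongr φ ∈ H' ↔ φ ∈ H)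
    (hT : ∀ x, ψ x ∈ T' ↔ x ∈ T) : IsCollapsing M' H' T' N S (ψ ∘ e) where
  le_aut := hH'
  orbit := by
    obtain ⟨x₀, hx₀⟩ := h.orbit
    refine ⟨ψ x₀, fun x' => ?_⟩
    obtain ⟨x, rfl⟩ := ψ.surjective x'
    rw [hT, hx₀]
    constructor
    · rintro ⟨φ, hφ, hc⟩
      refine ⟨ψ.permCongr φ, (hH φ).2 hφ, ?_⟩
      simpa using hψ.cell hc
    · rintro ⟨φ, hφ, hc⟩
      obtain ⟨φ, rfl⟩ := ψ.permCongr.surjective φ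
      refine ⟨φ, (hH φ).1 hφ, ?_⟩
      rw [← hψ.cell_iff]
      simpa using hc
  triangle x' hx' := by
    obtain ⟨x, rfl⟩ := ψ.surjective x'
    rw [← hψ.codegree]
    exact h.triangle x ((hT x).1 hx')
  at_vertex x' := by
    obtain ⟨x, rfl⟩ := ψ.surjective x'
    have e1 : {y | M'.cell 0 (ψ x) y ∧ y ∈ T'} = ψ '' {y | M.cell 0 x y ∧ y ∈ T} := by
      ext y'
      obtain ⟨y, rfl⟩ := ψ.surjective y'
      simp [hψ.cell_iff, hT]
    rw [e1, Set.ncard_image_of_injective _ ψ.injective]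
    refine (h.at_vertex x).imp_right fun h1 => h1.imp_right fun h2 => h2.imp_right ?_
    rintro ⟨y, h1, h2, h3⟩
    exact ⟨ψ y, hψ.cell h1, (hT y).2 h2, by rw [← hψ]; exact (hT _).2 h3⟩
  one_edge x' hx' := by
    obtain ⟨x, rfl⟩ := ψ.surjective x'
    have e1 : ∀ j : Fin 3, M'.r 2 (![ψ x, M'.r 1 (ψ x), M'.r 1 (M'.r 0 (ψ x))] j) ∈ T' ↔
        M.r 2 (![x, M.r 1 x, M.r 1 (M.r 0 x)] j) ∈ T := by
      intro j
      rw [← hT, hψ]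
      fin_cases j <;> simp [hψ _ _]
    simp only [e1]
    exact h.one_edge x ((hT x).1 hx')
  three_vertices x' hx' := by
    obtain ⟨x, rfl⟩ := ψ.surjective x'
    simp only [← hψ _ _, hψ.cell_iff]
    exact h.three_vertices x ((hT x).1 hx')
  four_vertices x' hx' hx'' := by
    obtain ⟨x, rfl⟩ := ψ.surjective x'
    simp only [← hψ _ _, hψ.cell_iff, hT] at hx' hx'' ⊢
    exact h.four_vertices x hx' hx''
  injective := ψ.injective.comp h.injective
  range_eq := by
    rw [Set.range_comp, h.range_eq]
    ext x'
    obtain ⟨x, rfl⟩ := ψ.surjective x'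
    simp [hT]
  map_zero y := by simp only [Function.comp, ← hψ _ _, h.map_zero]
  map_one y := by simp only [Function.comp, ← hψ _ _, h.map_one]
  map_two y hy := by
    simp only [Function.comp, ← hψ _ _, hT] at hy ⊢; rw [h.map_two _ hy]
  map_two_near y hy hy' := by
    simp only [Function.comp, ← hψ _ _, hT] at hy hy' ⊢; rw [h.map_two_near _ hy hy']
  map_two_far y hy hy' := by
    simp only [Function.comp, ← hψ _ _, hT] at hy hy' ⊢; rw [h.map_two_far _ hy hy']
  mem_split y := by
    simp only [Function.comp, ← hψ _ _, hT]; exact h.mem_split y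

/-! ### The canonical maps -/

section Canonical

variable {G : Type*} [Group G]

/-- The group-theoretic content of the construction: a group `G` generated by `a`, `b`, `d` with an
involution `a` and `a b d` of order `3`, where `b` and `d` are involutions in the case (B) and are
equal in the cases (C) and (D). -/
structure Datum (c : Case) (a b d : G) : Prop where
  a_inv : a⁻¹ = a
  a_ne : a ≠ 1
  cube : a * (b * (d * (a * (b * (d * (a * (b * d))))))) = 1
  ne : a * (b * d) ≠ 1
  gen : Subgroup.closure {a, b, d} = ⊤
  special : match c with
    | Case.B => b⁻¹ = b ∧ b ≠ 1 ∧ d⁻¹ = d ∧ d ≠ 1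
    | _ => d = b

/-- The type graphs as tables. -/
def graphTable (c : Case) : Fin 3 → Fin 14 → Fin 14 :=
  ![match c with
    | Case.B => ![11, 2, 1, 10, 9, 6, 5, 8, 7, 4, 3, 14, 13, 12]
    | Case.C => ![11, 2, 1, 10, 9, 7, 8, 5, 6, 4, 3, 14, 13, 12]
    | Case.D => ![11, 5, 6, 9, 10, 1, 2, 8, 7, 3, 4, 14, 13, 12],
    ![1, 14, 3, 2, 5, 4, 7, 6, 9, 8, 11, 10, 13, 12],
    ![13, 2, 1, 4, 3, 6, 5, 8, 7, 10, 9, 12, 11, 14]]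

theorem graph_apply (c : Case) (i : Fin 3) (v : Fin 14) : c.graph i v = graphTable c i v := by
  cases c <;> revert i v <;> decide

/-- The voltages of the `0`-adjacencies of the map of type `{3, 7}`. -/
def voltFourteen (c : Case) (a b d : G) : Fin 14 → G :=
  match c with
  | Case.D => ![b * a * b, b * a, b * a, b, b, (b * a)⁻¹, (b * a)⁻¹, a, a, b⁻¹, b⁻¹, (b * a * b)⁻¹,
      (b * a * b)⁻¹, b * a * b]
  | _ => ![a * b * d, a, a, b * d, b * d, b, b, d⁻¹, d⁻¹, (b * d)⁻¹, (b * d)⁻¹, (a * b * d)⁻¹,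
      (a * b * d)⁻¹, a * b * d]

/-- All voltages of the map of type `{3, 7}`. -/
def voltBar (c : Case) (a b d : G) : Fin 3 → Fin 14 → G :=
  ![voltFourteen c a b d, fun _ => 1, fun _ => 1]

/-- The element rotating the split vertices of the map of type `{3, 8}` by a half turn. -/
def halfTurn (c : Case) (a b d : G) : G :=
  match c with
  | Case.D => b * a * b⁻¹
  | _ => (b * d)⁻¹ * a * (b * d)

/-- The labels of the map of type `{3, 8}`, in cyclic order around a vertex. -/
def eightLabel : Case → Fin 8 → Fin 14
  | Case.D => ![4, 5, 10, 11, 12, 13, 14, 1]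
  | _ => ![4, 5, 6, 7, 8, 9, 12, 13]

/-- The type graph of the map of type `{3, 8}`. -/
def eightTable (c : Case) : Fin 3 → Fin 8 → Fin 8 :=
  ![match c with
    | Case.B => ![5, 2, 1, 4, 3, 0, 7, 6]
    | Case.C => ![5, 3, 4, 1, 2, 0, 7, 6]
    | Case.D => ![2, 7, 0, 6, 5, 4, 3, 1],
    ![1, 0, 3, 2, 5, 4, 7, 6], ![7, 2, 1, 4, 3, 6, 5, 0]]

/-- The voltages of the map of type `{3, 8}`. -/
def voltEight (c : Case) (a b d : G) : Fin 3 → Fin 8 → G :=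
  ![fun v => voltFourteen c a b d (eightLabel c v), fun _ => 1,
    match c with
    | Case.D => ![halfTurn c a b d, 1, 1, 1, 1, 1, 1, halfTurn c a b d]
    | _ => ![1, 1, 1, 1, 1, halfTurn c a b d, halfTurn c a b d, 1]]

/-- The vertices of the eight-vertex graph on the edge that is doubled. -/
def eightSplit : Case → Set (Fin 8)
  | Case.D => {7, 0}
  | _ => {5, 6}

/-- The vertices of the eight-vertex graph belonging to the triangles outside the belts. -/
def eightOff : Case → Set (Fin 8)
  | Case.D => {4, 5}
  | _ => {6, 7}

/-- The type graph of the map with two flag orbits. -/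
def twoTable (c : Case) : Fin 3 → Fin 2 → Fin 2 :=
  ![![0, 1], match c with
    | Case.B => ![0, 1]
    | _ => ![1, 0], ![1, 0]]

/-- The voltages of the map with two flag orbits. -/
def voltTwo (c : Case) (a b d : G) : Fin 3 → Fin 2 → G :=
  ![fun _ => halfTurn c a b d, match c with
    | Case.B => ![b, d]
    | _ => ![b⁻¹, b], fun _ => 1]

theorem mul_self_of_inv {x : G} (h : x⁻¹ = x) : x * x = 1 := by
  rw [mul_eq_one_iff_inv_eq, h]

theorem mul_mul_self_of_inv {x : G} (h : x⁻¹ = x) (y : G) : x * (x * y) = y := by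
  rw [← mul_assoc, mul_self_of_inv h, one_mul]

theorem graphTable_succ (c : Case) (v : Fin 14) :
    graphTable c 1 v = v + 1 ∨ graphTable c 2 v = v + 1 := by
  cases c <;> revert v <;> decide

theorem eightLabel_injective (c : Case) : Function.Injective (eightLabel c) := by
  cases c <;> decide

theorem eightLabel_table (c : Case) (i : Fin 3) (v : Fin 8) :
    eightLabel c (eightTable c i v) = c.graphEight i (eightLabel c v) := by
  cases c <;> revert i v <;> decide

theorem twoTable_apply (c : Case) (i : Fin 3) (v : Fin 2) : c.graphTwo i v = twoTable c i v := by
  cases c <;> revert i v <;> decide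

namespace Datum

variable {c : Case} {a b d : G}

theorem a_mul (h : Datum c a b d) : a * a = 1 := mul_self_of_inv h.a_inv

theorem a_mul_a_mul (h : Datum c a b d) (x : G) : a * (a * x) = x := mul_mul_self_of_inv h.a_inv x

theorem cube_inv (h : Datum c a b d) :
    d⁻¹ * (b⁻¹ * (a * (d⁻¹ * (b⁻¹ * (a * (d⁻¹ * (b⁻¹ * a))))))) = 1 := by
  have := congrArg (·⁻¹) h.cube
  simpa [mul_assoc, h.a_inv] using this

theorem eq_top (h : Datum c a b d) {K : Subgroup G} (ha : a ∈ K) (hb : b ∈ K) (hd : d ∈ K) :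
    K = ⊤ := by
  rw [eq_top_iff, ← h.gen, Subgroup.closure_le]
  rintro x (rfl | rfl | rfl) <;> assumption

/-- The half turn is a conjugate of the involution `a`. -/
theorem halfTurn_ne (h : Datum c a b d) : halfTurn c a b d ≠ 1 := by
  intro hc
  apply h.a_ne
  have key : (b * d)⁻¹ * a * (b * d) = 1 → a = 1 := fun e => by
    rw [← conj_eq_one_iff (a := (b * d)⁻¹), inv_inv, e]
  cases c
  · exact key hc
  · exact key hc
  · simpa [halfTurn] using hc

theorem two_invol (h : Datum c a b d) (i : Fin 3) (v : Fin 2) :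
    twoTable c i (twoTable c i v) = v ∧
      voltTwo c a b d i v * voltTwo c a b d i (twoTable c i v) = 1 := by
  constructor
  · cases c <;> revert i v <;> decide
  · cases c
    · obtain ⟨hb, hb1, hd, hd1⟩ := h.special
      fin_cases i <;> fin_cases v <;>
        simp [twoTable, voltTwo, halfTurn, mul_assoc, mul_self_of_inv hb, mul_self_of_inv hd,
          h.a_mul_a_mul]
    all_goals
      obtain rfl : d = b := h.special
      fin_cases i <;> fin_cases v <;>
        simp [twoTable, voltTwo, halfTurn, mul_assoc, h.a_mul_a_mul]

theorem bar_invol (h : Datum c a b d) (i : Fin 3) (v : Fin 14) :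
    graphTable c i (graphTable c i v) = v ∧
      voltBar c a b d i v * voltBar c a b d i (graphTable c i v) = 1 := by
  constructor
  · cases c <;> revert i v <;> decide
  · cases c
    · obtain ⟨hb, hb1, hd, hd1⟩ := h.special
      fin_cases i <;> fin_cases v <;>
        simp [graphTable, voltBar, voltFourteen, h.a_mul, mul_assoc, hb, hd,
          h.a_mul_a_mul, mul_self_of_inv hb, mul_self_of_inv hd, mul_mul_self_of_inv hb,
          mul_mul_self_of_inv hd, h.a_inv]
    all_goals
      obtain rfl : d = b := h.special
      fin_cases i <;> fin_cases v <;>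
        simp [graphTable, voltBar, voltFourteen, h.a_mul, mul_assoc, h.a_mul_a_mul, h.a_inv]

theorem bar_isVoltage (h : Datum c a b d) : IsVoltage (graphTable c) (voltBar c a b d) where
  invol := h.bar_invol
  no_fix i v hv := absurd hv (by cases c <;> revert i v <;> decide)
  comm v := by
    constructor
    · cases c <;> revert v <;> decide
    · cases c <;> fin_cases v <;> simp [graphTable, voltBar, voltFourteen]
  no_fix_edge v := by
    cases c
    · obtain ⟨hb, hb1, hd, hd1⟩ := h.special
      fin_cases v <;> simp [graphTable, voltBar, voltFourteen, h.a_ne, hb1, hd1]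
    all_goals fin_cases v <;> simp [graphTable, voltBar, voltFourteen, h.a_ne]
  reach := by
    refine reach_of_closure h.bar_invol 0 ?_ ?_
    · have step : ∀ v : Fin 14,
          VoltageReach (graphTable c) (voltBar c a b d) (1, v) (1, v + 1) := by
        intro v
        rcases graphTable_succ c v with e | e
        · exact Relation.ReflTransGen.single ⟨1, by simp [voltageAdj, e, voltBar]⟩
        · exact Relation.ReflTransGen.single ⟨2, by simp [voltageAdj, e, voltBar]⟩
      intro v
      induction v using Fin.induction with
      | zero => exact Relation.ReflTransGen.refl
      | succ v ih => exact ih.trans (by simpa using step v.castSucc)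
    · intro K hK
      cases c
      · exact h.eq_top (hK 0 1) (hK 0 5) (by simpa [voltBar, voltFourteen] using hK 0 7)
      · obtain rfl : d = b := h.special
        exact h.eq_top (hK 0 1) (hK 0 5) (hK 0 5)
      · obtain rfl : d = b := h.special
        exact h.eq_top (hK 0 7) (hK 0 3) (hK 0 3)

theorem eight_invol (h : Datum c a b d) (i : Fin 3) (v : Fin 8) :
    eightTable c i (eightTable c i v) = v ∧
      voltEight c a b d i v * voltEight c a b d i (eightTable c i v) = 1 := by
  constructor
  · cases c <;> revert i v <;> decide
  · cases c
    · obtain ⟨hb, hb1, hd, hd1⟩ := h.special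
      fin_cases i <;> fin_cases v <;>
        simp [eightTable, voltEight, eightLabel, halfTurn, voltFourteen, h.a_mul, mul_assoc, hb, hd,
          h.a_mul_a_mul, mul_self_of_inv hb, mul_self_of_inv hd, mul_mul_self_of_inv hb,
          mul_mul_self_of_inv hd, h.a_inv]
    all_goals
      obtain rfl : d = b := h.special
      fin_cases i <;> fin_cases v <;>
        simp [eightTable, voltEight, eightLabel, halfTurn, voltFourteen, h.a_mul, mul_assoc,
          h.a_mul_a_mul, h.a_inv]

theorem eight_isVoltage (h : Datum c a b d) : IsVoltage (eightTable c) (voltEight c a b d) where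
  invol := h.eight_invol
  no_fix i v hv := absurd hv (by cases c <;> revert i v <;> decide)
  comm v := by
    constructor
    · cases c <;> revert v <;> decide
    · cases c
      · obtain ⟨hb, hb1, hd, hd1⟩ := h.special
        fin_cases v <;> simp [eightTable, voltEight, eightLabel, halfTurn, voltFourteen, mul_assoc,
          h.a_inv, h.a_mul, h.a_mul_a_mul]
      all_goals
        obtain rfl : d = b := h.special
        fin_cases v <;> simp [eightTable, voltEight, eightLabel, halfTurn, voltFourteen, mul_assoc,
          h.a_inv, h.a_mul, h.a_mul_a_mul]
  no_fix_edge v := by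
    cases c
    · obtain ⟨hb, hb1, hd, hd1⟩ := h.special
      fin_cases v <;> simp [eightTable, voltEight, eightLabel, voltFourteen, hb1, hd1]
    all_goals fin_cases v <;> simp [eightTable, voltEight, eightLabel, voltFourteen]
  reach := by
    have step : ∀ v w : Fin 8, (∃ i, eightTable c i v = w ∧ voltEight c a b d i v = 1) →
        VoltageReach (eightTable c) (voltEight c a b d) (1, v) (1, w) := by
      rintro v w ⟨i, rfl, e⟩
      exact Relation.ReflTransGen.single ⟨i, by simp [voltageAdj, e]⟩
    refine reach_of_closure h.eight_invol (match c with | Case.D => 0 | _ => 6) ?_ ?_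
    · cases c
      case D =>
        have s : ∀ v, v ≠ 7 → VoltageReach (eightTable Case.D) (voltEight Case.D a b d)
            (1, v) (1, v + 1) := by
          intro v hv
          fin_cases v <;> first
            | exact absurd rfl hv
            | exact step _ _ ⟨1, rfl, rfl⟩
            | exact step _ _ ⟨2, rfl, rfl⟩
        have r1 := s 0 (by decide)
        have r2 := r1.trans (s 1 (by decide))
        have r3 := r2.trans (s 2 (by decide))
        have r4 := r3.trans (s 3 (by decide))
        have r5 := r4.trans (s 4 (by decide))
        have r6 := r5.trans (s 5 (by decide))
        have r7 := r6.trans (s 6 (by decide))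
        intro v
        fin_cases v
        exacts [Relation.ReflTransGen.refl, r1, r2, r3, r4, r5, r6, r7]
      all_goals
        have s := fun (v : Fin 8) (hv : v ≠ 5) => step v (v + 1) (by
          fin_cases v <;> first
            | exact absurd rfl hv
            | exact ⟨1, rfl, rfl⟩
            | exact ⟨2, rfl, rfl⟩)
        have r7 := s 6 (by decide)
        have r0 := r7.trans (s 7 (by decide))
        have r1 := r0.trans (s 0 (by decide))
        have r2 := r1.trans (s 1 (by decide))
        have r3 := r2.trans (s 2 (by decide))
        have r4 := r3.trans (s 3 (by decide))
        have r5 := r4.trans (s 4 (by decide))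
        intro v
        fin_cases v
        exacts [r0, r1, r2, r3, r4, r5, Relation.ReflTransGen.refl, r7]
    · intro K hK
      cases c
      · have hb : b ∈ K := hK 0 1
        have hd : d ∈ K := by
          simpa [voltEight, voltFourteen, eightLabel] using hK 0 3
        have hw : a * b * d ∈ K := hK 0 7
        exact h.eq_top (by simpa using K.mul_mem hw (K.inv_mem (K.mul_mem hb hd))) hb hd
      · obtain rfl : d = b := h.special
        have hb : d ∈ K := hK 0 1
        have hw : a * d * d ∈ K := hK 0 7
        exact h.eq_top (by simpa using K.mul_mem hw (K.inv_mem (K.mul_mem hb hb))) hb hb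
      · obtain rfl : d = b := h.special
        have hb : d ∈ K := hK 0 0
        have hw : d * a ∈ K := hK 0 7
        exact h.eq_top (by simpa using K.mul_mem (K.inv_mem hb) hw) hb hb

theorem two_isVoltage (h : Datum c a b d) : IsVoltage (twoTable c) (voltTwo c a b d) where
  invol := h.two_invol
  no_fix i v := by
    cases c
    · obtain ⟨hb, hb1, hd, hd1⟩ := h.special
      fin_cases i <;> fin_cases v <;> simp [twoTable, voltTwo, hb1, hd1, h.halfTurn_ne]
    all_goals fin_cases i <;> fin_cases v <;> simp [twoTable, voltTwo, h.halfTurn_ne]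
  comm v := by
    constructor
    · cases c <;> revert v <;> decide
    · simp [voltTwo]
  no_fix_edge v hv := absurd hv (by cases c <;> revert v <;> decide)
  reach := by
    refine reach_of_closure h.two_invol 0 ?_ ?_
    · intro v
      fin_cases v
      · exact Relation.ReflTransGen.refl
      · exact Relation.ReflTransGen.single ⟨2, by simp [voltageAdj, voltTwo, twoTable]⟩
    · intro K hK
      have hh : halfTurn c a b d ∈ K := hK 0 0
      cases c
      · have hb : b ∈ K := hK 1 0
        have hd : d ∈ K := hK 1 1
        have hbd := K.mul_mem hb hd
        exact h.eq_top (by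
          simpa [halfTurn, mul_assoc] using K.mul_mem (K.mul_mem hbd hh) (K.inv_mem hbd)) hb hd
      · obtain rfl : d = b := h.special
        have hb : d ∈ K := hK 1 1
        have hbd := K.mul_mem hb hb
        exact h.eq_top (by
          simpa [halfTurn, mul_assoc] using K.mul_mem (K.mul_mem hbd hh) (K.inv_mem hbd)) hb hb
      · obtain rfl : d = b := h.special
        have hb : d ∈ K := hK 1 1
        exact h.eq_top (by
          simpa [halfTurn, mul_assoc] using K.mul_mem (K.mul_mem (K.inv_mem hb) hh) hb) hb hb

end Datum
end Canonical

/-! ### The standard map of type {3,7} -/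

section Canonical

variable {G : Type*} [Group G] {c : Case} {a b d : G}

namespace Datum

theorem cube_mul (h : Datum c a b d) (x : G) :
    a * (b * (d * (a * (b * (d * (a * (b * (d * x)))))))) = x := by
  have := congrArg (· * x) h.cube
  simpa [mul_assoc] using this

theorem ne_inv (h : Datum c a b d) : d⁻¹ * (b⁻¹ * a) ≠ 1 := by
  intro hc
  apply h.ne
  have := congrArg (·⁻¹) hc
  simpa [mul_assoc, h.a_inv] using this

theorem ne_of_eq (h : Datum c a b b) : b * (a * b) ≠ 1 := by
  intro hc
  apply h.ne
  have : a * b = b⁻¹ := eq_inv_of_mul_eq_one_right hc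
  rw [← mul_assoc, this, inv_mul_cancel]

theorem ne_inv_of_eq (h : Datum c a b b) : b⁻¹ * (a * b⁻¹) ≠ 1 := by
  intro hc
  apply h.ne_of_eq
  have := congrArg (·⁻¹) hc
  simpa [mul_assoc, h.a_inv] using this

variable [Finite G]

/-- The map of type `{3, 7}` given by a datum. -/
def bar (h : Datum c a b d) : FlagMap (G × Fin 14) := voltageMap h.bar_isVoltage

/-- The map of type `{3, 8}` given by a datum. -/
def eight (h : Datum c a b d) : FlagMap (G × Fin 8) := voltageMap h.eight_isVoltage

/-- The map with two flag orbits given by a datum. -/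
def two (h : Datum c a b d) : FlagMap (G × Fin 2) := voltageMap h.two_isVoltage

theorem bar_r (h : Datum c a b d) (i : Fin 3) (g : G) (v : Fin 14) :
    h.bar.r i (g, v) = (g * voltBar c a b d i v, graphTable c i v) := rfl

theorem eight_r (h : Datum c a b d) (i : Fin 3) (g : G) (v : Fin 8) :
    h.eight.r i (g, v) = (g * voltEight c a b d i v, eightTable c i v) := rfl

theorem two_r (h : Datum c a b d) (i : Fin 3) (g : G) (v : Fin 2) :
    h.two.r i (g, v) = (g * voltTwo c a b d i v, twoTable c i v) := rfl

theorem bar_isEquivelar (h : Datum c a b d) : h.bar.IsEquivelar 3 7 := by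
  have h3 := Fact.mk Nat.prime_three
  have h7 := Fact.mk (show Nat.Prime 7 by norm_num)
  rintro ⟨g, v⟩
  constructor
  · refine Function.minimalPeriod_eq_prime ?_ ?_
    · change h.bar.r 0 (h.bar.r 1 (h.bar.r 0 (h.bar.r 1 (h.bar.r 0 (h.bar.r 1 (g, v)))))) = (g, v)
      have h1 := h.cube
      have h2 := h.cube_inv
      cases c
      · obtain ⟨hb, hb1, hd, hd1⟩ := h.special
        rw [hb, hd] at h2
        fin_cases v <;> simp [bar_r, graphTable, voltBar, voltFourteen, mul_assoc, h1, h2, hb, hd,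
          h.a_inv, h.a_mul, h.a_mul_a_mul, mul_self_of_inv hb, mul_self_of_inv hd,
          mul_mul_self_of_inv hb, mul_mul_self_of_inv hd]
      · obtain rfl : d = b := h.special
        fin_cases v <;> simp [bar_r, graphTable, voltBar, voltFourteen, mul_assoc, h1, h2,
          h.a_inv, h.a_mul, h.a_mul_a_mul]
      · obtain rfl : d = b := h.special
        -- In case (D) the triangle invariant under rotation has voltage `bab`, a conjugate of
        -- `abb`; its cube is a cyclic rearrangement of the given relation.
        have h3 : d * (a * (d * (d * (a * (d * (d * (a * d))))))) = 1 := by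
          have := h.cube_mul (d⁻¹)
          simp only [mul_inv_cancel, mul_one] at this
          rw [this, mul_inv_cancel]
        have h4 : d⁻¹ * (a * (d⁻¹ * (d⁻¹ * (a * (d⁻¹ * (d⁻¹ * (a * d⁻¹))))))) = 1 := by
          have := congrArg (·⁻¹) h3
          simpa [mul_assoc, h.a_inv] using this
        fin_cases v <;> simp [bar_r, graphTable, voltBar, voltFourteen, mul_assoc, h3, h4,
          h.a_inv, h.a_mul, h.a_mul_a_mul]
    · intro hc
      have hc : h.bar.r 0 (h.bar.r 1 (g, v)) = (g, v) := hc
      cases c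
      case D =>
        obtain rfl : d = b := h.special
        fin_cases v <;> simp [bar_r, graphTable, voltBar, voltFourteen, mul_assoc, h.a_inv,
          h.ne_of_eq, h.ne_inv_of_eq] at hc
      all_goals
        fin_cases v <;> simp [bar_r, graphTable, voltBar, voltFourteen, mul_assoc, h.a_inv, h.ne,
          h.ne_inv] at hc
  · refine Function.minimalPeriod_eq_prime ?_ ?_
    · change (fun x => h.bar.r 1 (h.bar.r 2 x))^[7] (g, v) = (g, v)
      fin_cases v <;> simp [bar_r, graphTable, voltBar]
    · intro hc
      have hc : h.bar.r 1 (h.bar.r 2 (g, v)) = (g, v) := hc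
      fin_cases v <;> simp [bar_r, graphTable, voltBar] at hc

/-- The adjacencies around a vertex have trivial voltage and connect all labels, so the vertices of
the standard map are the elements of `G`. Incidence questions thereby become inequalities in `G`. -/
theorem bar_cell_zero (h : Datum c a b d) {x y : G × Fin 14} : h.bar.cell 0 x y ↔ x.1 = y.1 := by
  constructor
  · intro hxy
    refine h.bar.cell_induction (P := fun y => x.1 = y.1) ?_ hxy rfl
    rintro j hj ⟨g, v⟩ rfl
    fin_cases j
    · exact absurd rfl hj
    · simp [bar_r, voltBar]
    · simp [bar_r, voltBar]
  · obtain ⟨g, v⟩ := x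
    obtain ⟨g', w⟩ := y
    rintro rfl
    have key : ∀ v, h.bar.cell 0 (g, 0) (g, v) := by
      intro v
      induction v using Fin.induction with
      | zero => exact h.bar.cell_refl _
      | succ v ih =>
        rw [← Fin.coeSucc_eq_succ]
        rcases graphTable_succ c v.castSucc with e | e
        · have := h.bar.cell_step (j := 1) (by decide) ih
          rwa [bar_r, e, show voltBar c a b d 1 v.castSucc = 1 from rfl, mul_one] at this
        · have := h.bar.cell_step (j := 2) (by decide) ih
          rwa [bar_r, e, show voltBar c a b d 2 v.castSucc = 1 from rfl, mul_one] at this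
    exact h.bar.cell_trans (h.bar.cell_symm (key v)) (key w)

/-- The labels of the deleted triangles as a table. -/
def _root_.deletedTable : Case → Fin 14 → Bool
  | Case.D => ![false, false, true, true, false, false, true, true, true, true, false, false,
      false, false]
  | _ => ![true, true, true, true, false, false, false, false, false, false, true, true, false,
      false]

theorem _root_.mem_deleted {c : Case} {v : Fin 14} : v ∈ c.deleted ↔ deletedTable c v = true := by
  cases c <;> simp only [Case.deleted, Set.mem_insert_iff, Set.mem_singleton_iff] <;>
    revert v <;> decide

theorem _root_.ncard_deleted (c : Case) : c.deleted.ncard = 6 := by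
  have : c.deleted = ↑(Finset.univ.filter fun v => deletedTable c v = true) := by
    ext v
    simp [mem_deleted]
  rw [this, Set.ncard_coe_finset]
  cases c <;> decide

theorem _root_.deletedTable_face (c : Case) (j : Fin 3) (v : Fin 14) (hj : j ≠ 2)
    (hv : deletedTable c v = true) : deletedTable c (graphTable c j v) = true := by
  cases c <;> revert j v <;> decide

/-- The six deleted labels form one cycle under `r 0` and `r 1` starting at label 3, so the
triangles bearing them are the translates of a single one. -/
theorem bar_triangles (h : Datum c a b d) (x : G × Fin 14) : x.2 ∈ c.deleted ↔
    ∃ φ ∈ h.bar.labelGroup (fun x => x.2), h.bar.cell 2 (φ (1, 3)) x := by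
  constructor
  · obtain ⟨g, v⟩ := x
    intro hv
    have step : ∀ v, (∃ k, h.bar.cell 2 (1, 3) (k, v)) → ∀ j : Fin 3, j ≠ 2 →
        ∃ k, h.bar.cell 2 (1, 3) (k, graphTable c j v) :=
      fun v ⟨k, hk⟩ j hj => ⟨_, h.bar.cell_step hj hk⟩
    have key : ∃ k, h.bar.cell 2 (1, 3) (k, v) := by
      have s0 : ∃ k, h.bar.cell 2 (1, 3) (k, 3) := ⟨1, h.bar.cell_refl _⟩
      have s1 := step _ s0 1 (by decide)
      have s2 := step _ s1 0 (by decide)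
      have s3 := step _ s2 1 (by decide)
      have s4 := step _ s3 0 (by decide)
      have s5 := step _ s4 1 (by decide)
      have hv : deletedTable c v = true := mem_deleted.1 hv
      cases c <;> fin_cases v <;> first | exact absurd hv (by decide) | assumption
    obtain ⟨k, hk⟩ := key
    refine ⟨translation _ (g * k⁻¹), translation_mem _ id _, ?_⟩
    have := h.bar.cell_aut (translation_mem_aut h.bar_isVoltage (g * k⁻¹)) hk
    simpa using this
  · rintro ⟨φ, hφ, hc⟩
    refine h.bar.cell_induction (P := fun y => y.2 ∈ c.deleted) ?_ hc ?_
    · rintro j hj ⟨g, v⟩ hv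
      exact mem_deleted.2 (deletedTable_face c j v hj (mem_deleted.1 hv))
    · have : (φ (1, 3)).2 = 3 := hφ.2 (1, 3)
      change (φ (1, 3)).2 ∈ c.deleted
      rw [this, mem_deleted]
      cases c <;> rfl

end Datum
end Canonical

/-! ### Collapsing in standard form -/

section Canonical

variable {G : Type*} [Group G] {c : Case} {a b d : G}

/-- The split vertices as a table. -/
def splitTable : Case → Fin 8 → Bool
  | Case.D => ![true, false, false, false, false, false, false, true]
  | _ => ![false, false, false, false, false, true, true, false]

theorem mem_eightSplit {c : Case} {v : Fin 8} : v ∈ eightSplit c ↔ splitTable c v = true := by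
  cases c <;> simp only [eightSplit, Set.mem_insert_iff, Set.mem_singleton_iff] <;>
    revert v <;> decide

namespace Datum

/-- If `bd = 1`, the relation says `a³ = 1`, which forces the involution `a` to be trivial. The
inequalities here are those needed for deleted triangles to have distinct vertices. -/
theorem b_mul_d_ne (h : Datum c a b d) : b * d ≠ 1 := by
  intro hc
  have h1 := h.cube
  have h2 : ∀ x, b * (d * x) = x := fun x => by rw [← mul_assoc, hc, one_mul]
  rw [hc, mul_one, h2, h2, h.a_mul_a_mul] at h1
  exact h.a_ne h1

theorem b_ne_of_eq (h : Datum c a b b) : b ≠ 1 := by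
  rintro rfl
  exact h.b_mul_d_ne (mul_one 1)

theorem b_mul_a_ne_of_eq (h : Datum c a b b) : b * a ≠ 1 := by
  intro hc
  have h1 : b = a := by rw [← h.a_inv]; exact eq_inv_of_mul_eq_one_left hc
  subst h1
  exact h.b_mul_d_ne h.a_mul

theorem a_ne_b_mul_d (h : Datum c a b d) : a ≠ b * d := fun hc => h.ne (by rw [← hc, h.a_mul])

theorem inv_mul_inv_ne (h : Datum c a b d) : d⁻¹ * b⁻¹ ≠ 1 := by
  rw [← mul_inv_rev]
  exact inv_ne_one.2 h.b_mul_d_ne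

theorem inv_ne_a_of_eq (h : Datum c a b b) : b⁻¹ ≠ a := fun hc =>
  h.b_mul_a_ne_of_eq (by rw [← hc, mul_inv_cancel])

theorem a_mul_inv_ne_of_eq (h : Datum c a b b) : a * b⁻¹ ≠ 1 := fun hc =>
  h.inv_ne_a_of_eq (by rw [← h.a_inv]; exact eq_inv_of_mul_eq_one_right hc)

variable [Finite G]

set_option maxHeartbeats 1000000 in
theorem isCollapsing (h : Datum c a b d) : IsCollapsing h.bar (h.bar.labelGroup fun x => x.2)
    {x | x.2 ∈ c.deleted} h.eight {x | x.2 ∈ eightSplit c} (fun x => (x.1, eightLabel c x.2)) where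
  le_aut := labelGroup_le_aut
  orbit := ⟨(1, 3), h.bar_triangles⟩
  triangle x _ := (h.bar_isEquivelar x).1
  at_vertex := by
    rintro ⟨g, v⟩
    right; right
    constructor
    · right
      -- Each vertex carries every label exactly once, hence six deleted flags, that is, three
      -- deleted triangles.
      have : {y | h.bar.cell 0 (g, v) y ∧ y ∈ {x : G × Fin 14 | x.2 ∈ c.deleted}} =
          (fun w => (g, w)) '' c.deleted := by
        ext ⟨g', w⟩
        simp only [h.bar_cell_zero, Set.mem_ofPred_eq, Set.mem_image, Prod.mk.injEq]
        constructor
        · rintro ⟨rfl, hw⟩; exact ⟨w, hw, rfl, rfl⟩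
        · rintro ⟨w, hw, rfl, rfl⟩; exact ⟨rfl, hw⟩
      rw [this, Set.ncard_image_of_injective _ (Prod.mk_right_injective g), ncard_deleted]
    · have : ∃ w, deletedTable c w = true ∧ deletedTable c (graphTable c 2 w) = true := by
        cases c <;> decide
      obtain ⟨w, h1, h2⟩ := this
      exact ⟨(g, w), h.bar_cell_zero.2 rfl, mem_deleted.2 h1, mem_deleted.2 h2⟩
  one_edge := by
    rintro ⟨g, v⟩ hv
    replace hv : deletedTable c v = true := mem_deleted.1 hv
    have key : ∃! j : Fin 3, deletedTable c (graphTable c 2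
        (![v, graphTable c 1 v, graphTable c 1 (graphTable c 0 v)] j)) = true := by
      unfold ExistsUnique
      beta_reduce
      cases c <;> revert v <;> decide
    convert key using 2 with j
    rw [← mem_deleted]
    fin_cases j <;> rfl
  three_vertices := by
    rintro ⟨g, v⟩ hv
    replace hv : deletedTable c v = true := mem_deleted.1 hv
    simp only [h.bar_cell_zero]
    cases c
    case D =>
      obtain rfl : d = b := h.special
      fin_cases v <;> first
        | exact absurd hv (by decide)
        | simp [bar_r, graphTable, voltBar, voltFourteen, h.a_inv, h.a_ne, h.b_ne_of_eq,
            h.b_mul_a_ne_of_eq, mul_assoc, h.inv_ne_a_of_eq, h.inv_ne_a_of_eq.symm,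
            h.a_mul_inv_ne_of_eq]
    all_goals
      fin_cases v <;> first
        | exact absurd hv (by decide)
        | simp [bar_r, graphTable, voltBar, voltFourteen, h.a_inv, h.a_ne, h.b_mul_d_ne,
            h.ne, mul_assoc, h.a_ne_b_mul_d, h.a_ne_b_mul_d.symm, h.inv_mul_inv_ne, h.ne_inv]
  four_vertices := by
    rintro ⟨g, v⟩ hv hv'
    replace hv : deletedTable c v = true := mem_deleted.1 hv
    replace hv' : deletedTable c (graphTable c 2 v) = true := mem_deleted.1 hv'
    simp only [h.bar_cell_zero]
    cases c
    case D =>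
      obtain rfl : d = b := h.special
      fin_cases v <;> first
        | exact absurd hv (by decide)
        | exact absurd hv' (by decide)
        | simp [bar_r, graphTable, voltBar, voltFourteen, h.a_inv, h.a_ne, mul_assoc]
    all_goals
      fin_cases v <;> first
        | exact absurd hv (by decide)
        | exact absurd hv' (by decide)
        | simp [bar_r, graphTable, voltBar, voltFourteen, h.a_inv, h.a_ne, mul_assoc]
  injective := by
    rintro ⟨g, v⟩ ⟨g', v'⟩ e
    simp only [Prod.mk.injEq] at e
    rw [e.1, eightLabel_injective c e.2]
  range_eq := by
    have key : ∀ v, (∃ w, eightLabel c w = v) ↔ deletedTable c v = false := by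
      cases c <;> decide
    ext ⟨g, v⟩
    simp only [Set.mem_range, Prod.exists, Prod.mk.injEq, Set.mem_compl_iff, Set.mem_ofPred_eq,
      mem_deleted, Bool.not_eq_true, ← key]
    exact ⟨fun ⟨_, w, _, hw⟩ => ⟨w, hw⟩, fun ⟨w, hw⟩ => ⟨g, w, rfl, hw⟩⟩
  map_zero := by
    rintro ⟨g, v⟩
    have : eightLabel c (eightTable c 0 v) = graphTable c 0 (eightLabel c v) := by
      cases c <;> revert v <;> decide
    rw [eight_r, bar_r, this]
    rfl
  map_one := by
    rintro ⟨g, v⟩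
    have : eightLabel c (eightTable c 1 v) = graphTable c 1 (eightLabel c v) := by
      cases c <;> revert v <;> decide
    rw [eight_r, bar_r, this]
    rfl
  map_two := by
    rintro ⟨g, v⟩ hv
    replace hv : ¬ deletedTable c (graphTable c 2 (eightLabel c v)) = true :=
      fun hc => hv (mem_deleted.2 hc)
    cases c <;> fin_cases v <;> first
      | exact absurd rfl hv
      | rfl
  map_two_near := by
    rintro ⟨g, v⟩ hv hv'
    replace hv : deletedTable c (graphTable c 2 (eightLabel c v)) = true := mem_deleted.1 hv
    replace hv' : deletedTable c
        (graphTable c 2 (graphTable c 1 (graphTable c 2 (eightLabel c v)))) =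
      true := mem_deleted.1 hv'
    cases c <;> fin_cases v <;> first
      | exact absurd hv (by decide)
      | exact absurd hv' (by decide)
      | simp [bar_r, eight_r, graphTable, eightTable, eightLabel, voltBar, voltEight]
  map_two_far := by
    rintro ⟨g, v⟩ hv hv'
    replace hv : deletedTable c (graphTable c 2 (eightLabel c v)) = true := mem_deleted.1 hv
    replace hv' : ¬ deletedTable c
        (graphTable c 2 (graphTable c 1 (graphTable c 2 (eightLabel c v)))) =
      true := fun hc => hv' (mem_deleted.2 hc)
    -- The two identified vertices `x` and `w` have group coordinates differing by the half turn.
    -- This is the only source of nontrivial `2`-voltages in the map of type {3,8}.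
    cases c
    case D =>
      obtain rfl : d = b := h.special
      fin_cases v <;> first
        | exact absurd hv (by decide)
        | exact absurd rfl hv'
        | simp [bar_r, eight_r, graphTable, eightTable, eightLabel, voltBar, voltEight,
            voltFourteen, halfTurn, mul_assoc, h.a_inv]
    all_goals
      fin_cases v <;> first
        | exact absurd hv (by decide)
        | exact absurd rfl hv'
        | simp [bar_r, eight_r, graphTable, eightTable, eightLabel, voltBar, voltEight,
            voltFourteen, halfTurn, mul_assoc, h.a_inv]
  mem_split := by
    rintro ⟨g, v⟩
    have key : splitTable c v = true ↔ deletedTable c (graphTable c 2 (eightLabel c v)) = true ∧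
      ¬ deletedTable c
        (graphTable c 2 (graphTable c 1 (graphTable c 2 (eightLabel c v)))) =
      true := by
      cases c <;> revert v <;> decide
    rw [← mem_eightSplit, ← mem_deleted, ← mem_deleted] at key
    exact key

/-- The second doubled edge at a split vertex. -/
theorem eight_next (h : Datum c a b d) (y : G × Fin 8) (hy : y.2 ∈ eightSplit c) :
    let nxt := fun y => h.eight.r 1 (h.eight.r 2 (h.eight.r 1 (h.eight.r 2 (h.eight.r 1
      (h.eight.r 2 (h.eight.r 1 y))))))
    (nxt y).2 ∈ eightSplit c ∧ nxt y ≠ y ∧ Relation.ReflTransGen (fun a b => h.eight.r 1 a = b ∨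
      a ∉ {x : G × Fin 8 | x.2 ∈ eightSplit c} ∧ h.eight.r 2 a = b) y (nxt y) := by
  intro nxt
  obtain ⟨g, v⟩ := y
  replace hy : splitTable c v = true := mem_eightSplit.1 hy
  have hl : ∀ i x, (h.eight.r i x).2 = eightTable c i x.2 := fun i x => rfl
  refine ⟨?_, ?_, ?_⟩
  · rw [mem_eightSplit]
    simp only [nxt, hl]
    cases c <;> revert v <;> decide
  · intro hc
    replace hc := congrArg Prod.snd hc
    simp only [nxt, hl] at hc
    revert hc
    cases c <;> revert v <;> decide
  -- The walk `1,2,1,2,1,2,1` passes all eight labels, from one split label to the other, which is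
  -- half of the flags at the vertex; it crosses no split edge.
  · have s2 : ∀ x, splitTable c x.2 = false → Relation.ReflTransGen (fun a b => h.eight.r 1 a = b ∨
      a ∉ {x : G × Fin 8 | x.2 ∈ eightSplit c} ∧ h.eight.r 2 a = b) x (h.eight.r 2 x) := by
      intro x hx
      refine Relation.ReflTransGen.single (Or.inr ⟨?_, rfl⟩)
      intro hc
      rw [Set.mem_ofPred_eq, mem_eightSplit, hx] at hc
      exact Bool.false_ne_true hc
    have s1 : ∀ x, Relation.ReflTransGen (fun a b => h.eight.r 1 a = b ∨
      a ∉ {x : G × Fin 8 | x.2 ∈ eightSplit c} ∧ h.eight.r 2 a = b) x (h.eight.r 1 x) :=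
      fun x => Relation.ReflTransGen.single (Or.inl rfl)
    refine ((((((s1 _).trans (s2 _ ?_)).trans (s1 _)).trans (s2 _ ?_)).trans (s1 _)).trans
      (s2 _ ?_)).trans (s1 _) <;> simp only [hl] <;> cases c <;> revert v <;> decide

end Datum
end Canonical

/-! ### Rebelting in standard form -/

section Canonical

variable {G : Type*} [Group G] {c : Case} {a b d : G}

/-- The triangles outside the belts as a table. -/
def offTable : Case → Fin 8 → Bool
  | Case.D => ![false, false, false, false, true, true, false, false]
  | _ => ![false, false, false, false, false, false, true, true]

theorem mem_eightOff {c : Case} {v : Fin 8} : v ∈ eightOff c ↔ offTable c v = true := by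
  cases c <;> simp only [eightOff, Set.mem_insert_iff, Set.mem_singleton_iff] <;>
    revert v <;> decide

/-- The label in the eight-vertex graph of a flag of the map of type `{3, 9}`. -/
def beltVertex : Case → Fin 2 → Fin 3 → Fin 8
  | Case.B => ![![0, 2, 1], ![5, 3, 4]]
  | Case.C => ![![0, 3, 1], ![5, 2, 4]]
  | Case.D => ![![6, 1, 7], ![3, 0, 2]]

/-- The group element attached to a flag of the map of type `{3, 9}` by the inverse rebelting. -/
def beltVolt (c : Case) (a b d : G) : Fin 2 → Fin 3 → G :=
  match c with
  | Case.D => ![![(b * a)⁻¹, 1, (b * a)⁻¹], ![b, 1, b]]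
  | _ => ![![b⁻¹, 1, b⁻¹], ![d, 1, d]]

/-- The identification of the flags of the map of type `{3, 9}` with those on belts. -/
def beltMap (c : Case) (a b d : G) (x : (G × Fin 2) × Fin 3) : G × Fin 8 :=
  (x.1.1 * beltVolt c a b d x.1.2 x.2, beltVertex c x.1.2 x.2)

theorem forall_of_succ {n : ℕ} [NeZero n] {P : Fin n → Prop} (h : ∃ v, P v)
    (hs : ∀ v, P v → P (v + 1)) (v : Fin n) : P v := by
  obtain ⟨w, hw⟩ := h
  have key : ∀ k : ℕ, P (w + Fin.ofNat n k) := by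
    intro k
    induction k with
    | zero => simpa using hw
    | succ k ih =>
      have : Fin.ofNat n (k + 1) = Fin.ofNat n k + 1 := by
        ext; simp [Fin.val_add]
      rw [this, ← add_assoc]
      exact hs _ ih
  simpa using key (v - w).val

theorem eightTable_succ (c : Case) (v : Fin 8) :
    eightTable c 1 v = v + 1 ∨ eightTable c 2 v = v + 1 := by
  cases c <;> revert v <;> decide

section Nine

variable {F : Type*} (M : FlagMap F)

theorem nine_zero_zero (f : F) : M.truncation.petrial.dual.r 0 (f, 0) = (M.r 2 f, 0) := rfl
theorem nine_zero_one (f : F) : M.truncation.petrial.dual.r 0 (f, 1) = (f, 2) := rfl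
theorem nine_zero_two (f : F) : M.truncation.petrial.dual.r 0 (f, 2) = (f, 1) := rfl
theorem nine_one_zero (f : F) : M.truncation.petrial.dual.r 1 (f, 0) = (f, 1) := rfl
theorem nine_one_one (f : F) : M.truncation.petrial.dual.r 1 (f, 1) = (f, 0) := rfl
theorem nine_one_two (f : F) : M.truncation.petrial.dual.r 1 (f, 2) = (M.r 2 f, 2) := rfl
theorem nine_two_zero (f : F) :
    M.truncation.petrial.dual.r 2 (f, 0) = (M.r 0 (M.r 2 f), 0) := rfl
theorem nine_two_one (f : F) : M.truncation.petrial.dual.r 2 (f, 1) = (M.r 1 f, 2) := rfl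
theorem nine_two_two (f : F) : M.truncation.petrial.dual.r 2 (f, 2) = (M.r 1 f, 1) := rfl

end Nine

namespace Datum

variable [Finite G]

/-- Triangles that are not deleted are unchanged by collapsing. Around a vertex, four rotation steps
run once through the eight labels and multiply by the half turn, an involution; hence eight steps
are the exact period. -/
theorem eight_isEquivelar (h : Datum c a b d) : h.eight.IsEquivelar 3 8 := by
  rintro ⟨g, v⟩
  constructor
  · rw [← (h.bar_isEquivelar (g, eightLabel c v)).1]
    unfold FlagMap.codegree
    have hs : Function.Semiconj (fun x : G × Fin 8 => (x.1, eightLabel c x.2))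
        (fun x => h.eight.r 0 (h.eight.r 1 x)) (fun x => h.bar.r 0 (h.bar.r 1 x)) := fun x => by
      have h1 := h.isCollapsing.map_zero (h.eight.r 1 x)
      have h2 := h.isCollapsing.map_one x
      exact h1.trans (congrArg _ h2)
    rw [Function.minimalPeriod_eq_minimalPeriod_iff]
    intro n
    have := (hs.iterate_right n) (g, v)
    simp only [Function.IsPeriodicPt, Function.IsFixedPt]
    rw [← this]
    exact h.isCollapsing.injective.eq_iff.symm
  · have h2 := Fact.mk Nat.prime_two
    have hh := h.halfTurn_ne
    have hinv : halfTurn c a b d * halfTurn c a b d = 1 := by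
      simpa [voltTwo, twoTable] using (h.two_invol 0 0).2
    refine Function.minimalPeriod_eq_prime_pow (p := 2) (k := 2) ?_ ?_
    · change ¬ (fun x => h.eight.r 1 (h.eight.r 2 x))^[4] (g, v) = (g, v)
      cases c <;> fin_cases v <;> simp [eight_r, eightTable, voltEight, hh]
    · change (fun x => h.eight.r 1 (h.eight.r 2 x))^[8] (g, v) = (g, v)
      cases c <;> fin_cases v <;> simp [eight_r, eightTable, voltEight, mul_assoc, hinv]

set_option maxHeartbeats 1000000 in
-- The offsets `beltVolt` are normalised to be trivial on the flags `(f, 1)`. Each clause then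
-- splits into a table lookup for the labels and a word identity in `a`, `b`, `d`.
theorem isRebelting (h : Datum c a b d) : IsRebelting h.eight {x | x.2 ∉ eightOff c}
    h.two.truncation.petrial.dual (inheritedFlags (G × Fin 2)) (beltMap c a b d) where
  equivelar := h.eight_isEquivelar
  faces := by
    rintro ⟨g, v⟩
    have key : (offTable c (eightTable c 0 v) = offTable c v) ∧
        (offTable c (eightTable c 1 v) = offTable c v) := by
      cases c <;> revert v <;> decide
    simp only [Set.mem_ofPred_eq, eight_r, mem_eightOff, key.1, key.2, and_self]
  off_belt := by
    intro x
    have key : ∀ v, ∃ g, h.eight.cell 0 x (g, v) := by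
      refine forall_of_succ (P := fun v => ∃ g, h.eight.cell 0 x (g, v))
        ⟨x.2, x.1, h.eight.cell_refl x⟩ ?_
      rintro v ⟨g, hg⟩
      rcases eightTable_succ c v with e | e
      · exact ⟨_, by simpa only [eight_r, e] using h.eight.cell_step (j := 1) (by decide) hg⟩
      · exact ⟨_, by simpa only [eight_r, e] using h.eight.cell_step (j := 2) (by decide) hg⟩
    obtain ⟨v, hv⟩ : ∃ v, offTable c v = true := by cases c <;> decide
    obtain ⟨g, hg⟩ := key v
    exact ⟨(g, v), fun hc => hc (mem_eightOff.2 hv), hg⟩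
  fan := by
    rintro ⟨g, v⟩ hv
    replace hv : offTable c v = true := by
      by_contra hc
      exact hv fun h' => hc (mem_eightOff.1 h')
    have hl : ∀ i x, (h.eight.r i x).2 = eightTable c i x.2 := fun i x => rfl
    simp only [Function.iterate_succ, Function.iterate_zero, Function.comp, id, Set.mem_ofPred_eq,
      hl, mem_eightOff]
    cases c <;> revert v <;> decide
  injective := by
    have key : ∀ i j i' j', beltVertex c i j = beltVertex c i' j' → i = i' ∧ j = j' := by
      cases c <;> decide
    rintro ⟨⟨g, i⟩, j⟩ ⟨⟨g', i'⟩, j'⟩ e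
    simp only [beltMap, Prod.mk.injEq] at e
    obtain ⟨rfl, rfl⟩ := key _ _ _ _ e.2
    rw [mul_right_cancel e.1]
  range_eq := by
    have key : ∀ v, (∃ i j, beltVertex c i j = v) ↔ ¬ offTable c v = true := by
      cases c <;> decide
    ext ⟨g, v⟩
    simp only [Set.mem_ofPred_eq, mem_eightOff, ← key]
    constructor
    · rintro ⟨⟨⟨g', i⟩, j⟩, e⟩
      exact ⟨i, j, congrArg Prod.snd e⟩
    · rintro ⟨i, j, rfl⟩
      exact ⟨((g * (beltVolt c a b d i j)⁻¹, i), j), by simp [beltMap]⟩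
  mem_bounding := by
    rintro ⟨⟨g, i⟩, j⟩
    have key : j = 0 ↔ offTable c (eightTable c 2 (beltVertex c i j)) = true := by
      cases c <;> revert i j <;> decide
    rw [← mem_eightOff] at key
    exact key.trans not_not.symm
  map_zero := by
    rintro ⟨⟨g, i⟩, j⟩
    cases c
    · obtain ⟨hb, hb1, hd, hd1⟩ := h.special
      fin_cases i <;> fin_cases j <;>
        simp [beltMap, beltVertex, beltVolt, nine_zero_zero, nine_zero_one, nine_zero_two, two_r,
          eight_r, twoTable, voltTwo, eightTable, voltEight, voltFourteen, eightLabel, mul_assoc,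
          h.a_inv, hb, hd, mul_self_of_inv hb, mul_self_of_inv hd, mul_mul_self_of_inv hb,
          mul_mul_self_of_inv hd]
    all_goals
      obtain rfl : d = b := h.special
      fin_cases i <;> fin_cases j <;>
        simp [beltMap, beltVertex, beltVolt, nine_zero_zero, nine_zero_one, nine_zero_two, two_r,
          eight_r, twoTable, voltTwo, eightTable, voltEight, voltFourteen, eightLabel, mul_assoc,
          h.a_inv, h.a_mul, h.a_mul_a_mul]
  map_one_base := by
    rintro ⟨⟨g, i⟩, j⟩ hv
    replace hv : offTable c (eightTable c 2 (beltVertex c i j)) = true :=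
      mem_eightOff.1 (not_not.1 hv)
    cases c
    · obtain ⟨hb, hb1, hd, hd1⟩ := h.special
      fin_cases i <;> fin_cases j <;> first
        | exact absurd hv (by decide)
        | simp [beltMap, beltVertex, beltVolt, nine_one_zero, nine_one_one, nine_one_two, two_r,
            eight_r, twoTable, voltTwo, eightTable, voltEight, voltFourteen, eightLabel, mul_assoc,
            h.a_inv, hb, hd, mul_self_of_inv hb, mul_self_of_inv hd, mul_mul_self_of_inv hb,
            mul_mul_self_of_inv hd, h.a_mul, h.a_mul_a_mul]
    all_goals
      obtain rfl : d = b := h.special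
      fin_cases i <;> fin_cases j <;> first
        | exact absurd hv (by decide)
        | simp [beltMap, beltVertex, beltVolt, nine_one_zero, nine_one_one, nine_one_two, two_r,
            eight_r, twoTable, voltTwo, eightTable, voltEight, voltFourteen, eightLabel, mul_assoc,
            h.a_inv, h.a_mul, h.a_mul_a_mul]
  map_one_apex := by
    rintro ⟨⟨g, i⟩, j⟩ hv hv'
    replace hv : ¬ offTable c (eightTable c 2 (beltVertex c i j)) = true :=
      fun hc => hv (mem_eightOff.2 hc)
    replace hv' : ¬ offTable c (eightTable c 2 (eightTable c 1 (beltVertex c i j))) = true :=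
      fun hc => hv' (mem_eightOff.2 hc)
    cases c
    · obtain ⟨hb, hb1, hd, hd1⟩ := h.special
      fin_cases i <;> fin_cases j <;> first
        | exact absurd rfl hv
        | exact absurd rfl hv'
        | simp [beltMap, beltVertex, beltVolt, nine_one_zero, nine_one_one, nine_one_two, two_r,
            eight_r, twoTable, voltTwo, eightTable, voltEight, voltFourteen, eightLabel, mul_assoc,
            h.a_inv, hb, hd, mul_self_of_inv hb, mul_self_of_inv hd, mul_mul_self_of_inv hb,
            mul_mul_self_of_inv hd, h.a_mul, h.a_mul_a_mul]
    all_goals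
      obtain rfl : d = b := h.special
      fin_cases i <;> fin_cases j <;> first
        | exact absurd rfl hv
        | exact absurd rfl hv'
        | simp [beltMap, beltVertex, beltVolt, nine_one_zero, nine_one_one, nine_one_two, two_r,
            eight_r, twoTable, voltTwo, eightTable, voltEight, voltFourteen, eightLabel, mul_assoc,
            h.a_inv, h.a_mul, h.a_mul_a_mul]
  map_one_side := by
    rintro ⟨⟨g, i⟩, j⟩ hv hv'
    replace hv : ¬ offTable c (eightTable c 2 (beltVertex c i j)) = true :=
      fun hc => hv (mem_eightOff.2 hc)
    replace hv' : offTable c (eightTable c 2 (eightTable c 1 (beltVertex c i j))) = true :=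
      mem_eightOff.1 (not_not.1 hv')
    cases c
    · obtain ⟨hb, hb1, hd, hd1⟩ := h.special
      fin_cases i <;> fin_cases j <;> first
        | exact absurd rfl hv
        | exact absurd hv' (by decide)
        | simp [beltMap, beltVertex, beltVolt, nine_one_zero, nine_one_one, nine_one_two, two_r,
            eight_r, twoTable, voltTwo, eightTable, voltEight, voltFourteen, eightLabel, mul_assoc,
            h.a_inv, hb, hd, mul_self_of_inv hb, mul_self_of_inv hd, mul_mul_self_of_inv hb,
            mul_mul_self_of_inv hd, h.a_mul, h.a_mul_a_mul]
    all_goals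
      obtain rfl : d = b := h.special
      fin_cases i <;> fin_cases j <;> first
        | exact absurd rfl hv
        | exact absurd hv' (by decide)
        | simp [beltMap, beltVertex, beltVolt, nine_one_zero, nine_one_one, nine_one_two, two_r,
            eight_r, twoTable, voltTwo, eightTable, voltEight, voltFourteen, eightLabel, mul_assoc,
            h.a_inv, h.a_mul, h.a_mul_a_mul]
  map_two_side := by
    rintro ⟨⟨g, i⟩, j⟩ hv
    replace hv : ¬ offTable c (eightTable c 2 (beltVertex c i j)) = true :=
      fun hc => hv (mem_eightOff.2 hc)
    cases c
    · obtain ⟨hb, hb1, hd, hd1⟩ := h.special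
      fin_cases i <;> fin_cases j <;> first
        | exact absurd rfl hv
        | simp [beltMap, beltVertex, beltVolt, nine_two_zero, nine_two_one, nine_two_two, two_r,
            eight_r, twoTable, voltTwo, eightTable, voltEight, voltFourteen, eightLabel, mul_assoc,
            halfTurn,
            h.a_inv, hb, hd, mul_self_of_inv hb, mul_self_of_inv hd, mul_mul_self_of_inv hb,
            mul_mul_self_of_inv hd, h.a_mul, h.a_mul_a_mul]
    all_goals
      obtain rfl : d = b := h.special
      fin_cases i <;> fin_cases j <;> first
        | exact absurd rfl hv
        | simp [beltMap, beltVertex, beltVolt, nine_two_zero, nine_two_one, nine_two_two, two_r,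
            eight_r, twoTable, voltTwo, eightTable, voltEight, voltFourteen, eightLabel, mul_assoc,
            halfTurn,
            h.a_inv, h.a_mul, h.a_mul_a_mul]
  map_two_base := by
    rintro ⟨⟨g, i⟩, j⟩ hv
    replace hv : offTable c (eightTable c 2 (beltVertex c i j)) = true :=
      mem_eightOff.1 (not_not.1 hv)
    cases c
    · obtain ⟨hb, hb1, hd, hd1⟩ := h.special
      fin_cases i <;> fin_cases j <;> first
        | exact absurd hv (by decide)
        | simp [beltMap, beltVertex, beltVolt, nine_two_zero, nine_two_one, nine_two_two, two_r,
            eight_r, twoTable, voltTwo, eightTable, voltEight, voltFourteen, eightLabel, mul_assoc,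
            halfTurn,
            h.a_inv, hb, hd, mul_self_of_inv hb, mul_self_of_inv hd, mul_mul_self_of_inv hb,
            mul_mul_self_of_inv hd, h.a_mul, h.a_mul_a_mul]
    all_goals
      obtain rfl : d = b := h.special
      fin_cases i <;> fin_cases j <;> first
        | exact absurd hv (by decide)
        | simp [beltMap, beltVertex, beltVolt, nine_two_zero, nine_two_one, nine_two_two, two_r,
            eight_r, twoTable, voltTwo, eightTable, voltEight, voltFourteen, eightLabel, mul_assoc,
            halfTurn,
            h.a_inv, h.a_mul, h.a_mul_a_mul]

end Datum
end Canonical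

/-! ### The order-three relation as a closed walk, and type {3,9} -/

namespace FlagMap

variable {F : Type*} (M : FlagMap F)

/-- The walk `0, 1, 2, 1, 2` of adjacencies. -/
def walk (f : F) : F := M.r 2 (M.r 1 (M.r 2 (M.r 1 (M.r 0 f))))

/-- Conjugation by `r 0 r 2` inverts the walk; this carries properties from one label class of flags
to the other. -/
theorem walk_conj (f : F) : M.walk (M.r 0 (M.r 2 (M.walk f))) = M.r 0 (M.r 2 f) := by
  simp only [walk, M.r_r, M.comm]

theorem aut_walk {φ : Equiv.Perm F} (hφ : φ ∈ M.aut) (f : F) : φ (M.walk f) = M.walk (φ f) := by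
  simp only [walk, M.aut_r hφ]

/-- If the walk `0, 1, 2, 1, 2` closes up exactly after three rounds, the dual of the Petrial of the
truncation has type `{3, 9}`. -/
theorem nine_isEquivelar (h3 : ∀ f, M.walk (M.walk (M.walk f)) = f) (h1 : ∀ f, M.walk f ≠ f) :
    M.truncation.petrial.dual.IsEquivelar 3 9 := by
  have hp := Fact.mk Nat.prime_three
  rintro ⟨f, j⟩
  constructor
  · refine Function.minimalPeriod_eq_prime ?_ ?_
    · change M.truncation.petrial.dual.r 0 (M.truncation.petrial.dual.r 1
        (M.truncation.petrial.dual.r 0 (M.truncation.petrial.dual.r 1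
        (M.truncation.petrial.dual.r 0 (M.truncation.petrial.dual.r 1 (f, j)))))) = (f, j)
      fin_cases j <;>
        simp [nine_zero_zero, nine_zero_one, nine_zero_two, nine_one_zero, nine_one_one,
          nine_one_two, M.r_r]
    · change ¬ M.truncation.petrial.dual.r 0 (M.truncation.petrial.dual.r 1 (f, j)) = (f, j)
      fin_cases j <;>
        simp [nine_zero_zero, nine_zero_one, nine_zero_two, nine_one_zero, nine_one_one,
          nine_one_two]
  · set R := fun x => M.truncation.petrial.dual.r 1 (M.truncation.petrial.dual.r 2 x) with hR
    -- Three rotation steps return to the same kind of flag of the truncation and act on `F` as a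
    -- conjugate of the walk or of its inverse, which has period 3; so the degree is 9.
    have key : ∀ u : F → F, (∀ x, u x ≠ x) → (∀ x, u (u (u x)) = x) →
        (∀ x, R (R (R (x, j))) = (u x, j)) → M.truncation.petrial.dual.degree (f, j) = 9 := by
      intro u hu hu3 hR3
      refine Function.minimalPeriod_eq_prime_pow (p := 3) (k := 1) ?_ ?_
      · change ¬ R (R (R (f, j))) = (f, j)
        rw [hR3]
        exact fun hc => hu f (congrArg Prod.fst hc)
      · change R (R (R (R (R (R (R (R (R (f, j))))))))) = (f, j)
        rw [hR3, hR3, hR3, hu3]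
    have h2 : ∀ f, M.walk (M.walk f) ≠ f := fun f hc => h1 f (by
      conv_lhs => rw [← hc]
      exact h3 f)
    fin_cases j
    · refine key (fun x => M.r 2 (M.walk (M.r 2 x))) (fun x hx => h1 (M.r 2 x) ?_) (fun x => ?_)
        fun x => ?_
      · rwa [M.r_eq_iff] at hx
      · simp only [M.r_r, h3]
      · simp [hR, nine_one_zero, nine_one_one, nine_one_two, nine_two_zero, nine_two_one,
          nine_two_two, walk, M.r_r]
    · refine key (fun x => M.r 2 (M.walk (M.walk (M.r 2 x)))) (fun x hx => h2 (M.r 2 x) ?_)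
        (fun x => ?_) fun x => ?_
      · rwa [M.r_eq_iff] at hx
      · simp only [M.r_r, h3]
      · have hw : M.walk (M.r 2 (M.r 0 (M.r 2 (M.r 1 (M.r 2 (M.r 1 x)))))) = M.r 2 x := by
          simp only [walk, ← M.comm, M.r_r]
        have : M.r 0 (M.r 2 (M.r 1 (M.r 2 (M.r 1 x)))) = M.r 2 (M.walk (M.walk (M.r 2 x))) := by
          rw [← hw, h3, M.r_r]
        simp [hR, nine_one_zero, nine_one_one, nine_one_two, nine_two_zero, nine_two_one,
          nine_two_two, this]
    · refine key (fun x => M.r 1 (M.r 2 (M.walk (M.r 2 (M.r 1 x)))))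
        (fun x hx => h1 (M.r 2 (M.r 1 x)) ?_) (fun x => ?_) fun x => ?_
      · rw [M.r_eq_iff, M.r_eq_iff] at hx
        exact hx
      · simp only [M.r_r, h3]
      · simp [hR, nine_one_zero, nine_one_one, nine_one_two, nine_two_zero, nine_two_one,
          nine_two_two, walk, M.r_r]

/-- Automorphisms commute with adjacencies, so a product of them acts on the base flag by
adjacencies in reversed order. Thus `ρ₀ρ₁ρ₂₁₂` and `ρ₀σ₁₂²` both send the base flag along the same
walk, which treats the three cases together. -/
theorem exists_walk_of_startRelation {c : Case} (h : c.StartRelation M) :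
    ∃ f, ∃ φ ∈ M.aut, φ f = M.walk f ∧ orderOf φ = 3 := by
  have key : M.Relation20 → ∃ f, ∃ φ ∈ M.aut, φ f = M.walk f ∧ orderOf φ = 3 := by
    rintro ⟨f, ρ, σ, hρ, hσ, e1, e2, e3⟩
    refine ⟨f, _, M.aut.mul_mem hρ (M.aut.pow_mem hσ 2), ?_, e3⟩
    simp only [pow_two, Equiv.Perm.mul_apply, e2, M.aut_r hσ, M.aut_r hρ, e1, walk]
  cases c
  · obtain ⟨f, ρ, ρ₁, σ, hρ, hρ₁, hσ, e1, e2, e4, e3⟩ := h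
    refine ⟨f, _, M.aut.mul_mem (M.aut.mul_mem hρ hρ₁) hσ, ?_, e3⟩
    simp only [Equiv.Perm.mul_apply, e2, M.aut_r hρ₁, M.aut_r hρ, e1, e4, walk]
  · exact key h
  · exact key h

variable {M}

/-- Automorphisms spread the relation over the label class of the base flag, and `walk_conj` takes
it to the other class. -/
theorem IsLabelling.walk_walk_walk {c : Case} {l : F → Fin 2} (hl : M.IsLabelling c.graphTwo l)
    (h : c.StartRelation M) (f : F) : M.walk (M.walk (M.walk f)) = f ∧ M.walk f ≠ f := by
  obtain ⟨f₀, φ, hφ, e, ho⟩ := M.exists_walk_of_startRelation h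
  have base : ∀ f, l f = l f₀ → M.walk (M.walk (M.walk f)) = f ∧ M.walk f ≠ f := by
    intro f hf
    obtain ⟨ψ, hψ, rfl⟩ := hl.2 _ _ hf.symm
    simp only [← M.aut_walk hψ, EmbeddingLike.apply_eq_iff_eq, ne_eq]
    constructor
    · rw [← e, ← M.aut_walk hφ, ← e, ← M.aut_walk hφ, ← M.aut_walk hφ, ← e]
      have h3 : φ ^ 3 = 1 := ho ▸ pow_orderOf_eq_one φ
      simpa [pow_succ] using DFunLike.congr_fun h3 f₀
    · rw [← e]
      intro hc
      have : φ = 1 := M.aut_ext hφ M.aut.one_mem (x := f₀) hc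
      simp [this] at ho
  have two : ∀ f, l (M.r 0 f) = l f ∧ (l f ≠ l f₀ → l (M.r 2 f) = l f₀) ∧ l (M.walk f) = l f := by
    intro f
    simp only [walk, hl.1, twoTable_apply]
    generalize l f = x, l f₀ = y
    cases c <;> revert x y <;> decide
  by_cases hf : l f = l f₀
  · exact base f hf
  · have hb : ∀ x, l x = l f → l (M.r 0 (M.r 2 x)) = l f₀ := fun x hx => by
      rw [(two _).1, (two _).2.1 (hx ▸ hf)]
    constructor
    · have e3 := (base (M.r 0 (M.r 2 (M.walk (M.walk (M.walk f))))) (hb _ (by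
        simp only [(two _).2.2]))).1
      simp only [M.walk_conj] at e3
      exact ((M.r 2).injective ((M.r 0).injective e3)).symm
    · intro hc
      refine (base (M.r 0 (M.r 2 f)) (hb _ rfl)).2 ?_
      have := M.walk_conj f
      rwa [hc] at this

/-- An isomorphism of maps induces one of the duals of the Petrials of the truncations. -/
theorem IsIso.nine {F' : Type*} {M' : FlagMap F'} {ψ : F ≃ F'} (h : M.IsIso M' ψ) :
    M.truncation.petrial.dual.IsIso M'.truncation.petrial.dual
      (ψ.prodCongr (Equiv.refl (Fin 3))) := by
  rintro i ⟨f, j⟩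
  fin_cases i <;> fin_cases j <;>
    simp [nine_zero_zero, nine_zero_one, nine_zero_two, nine_one_zero, nine_one_one,
      nine_one_two, nine_two_zero, nine_two_one, nine_two_two, h _ _]

end FlagMap

/-! ### Relations and labellings of the standard maps -/

section Canonical

variable {G : Type*} [Group G] {c : Case} {a b d : G}

namespace Datum

theorem of_conj {w x : G} (hw : w ^ 3 = 1) (hw1 : w ≠ 1) (g : G)
    (hx : x = g * w * g⁻¹ ∨ x = g * w⁻¹ * g⁻¹) : x ^ 3 = 1 ∧ x ≠ 1 := by
  rcases hx with rfl | rfl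
  · rw [conj_pow, hw]
    simpa using hw1
  · rw [conj_pow, inv_pow, hw]
    simpa using hw1

theorem pow_three (h : Datum c a b d) : (a * (b * d)) ^ 3 = 1 := by
  have := h.cube
  simpa [pow_succ, mul_assoc] using this

theorem cube_of_pow (h : (a * (b * d)) ^ 3 = 1) :
    a * (b * (d * (a * (b * (d * (a * (b * d))))))) = 1 := by
  simpa [pow_succ, mul_assoc] using h

variable [Finite G]

theorem two_startRelation (h : Datum c a b d) : c.StartRelation h.two := by
  have h3 := Fact.mk Nat.prime_three
  have key : ∀ x : G, x ^ 3 = 1 ∧ x ≠ 1 → orderOf (translation (Fin 2) x) = 3 := by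
    rintro x ⟨hx, hx'⟩
    rw [orderOf_translation]
    exact orderOf_eq_prime hx hx'
  have conj := fun x => of_conj (x := x) h.pow_three h.ne
  have mulT : ∀ x y : G, translation (Fin 2) x * translation (Fin 2) y =
      translation (Fin 2) (x * y) := fun x y => ((translationHom G (Fin 2)).map_mul x y).symm
  cases c
  · refine ⟨(1, 0), translation _ (halfTurn Case.B a b d), translation _ b, translation _ d,
      translation_mem_aut _ _, translation_mem_aut _ _, translation_mem_aut _ _, ?_, ?_, ?_, ?_⟩
    · simp [two_r, voltTwo, twoTable]
    · simp [two_r, voltTwo, twoTable]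
    · simp [two_r, voltTwo, twoTable]
    · rw [mulT, mulT]
      -- With `h` the half turn, `h b d` is the conjugate of `abd` by `(bd)⁻¹`. In the other two
      -- cases `h b⁻²` is a conjugate of the inverse of `abb`.
      refine key _ (conj _ (b * d)⁻¹ (Or.inl ?_))
      simp [halfTurn, mul_assoc]
  · obtain rfl : d = b := h.special
    refine ⟨(1, 0), translation _ (halfTurn Case.C a d d), translation _ d⁻¹,
      translation_mem_aut _ _, translation_mem_aut _ _, ?_, ?_, ?_⟩
    · simp [two_r, voltTwo, twoTable]
    · simp [two_r, voltTwo, twoTable]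
    · rw [pow_two, mulT, mulT]
      refine key _ (conj _ 1 (Or.inr ?_))
      simp [halfTurn, mul_assoc, h.a_inv]
  · obtain rfl : d = b := h.special
    refine ⟨(1, 0), translation _ (halfTurn Case.D a d d), translation _ d⁻¹,
      translation_mem_aut _ _, translation_mem_aut _ _, ?_, ?_, ?_⟩
    · simp [two_r, voltTwo, twoTable]
    · simp [two_r, voltTwo, twoTable]
    · rw [pow_two, mulT, mulT]
      refine key _ (conj _ (d * a) (Or.inr ?_))
      simp [halfTurn, mul_assoc, h.a_inv, h.a_mul_a_mul]

theorem two_isLabelling (h : Datum c a b d) : h.two.IsLabelling c.graphTwo (fun x => x.2) :=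
  voltageMap_isLabelling h.two_isVoltage (L := id) Function.injective_id
    fun i v => (twoTable_apply c i v).symm

theorem bar_isLabelling (h : Datum c a b d) : h.bar.IsLabelling c.graph (fun x => x.2) :=
  voltageMap_isLabelling h.bar_isVoltage (L := id) Function.injective_id
    fun i v => (graph_apply c i v).symm

theorem eight_isCaseLabelling (h : Datum c a b d) :
    IsCaseLabelling c h.eight {x | x.2 ∉ eightOff c} (fun x => eightLabel c x.2) := by
  refine ⟨voltageMap_isLabelling h.eight_isVoltage (eightLabel_injective c)
    (eightLabel_table c), fun x => ?_, fun x => ?_⟩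
  · have := h.isCollapsing.e_not_mem x
    exact this
  · obtain ⟨g, v⟩ := x
    simp only [Set.mem_ofPred_eq, not_not, mem_eightOff]
    cases c <;> revert v <;> decide

end Datum
end Canonical

theorem Datum.gen_of {G : Type*} [Group G] {a b d : G}
    (h : ∀ K : Subgroup G, a ∈ K → b ∈ K → d ∈ K → K = ⊤) : Subgroup.closure {a, b, d} = ⊤ :=
  h _ (Subgroup.subset_closure (by simp)) (Subgroup.subset_closure (by simp))
    (Subgroup.subset_closure (by simp))

/-! ### Data recovered from maps with a two-vertex labelling -/

namespace FlagMap

variable {F : Type*} {M : FlagMap F}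

/-- A map with a two-vertex labelling in which the walk `0, 1, 2, 1, 2` closes up exactly after
three rounds is given by a datum over its label group. -/
theorem IsLabelling.exists_datum_two {c : Case} {l : F → Fin 2} (hl : M.IsLabelling c.graphTwo l)
    (hw : ∀ f, M.walk (M.walk (M.walk f)) = f ∧ M.walk f ≠ f) (f₀ : F) (hf : l f₀ = 0)
    [Finite (M.labelGroup l)] :
    ∃ (a b d : M.labelGroup l) (h : Datum c a b d) (ψ : M.labelGroup l × Fin 2 ≃ F),
      h.two.IsIso M ψ ∧ ψ (1, 0) = f₀ ∧ ∀ x, l (ψ x) = x.2 := by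
  have hl2 : l (M.r 2 f₀) = 1 := by
    rw [hl.1, hf, twoTable_apply]; rfl
  obtain ⟨ν, ψ, hψ, hadj, hν⟩ := hl.exists_voltage ![f₀, M.r 2 f₀] (by
    intro v
    fin_cases v
    · exact hf
    · exact hl2)
  have hlψ : ∀ x, l (ψ x) = x.2 := by
    rintro ⟨g, v⟩
    rw [hψ, g.2.2]
    fin_cases v
    · exact hf
    · exact hl2
  have hr : ∀ i g v, M.r i (ψ (g, v)) = ψ (g * ν i v, twoTable c i v) := fun i g v => by
    rw [← hadj, voltageAdj, twoTable_apply]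
  -- The two representatives are `2`-adjacent, so no voltage is left on the `2`-edge.
  have h2 : ∀ v, ν 2 v = 1 := by
    intro v
    apply hν
    rw [twoTable_apply]
    fin_cases v
    · rfl
    · exact (M.r_r 2 f₀).symm
  have ht2 : ∀ v, twoTable c 2 v = 1 - v := by
    cases c <;> decide
  have ht0 : ∀ v, twoTable c 0 v = v := by
    cases c <;> decide
  have hinv : ∀ i v, ν i v * ν i (twoTable c i v) = 1 := by
    intro i v
    have := M.r_r i (ψ (1, v))
    rw [hr, hr] at this
    simpa using congrArg Prod.fst (ψ.injective this)
  have h00 : ν 0 1 = ν 0 0 := by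
    have := M.comm (ψ (1, 0))
    simp only [hr, h2, ht2, ht0] at this
    simpa using congrArg Prod.fst (ψ.injective this)
  have hA : ν 0 0 * ν 0 0 = 1 := by simpa [ht0] using hinv 0 0
  have hA1 : ν 0 0 ≠ 1 := by
    intro hc
    refine M.no_fix 0 (ψ (1, 0)) ?_
    rw [hr, hc, ht0, mul_one]
  have hA' : (ν 0 0)⁻¹ = ν 0 0 := inv_eq_of_mul_eq_one_right hA
  have hgen : ∀ K : Subgroup (M.labelGroup l), ν 0 0 ∈ K → ν 1 0 ∈ K → ν 1 1 ∈ K → K = ⊤ := by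
    intro K k0 k1 k2
    refine closure_eq_top_of_voltage M (T := fun i => c.graphTwo i) ψ hadj K fun i v => ?_
    fin_cases i <;> fin_cases v
    exacts [k0, (h00 ▸ k0 : ν 0 1 ∈ K), k1, k2, (h2 0).symm ▸ K.one_mem, (h2 1).symm ▸ K.one_mem]
  have fin : ∀ a b d, (h : Datum c a b d) → (∀ i v, voltTwo c a b d i v = ν i v) →
      ∃ (a b d : M.labelGroup l) (h : Datum c a b d) (ψ : M.labelGroup l × Fin 2 ≃ F),
      h.two.IsIso M ψ ∧ ψ (1, 0) = f₀ ∧ ∀ x, l (ψ x) = x.2 := by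
    intro a b d h hv
    refine ⟨a, b, d, h, ψ, ?_, hψ 1 0, hlψ⟩
    rintro i ⟨g, v⟩
    rw [hr, Datum.two_r, hv]
  have h3 := congrArg Prod.fst (ψ.injective (by
    simpa only [walk, hr] using (hw (ψ (1, 0))).1))
  have h1 := fun hc => (hw (ψ (1, 0))).2 (by simpa only [walk, hr] using congrArg ψ hc)
  cases c
  · have hb := hinv 1 0
    have hd := hinv 1 1
    have hb1 : ν 1 0 ≠ 1 := fun hc => M.no_fix 1 (ψ (1, 0)) (by rw [hr, hc, mul_one]; rfl)
    have hd1 : ν 1 1 ≠ 1 := fun hc => M.no_fix 1 (ψ (1, 1)) (by rw [hr, hc, mul_one]; rfl)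
    simp [twoTable, h2] at h3 h1 hb hd
    -- The voltage of `r 0` has to become the half turn. Solving the definition of `halfTurn` for
    -- `a` gives the conjugate of `ν 0 0` used here; the other cases proceed likewise.
    have hx := Datum.of_conj (w := ν 0 0 * ν 1 0 * ν 1 1)
      (x := ν 1 0 * ν 1 1 * ν 0 0 * (ν 1 0 * ν 1 1)⁻¹ * (ν 1 0 * ν 1 1))
      (by simpa [pow_succ, mul_assoc] using h3) h1 (ν 1 0 * ν 1 1) (Or.inl (by simp [mul_assoc]))
    refine fin (ν 1 0 * ν 1 1 * ν 0 0 * (ν 1 0 * ν 1 1)⁻¹) (ν 1 0) (ν 1 1)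
      { a_inv := by simp [mul_assoc, hA']
        a_ne := fun hc => hA1 (conj_eq_one_iff.1 hc)
        cube := Datum.cube_of_pow hx.1
        ne := hx.2
        gen := ?_
        special := ⟨inv_eq_of_mul_eq_one_right hb, hb1, inv_eq_of_mul_eq_one_right hd, hd1⟩ } ?_
    · refine Datum.gen_of fun K ka kb kd => hgen K ?_ kb kd
      simpa [mul_assoc] using K.mul_mem (K.mul_mem (K.inv_mem (K.mul_mem kb kd)) ka)
        (K.mul_mem kb kd)
    · intro i v
      fin_cases i <;> fin_cases v <;> simp [voltTwo, halfTurn, h2, h00, mul_assoc]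
  · have hb : ν 1 0 = (ν 1 1)⁻¹ := eq_inv_of_mul_eq_one_left (hinv 1 0)
    simp [twoTable, h2, hb] at h3 h1
    have hx := Datum.of_conj (w := ν 0 0 * (ν 1 1)⁻¹ * (ν 1 1)⁻¹)
      (x := ν 1 1 * ν 1 1 * ν 0 0 * (ν 1 1 * ν 1 1)⁻¹ * (ν 1 1 * ν 1 1))
      (by simpa [pow_succ, mul_assoc] using h3) h1 1 (Or.inr (by simp [mul_assoc, hA']))
    refine fin (ν 1 1 * ν 1 1 * ν 0 0 * (ν 1 1 * ν 1 1)⁻¹) (ν 1 1) (ν 1 1)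
      { a_inv := by simp [mul_assoc, hA']
        a_ne := fun hc => hA1 (conj_eq_one_iff.1 hc)
        cube := Datum.cube_of_pow hx.1
        ne := hx.2
        gen := ?_
        special := rfl } ?_
    · refine Datum.gen_of fun K ka kb _ => hgen K ?_ (hb ▸ K.inv_mem kb) kb
      simpa [mul_assoc] using K.mul_mem (K.mul_mem (K.inv_mem (K.mul_mem kb kb)) ka)
        (K.mul_mem kb kb)
    · intro i v
      fin_cases i <;> fin_cases v <;> simp [voltTwo, halfTurn, h2, h00, hb, mul_assoc]
  · have hb : ν 1 0 = (ν 1 1)⁻¹ := eq_inv_of_mul_eq_one_left (hinv 1 0)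
    simp [twoTable, h2, hb] at h3 h1
    have hx := Datum.of_conj (w := ν 0 0 * (ν 1 1)⁻¹ * (ν 1 1)⁻¹)
      (x := (ν 1 1)⁻¹ * ν 0 0 * (ν 1 1)⁻¹⁻¹ * (ν 1 1 * ν 1 1))
      (by simpa [pow_succ, mul_assoc] using h3) h1 ((ν 1 1)⁻¹ * ν 0 0)
      (Or.inr (by simp [mul_assoc, hA', mul_mul_self_of_inv hA']))
    refine fin ((ν 1 1)⁻¹ * ν 0 0 * (ν 1 1)⁻¹⁻¹) (ν 1 1) (ν 1 1)
      { a_inv := by simp [mul_assoc, hA']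
        a_ne := fun hc => hA1 (conj_eq_one_iff.1 hc)
        cube := Datum.cube_of_pow hx.1
        ne := hx.2
        gen := ?_
        special := rfl } ?_
    · refine Datum.gen_of fun K ka kb _ => hgen K ?_ (hb ▸ K.inv_mem kb) kb
      simpa [mul_assoc] using K.mul_mem (K.mul_mem kb ka) (K.inv_mem kb)
    · intro i v
      fin_cases i <;> fin_cases v <;> simp [voltTwo, halfTurn, h2, h00, hb, mul_assoc]

end FlagMap

/-! ### Data recovered from labelled maps of type {3,7} -/

namespace FlagMap

variable {X : Type*} {M : FlagMap X}

theorem iterate_of_degree {x : X} (h : M.degree x = 7) :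
    (fun g => M.r 1 (M.r 2 g))^[7] x = x := by
  rw [← h]
  exact Function.iterate_minimalPeriod

/-- The flags in cyclic order around the vertex of `y`. -/
def around (M : FlagMap X) (y : X) : Fin 14 → X := fun v =>
  if v.val % 2 = 0 then (fun g => M.r 2 (M.r 1 g))^[v.val / 2] y
  else M.r 1 ((fun g => M.r 2 (M.r 1 g))^[v.val / 2] y)

/-- Only the last and the first of the fourteen flags need an argument: degree 7 closes the cycle
there. The three graphs share their `1`- and `2`-edges, so the list fits every case. -/
theorem around_r {y : X} (h : M.IsEquivelar 3 7) (c : Case) (v : Fin 14) :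
    M.around y (graphTable c 1 v) = M.r 1 (M.around y v) ∧
      M.around y (graphTable c 2 v) = M.r 2 (M.around y v) := by
  have h7' : M.r 1 (M.r 2 (M.r 1 (M.r 2 (M.r 1 (M.r 2 (M.r 1 (M.r 2 (M.r 1 (M.r 2 (M.r 1 (M.r 2
      (M.r 1 y)))))))))))) = M.r 2 y := by
    have := iterate_of_degree (h (M.r 2 y)).2
    simpa [M.r_r] using this
  rw [M.r_eq_iff] at h7'
  have h7'' := h7'
  rw [M.r_eq_iff] at h7''
  cases c <;> fin_cases v <;> first
    | (simp [graphTable, around, M.r_r, h7']; done)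
    | simp [graphTable, around, M.r_r, h7'']

/-- A map of type `{3, 7}` labelled by one of the fourteen-vertex graphs is given by a datum over
its label group. -/
theorem IsLabelling.exists_datum_bar {c : Case} {l : X → Fin 14} (hl : M.IsLabelling c.graph l)
    (he : M.IsEquivelar 3 7) [Finite (M.labelGroup l)] :
    ∃ (a b d : M.labelGroup l) (h : Datum c a b d) (ψ : M.labelGroup l × Fin 14 ≃ X),
      h.bar.IsIso M ψ ∧ ∀ x, l (ψ x) = x.2 := by
  obtain ⟨x₀⟩ := M.nonempty
  obtain ⟨y, hy⟩ : ∃ y, l y = 0 := by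
    refine forall_of_succ (P := fun v => ∃ y, l y = v) ⟨_, x₀, rfl⟩ ?_ 0
    rintro v ⟨y, rfl⟩
    rcases graphTable_succ c (l y) with e | e
    · exact ⟨M.r 1 y, by rw [hl.1, graph_apply, e]⟩
    · exact ⟨M.r 2 y, by rw [hl.1, graph_apply, e]⟩
  have hp : ∀ v, l (M.around y v) = v := by
    refine forall_of_succ ⟨0, hy⟩ ?_
    intro v hv
    rcases graphTable_succ c v with e | e
    · rw [← e, (around_r he c v).1, hl.1, hv, graph_apply]
    · rw [← e, (around_r he c v).2, hl.1, hv, graph_apply]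
  obtain ⟨ν, ψ, hψ, hadj, hν⟩ := hl.exists_voltage (M.around y) hp
  have hlψ : ∀ x, l (ψ x) = x.2 := by
    rintro ⟨g, v⟩
    rw [hψ, g.2.2, hp]
  have hr : ∀ i g v, M.r i (ψ (g, v)) = ψ (g * ν i v, graphTable c i v) := fun i g v => by
    rw [← hadj, voltageAdj, graph_apply]
  have h1 : ∀ v, ν 1 v = 1 := fun v => hν _ _ (by rw [graph_apply, (around_r he c v).1])
  have h2 : ∀ v, ν 2 v = 1 := fun v => hν _ _ (by rw [graph_apply, (around_r he c v).2])
  have hinv : ∀ v, ν 0 v * ν 0 (graphTable c 0 v) = 1 := by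
    intro v
    have := M.r_r 0 (ψ (1, v))
    rw [hr, hr] at this
    simpa using congrArg Prod.fst (ψ.injective this)
  have hcomm : ∀ v, ν 0 (graphTable c 2 v) = ν 0 v := by
    intro v
    have := M.comm (ψ (1, v))
    simp only [hr, h2] at this
    simpa using congrArg Prod.fst (ψ.injective this)
  have hedge : ∀ v, graphTable c 0 (graphTable c 2 v) = v → ν 0 v ≠ 1 := by
    intro v hv hc
    refine M.no_fix_edge (ψ (1, v)) ?_
    simp only [hr, h2, hcomm, hc, hv, mul_one]
  -- Going once around each triangle yields all relations of the datum: two kinds of triangles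
  -- express voltages through others, and the triangle labelled `12`, `13` gives the relation of
  -- order 3.
  have htri : ∀ v, ν 0 (graphTable c 1 v) * (ν 0 (graphTable c 1 (graphTable c 0
      (graphTable c 1 v))) * ν 0 (graphTable c 1 (graphTable c 0 (graphTable c 1 (graphTable c 0
      (graphTable c 1 v)))))) = 1 := by
    intro v
    have := triangle_relation (he (ψ (1, v))).1
    simp only [hr, h1, mul_one, one_mul] at this
    simpa only [mul_assoc] using congrArg Prod.fst (ψ.injective this)
  -- A rotation step at label `13` returns to this label, so trivial voltage would give a face with
  -- one edge.
  have hface : ν 0 12 ≠ 1 := by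
    intro hc
    have h3 := (he (ψ (1, 13))).1
    have : M.codegree (ψ (1, 13)) = 1 := by
      rw [codegree, Function.minimalPeriod_eq_one_iff_isFixedPt]
      change M.r 0 (M.r 1 _) = _
      have e1 : graphTable c 1 13 = 12 := by cases c <;> decide
      have e2 : graphTable c 0 12 = 13 := by cases c <;> decide
      simp only [hr, h1, e1, hc, mul_one, e2]
    omega
  have fin : ∀ a b d, (h : Datum c a b d) → (∀ v, voltFourteen c a b d v = ν 0 v) →
      ∃ (a b d : M.labelGroup l) (h : Datum c a b d) (ψ : M.labelGroup l × Fin 14 ≃ X),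
      h.bar.IsIso M ψ ∧ ∀ x, l (ψ x) = x.2 := by
    intro a b d h hv
    refine ⟨a, b, d, h, ψ, ?_, hlψ⟩
    rintro i ⟨g, v⟩
    rw [hr, Datum.bar_r]
    fin_cases i
    · simp [voltBar, hv]
    · simp [voltBar, h1]
    · simp [voltBar, h2]
  have hgen : ∀ K : Subgroup (M.labelGroup l), (∀ v, ν 0 v ∈ K) → K = ⊤ := by
    intro K k0
    refine closure_eq_top_of_voltage M (T := fun i => c.graph i) ψ hadj K fun i v => ?_
    fin_cases i
    exacts [k0 v, (h1 v).symm ▸ K.one_mem, (h2 v).symm ▸ K.one_mem]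
  clear hν hψ hadj
  cases c
  case D =>
    have c2 : ν 0 2 = ν 0 1 := hcomm 1
    have c4 : ν 0 4 = ν 0 3 := hcomm 3
    have c6 : ν 0 6 = ν 0 5 := hcomm 5
    have c8 : ν 0 8 = ν 0 7 := hcomm 7
    have c10 : ν 0 10 = ν 0 9 := hcomm 9
    have c12 : ν 0 12 = ν 0 11 := hcomm 11
    have c0 : ν 0 0 = ν 0 13 := hcomm 13
    have i1 : ν 0 5 = (ν 0 1)⁻¹ := eq_inv_of_mul_eq_one_right (hinv 1)
    have i3 : ν 0 9 = (ν 0 3)⁻¹ := eq_inv_of_mul_eq_one_right (hinv 3)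
    have i12 : ν 0 13 = (ν 0 12)⁻¹ := eq_inv_of_mul_eq_one_right (hinv 12)
    have i7 : (ν 0 7)⁻¹ = ν 0 7 := inv_eq_of_mul_eq_one_right (by
      have : ν 0 7 * ν 0 8 = 1 := hinv 7
      rwa [c8] at this)
    have f2 : ν 0 3 * (ν 0 8 * ν 0 6) = 1 := htri 2
    have f0 : ν 0 1 * (ν 0 4 * ν 0 11) = 1 := htri 0
    have f13 : ν 0 12 * (ν 0 12 * ν 0 12) = 1 := htri 13
    have n7 : ν 0 7 ≠ 1 := hedge 7 rfl
    have x1 : ν 0 1 = ν 0 3 * ν 0 7 := by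
      rw [c6, c8, i1, ← mul_assoc, mul_inv_eq_one] at f2
      exact f2.symm
    have x11 : ν 0 11 = (ν 0 3 * ν 0 7 * ν 0 3)⁻¹ := by
      rw [x1, c4, ← mul_assoc] at f0
      exact eq_inv_of_mul_eq_one_right f0
    have hx := Datum.of_conj (w := ν 0 12) (x := ν 0 7 * (ν 0 3 * ν 0 3))
      (by simpa [pow_succ, mul_assoc] using f13) hface (ν 0 3)⁻¹ (Or.inr (by
        simp [c12, x11, mul_assoc]))
    have hv : ∀ v, voltFourteen Case.D (ν 0 7) (ν 0 3) (ν 0 3) v = ν 0 v := by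
      intro v
      fin_cases v <;> simp [voltFourteen, c2, c4, c6, c8, c10, c12, c0, i1, i3, i12, x11, x1, i7]
    refine fin (ν 0 7) (ν 0 3) (ν 0 3)
      { a_inv := i7
        a_ne := n7
        cube := Datum.cube_of_pow hx.1
        ne := hx.2
        gen := Datum.gen_of fun K ka kb _ => hgen K fun v => ?_
        special := rfl } hv
    rw [← hv]
    have m1 := K.mul_mem kb ka
    have m2 := K.mul_mem m1 kb
    have m3 := K.inv_mem kb
    have m4 := K.inv_mem m1
    have m5 := K.inv_mem m2
    fin_cases v
    exacts [m2, m1, m1, kb, kb, m4, m4, ka, ka, m3, m3, m5, m5, m2]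
  all_goals
    have c2 : ν 0 2 = ν 0 1 := hcomm 1
    have c4 : ν 0 4 = ν 0 3 := hcomm 3
    have c6 : ν 0 6 = ν 0 5 := hcomm 5
    have c8 : ν 0 8 = ν 0 7 := hcomm 7
    have c10 : ν 0 10 = ν 0 9 := hcomm 9
    have c12 : ν 0 12 = ν 0 11 := hcomm 11
    have c0 : ν 0 0 = ν 0 13 := hcomm 13
    have i9 : ν 0 9 = (ν 0 3)⁻¹ := by
      rw [← c10]
      exact eq_inv_of_mul_eq_one_right (hinv 3)
    have i12 : ν 0 13 = (ν 0 12)⁻¹ := eq_inv_of_mul_eq_one_right (hinv 12)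
    have i1 : (ν 0 1)⁻¹ = ν 0 1 := inv_eq_of_mul_eq_one_right (by
      have : ν 0 1 * ν 0 2 = 1 := hinv 1
      rwa [c2] at this)
    have f0 : ν 0 1 * (ν 0 3 * ν 0 11) = 1 := htri 0
    have f13 : ν 0 12 * (ν 0 12 * ν 0 12) = 1 := htri 13
    have n1 : ν 0 1 ≠ 1 := hedge 1 rfl
    have hx : ∀ d, ν 0 3 = ν 0 5 * d → (ν 0 1 * (ν 0 5 * d)) ^ 3 = 1 ∧ ν 0 1 * (ν 0 5 * d) ≠ 1 := by
      intro d x3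
      refine Datum.of_conj (w := ν 0 12) (by simpa [pow_succ, mul_assoc] using f13) hface 1
        (Or.inr ?_)
      rw [← mul_assoc, x3] at f0
      rw [c12, eq_inv_of_mul_eq_one_right f0]
      simp
    have hv : ∀ d, ν 0 7 = d⁻¹ → ν 0 3 = ν 0 5 * d → ∀ v : Fin 14,
        ![ν 0 1 * ν 0 5 * d, ν 0 1, ν 0 1, ν 0 5 * d, ν 0 5 * d, ν 0 5, ν 0 5, d⁻¹, d⁻¹,
          (ν 0 5 * d)⁻¹, (ν 0 5 * d)⁻¹, (ν 0 1 * ν 0 5 * d)⁻¹, (ν 0 1 * ν 0 5 * d)⁻¹,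
          ν 0 1 * ν 0 5 * d] v = ν 0 v := by
      intro d x7 x3 v
      rw [← mul_assoc, x3] at f0
      have x11 := eq_inv_of_mul_eq_one_right f0
      fin_cases v <;> simp [c2, c4, c6, c8, c10, c12, c0, i9, i12, x11, x7, x3, mul_assoc]
    have hg : ∀ d, ν 0 7 = d⁻¹ → ν 0 3 = ν 0 5 * d →
        Subgroup.closure {ν 0 1, ν 0 5, d} = ⊤ := by
      intro d x7 x3
      refine Datum.gen_of fun K ka kb kd => hgen K fun v => ?_
      rw [← hv d x7 x3]
      have m1 := K.mul_mem kb kd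
      have m2 := K.mul_mem (K.mul_mem ka kb) kd
      have m3 := K.inv_mem kd
      have m4 := K.inv_mem m1
      have m5 := K.inv_mem m2
      fin_cases v
      exacts [m2, ka, ka, m1, m1, kb, kb, m3, m3, m4, m4, m5, m5, m2]
  · have f4 : ν 0 5 * (ν 0 7 * ν 0 9) = 1 := htri 4
    have i5 : ν 0 5 * ν 0 6 = 1 := hinv 5
    have i7 : ν 0 7 * ν 0 8 = 1 := hinv 7
    rw [c6] at i5
    rw [c8] at i7
    rw [i9, ← mul_assoc, mul_inv_eq_one] at f4
    have j5 := inv_eq_of_mul_eq_one_right i5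
    have j7 := inv_eq_of_mul_eq_one_right i7
    refine fin (ν 0 1) (ν 0 5) (ν 0 7)
      { a_inv := i1
        a_ne := n1
        cube := Datum.cube_of_pow (hx _ f4.symm).1
        ne := (hx _ f4.symm).2
        gen := hg _ j7.symm f4.symm
        special := ⟨j5, hedge 5 rfl, j7, hedge 7 rfl⟩ } (hv _ j7.symm f4.symm)
  · have f4 : ν 0 5 * (ν 0 6 * ν 0 9) = 1 := htri 4
    have i7 : ν 0 7 = (ν 0 5)⁻¹ := eq_inv_of_mul_eq_one_right (hinv 5)
    rw [i9, c6, ← mul_assoc, mul_inv_eq_one] at f4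
    refine fin (ν 0 1) (ν 0 5) (ν 0 5)
      { a_inv := i1
        a_ne := n1
        cube := Datum.cube_of_pow (hx _ f4.symm).1
        ne := (hx _ f4.symm).2
        gen := hg _ i7 f4.symm
        special := rfl } (hv _ i7 f4.symm)

end FlagMap

namespace FlagMap

variable {X : Type*} {M : FlagMap X}

/-! ### Flag orbits of vertex-transitive maps -/

/-- Representatives of the flag orbits give the orbit number and a labelling by orbits. -/
theorem exists_orbit_label {n : ℕ} (q : Fin n → X) (hq : ∀ x, ∃ v, M.SameOrbit x (q v))
    (hinj : ∀ v w, M.SameOrbit (q v) (q w) → v = w) :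
    M.numOrbits = n ∧ ∃ l : X → Fin n, (∀ v, l (q v) = v) ∧
      ∀ x y, l x = l y ↔ M.SameOrbit x y := by
  choose l hl using hq
  have hl' : ∀ x y, l x = l y ↔ M.SameOrbit x y := by
    refine fun x y => ⟨fun e => ?_, fun e => ?_⟩
    · have := hl y
      rw [← e] at this
      exact (hl x).trans this.symm
    · exact hinj _ _ ((hl x).symm.trans (e.trans (hl y)))
  refine ⟨?_, l, fun v => hinj _ _ (hl _).symm, hl'⟩
  have hbij : Function.Bijective
      (fun v => (Quotient.mk (MulAction.orbitRel M.aut X) (q v))) := by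
    constructor
    · intro v w e
      exact hinj _ _ (M.orbitRel_iff.1 (Quotient.exact e))
    · intro z
      obtain ⟨x, rfl⟩ := Quotient.exists_rep z
      exact ⟨l x, Quotient.sound (M.orbitRel_iff.2 (hl x).symm)⟩
  rw [numOrbits, ← Nat.card_congr (Equiv.ofBijective _ hbij), Nat.card_fin]

/-- Adjacencies of `M.around y`. -/
def wheelOne : Fin 14 → Fin 14 := ![1, 0, 3, 2, 5, 4, 7, 6, 9, 8, 11, 10, 13, 12]
/-- Adjacencies of `M.around y`. -/
def wheelTwo : Fin 14 → Fin 14 := ![13, 2, 1, 4, 3, 6, 5, 8, 7, 10, 9, 12, 11, 0]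

theorem around_wheelOne (h : M.IsEquivelar 3 7) (y : X) (v : Fin 14) :
    M.around y (wheelOne v) = M.r 1 (M.around y v) := (around_r h Case.B v).1

theorem around_wheelTwo (h : M.IsEquivelar 3 7) (y : X) (v : Fin 14) :
    M.around y (wheelTwo v) = M.r 2 (M.around y v) := (around_r h Case.B v).2

theorem IsVertexTransitive.exists_around (hv : M.IsVertexTransitive) (h : M.IsEquivelar 3 7)
    (y x : X) : ∃ v, M.SameOrbit x (M.around y v) := by
  obtain ⟨φ, hφ, hc⟩ := hv x y
  have key : ∃ v, M.around y v = φ x := by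
    refine M.cell_induction (P := fun z => ∃ v, M.around y v = z) ?_ (M.cell_symm hc) ⟨0, rfl⟩
    rintro j hj _ ⟨v, rfl⟩
    fin_cases j
    · exact absurd rfl hj
    · exact ⟨_, around_wheelOne h y v⟩
    · exact ⟨_, around_wheelTwo h y v⟩
  obtain ⟨v, hv⟩ := key
  exact ⟨v, φ, hφ, hv.symm⟩

/-- Two flag orbits exchanged by the `1`- and `2`-adjacencies. -/
theorem isRegular_or_isChiral (h : M.IsEquivelar 3 7) {y : X} (h2 : M.SameOrbit (M.r 2 y) (M.r 1 y))
    (hy : ∀ x, M.SameOrbit x y ∨ M.SameOrbit x (M.r 1 y)) : M.IsRegular ∨ M.IsChiral := by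
  by_cases h1 : M.SameOrbit y (M.r 1 y)
  · left
    refine (exists_orbit_label (n := 1) (fun _ => y) (fun x => ⟨0, ?_⟩) fun v w _ =>
      Subsingleton.elim v w).1
    exact (hy x).elim id fun e => e.trans h1.symm
  right
  have hr1 : ∀ {x}, M.SameOrbit x (M.r 1 y) → M.SameOrbit (M.r 1 x) y := fun e => by
    simpa [M.r_r] using e.r 1
  have h0 : M.SameOrbit (M.r 0 y) (M.r 1 y) := by
    -- Otherwise `r 0` would preserve both orbits while `r 1` exchanges them. The triangle relation
    -- contains `r 1` three times, an odd number.
    refine (hy _).resolve_left fun h0 => h1 ?_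
    have a1 : ∀ {x}, M.SameOrbit x y → M.SameOrbit (M.r 0 x) y := fun e => (e.r 0).trans h0
    have a2 : ∀ {x}, M.SameOrbit x (M.r 1 y) → M.SameOrbit (M.r 0 x) (M.r 1 y) := fun {x} e => by
      have := (e.trans h2.symm).r 0
      rw [M.comm] at this
      exact this.trans ((h0.r 2).trans h2)
    have := a2 ((a1 (hr1 (a2 ((SameOrbit.refl M y).r 1)))).r 1)
    rwa [triangle_relation (h y).1] at this
  have hi : ∀ i, M.SameOrbit (M.r i y) (M.r 1 y) := by
    intro i
    fin_cases i
    exacts [h0, SameOrbit.refl M _, h2]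
  have hi' : ∀ i, M.SameOrbit (M.r i (M.r 1 y)) y := by
    intro i
    simpa [M.r_r] using ((hi i).symm.r i)
  refine ⟨?_, ?_⟩
  · refine (exists_orbit_label (n := 2) ![y, M.r 1 y] (fun x => ?_) ?_).1
    · exact (hy x).elim (fun e => ⟨0, e⟩) fun e => ⟨1, e⟩
    · intro v w e
      fin_cases v <;> fin_cases w
      exacts [rfl, absurd e h1, absurd e.symm h1, rfl]
  · intro i f hf
    rcases hy f with e | e
    · exact h1 (e.symm.trans (hf.trans ((e.r i).trans (hi i))))
    · exact h1 (((hi' i).symm.trans (e.symm.r i)).trans (hf.symm.trans e))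

section Wheel

variable (h : M.IsEquivelar 3 7) {y : X}

include h

theorem sameOrbit_around_forall {g : Fin 14 → Fin 14}
    (hg : ∀ v, (wheelOne v = v + 1 ∧ wheelOne (g v) = g (v + 1)) ∨
      (wheelTwo v = v + 1 ∧ wheelTwo (g v) = g (v + 1)))
    {v : Fin 14} (e : M.SameOrbit (M.around y v) (M.around y (g v))) (w : Fin 14) :
    M.SameOrbit (M.around y w) (M.around y (g w)) := by
  refine forall_of_succ (P := fun w => M.SameOrbit (M.around y w) (M.around y (g w))) ⟨v, e⟩ ?_ w
  intro w ih
  rcases hg w with ⟨e1, e2⟩ | ⟨e1, e2⟩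
  · rw [← e2, ← e1, around_wheelOne h, around_wheelOne h]
    exact ih.r 1
  · rw [← e2, ← e1, around_wheelTwo h, around_wheelTwo h]
    exact ih.r 2

/-- A rotation about a vertex mapping flags to flags of the same orbit. -/
theorem isRegular_or_isChiral_of_even (hv : M.IsVertexTransitive) {v w : Fin 14} (hvw : v ≠ w)
    (hp : (v.val + w.val) % 2 = 0) (e : M.SameOrbit (M.around y v) (M.around y w)) :
    M.IsRegular ∨ M.IsChiral := by
  have e1 : ∀ k : ℕ, ∀ u, M.SameOrbit (M.around y u) (M.around y (u + k • (w - v))) := by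
    intro k u
    induction k with
    | zero => simpa using SameOrbit.refl M _
    | succ k ih =>
      refine ih.trans ?_
      have := sameOrbit_around_forall h (g := fun u => u + (w - v)) (v := v) (y := y) (by
        clear e ih; revert v w; decide) (by simpa using e) (u + k • (w - v))
      simpa [succ_nsmul, add_assoc] using this
  -- A nonzero even residue modulo 14 generates all even residues, as 7 is prime.
  obtain ⟨k, hk⟩ : ∃ k : Fin 14, k.val • (w - v) = 2 := by
    clear e e1; revert v w; decide
  have e2 : ∀ (m : ℕ) (u : Fin 14), M.SameOrbit (M.around y u) (M.around y (u + m • 2)) := by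
    intro m u
    rw [← hk, ← mul_nsmul']
    exact e1 _ u
  have e3 : ∀ u, (u.val % 2 = 0 → M.SameOrbit (M.around y u) (M.around y 0)) ∧
      (u.val % 2 = 1 → M.SameOrbit (M.around y u) (M.around y 1)) := by
    refine fun u => ⟨fun hu => ?_, fun hu => ?_⟩
    · obtain ⟨m, hm⟩ : ∃ m : Fin 7, u + m.val • 2 = 0 := by revert u; decide
      exact hm ▸ e2 m u
    · obtain ⟨m, hm⟩ : ∃ m : Fin 7, u + m.val • 2 = 1 := by revert u; decide
      exact hm ▸ e2 m u
  refine isRegular_or_isChiral h (y := y) ?_ ?_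
  · exact around_wheelTwo h y 0 ▸ around_wheelOne h y 0 ▸ (e3 13).2 rfl
  · intro x
    obtain ⟨u, hu⟩ := hv.exists_around h y x
    rcases Nat.mod_two_eq_zero_or_one u.val with hp | hp
    · exact Or.inl (hu.trans ((e3 u).1 hp))
    · exact Or.inr (hu.trans (around_wheelOne h y 0 ▸ (e3 u).2 hp))

/-- A reflection fixing a vertex maps some flag to its `1`-adjacent flag. -/
theorem exists_sameOrbit_r_one {v w : Fin 14} (hp : (v.val + w.val) % 2 = 1)
    (e : M.SameOrbit (M.around y v) (M.around y w)) : ∃ z, M.SameOrbit z (M.r 1 z) := by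
  have e1 := sameOrbit_around_forall h (g := fun u => v + w - u) (v := v) (y := y) (by
        clear e; revert v w; decide) (by simpa using e)
  -- A reflection of the wheel has a `1`-edge at one end of its axis because the degree 7 is odd.
  obtain ⟨u, hu⟩ : ∃ u, v + w - u = wheelOne u := by clear e e1; revert v w; decide
  refine ⟨M.around y u, ?_⟩
  have := e1 u
  rwa [hu, around_wheelOne h] at this

end Wheel

/-- There is no type graph with seven vertices in a row around a vertex of degree seven. -/
theorem seven_false (f : Fin 7 → Fin 7) (hf : ∀ v, f (f v) = v)
    (h2 : ∀ v, f (![1, 0, 3, 2, 5, 4, 6] v) = ![1, 0, 3, 2, 5, 4, 6] (f v))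
    (h3 : ∀ v, f (![0, 2, 1, 4, 3, 6, 5] (f (![0, 2, 1, 4, 3, 6, 5] (f
      (![0, 2, 1, 4, 3, 6, 5] v))))) = v) : False := by
  -- `f` commutes with the `2`-adjacency, whose only fixed vertex is 6. Hence `f` fixes 6 and is
  -- determined by three values.
  have h6 : f 6 = 6 := by
    have := h2 6
    simp at this
    revert this
    generalize f 6 = x
    revert x
    decide
  have e : f = ![f 0, ![1, 0, 3, 2, 5, 4, 6] (f 0), f 2, ![1, 0, 3, 2, 5, 4, 6] (f 2),
      f 4, ![1, 0, 3, 2, 5, 4, 6] (f 4), 6] := by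
    funext v
    fin_cases v
    exacts [rfl, h2 0, rfl, h2 2, rfl, h2 4, h6]
  clear h2 h6
  revert e hf h3
  generalize f 0 = x, f 2 = y, f 4 = z
  rintro hf h3 rfl
  revert x y z
  decide

/-- A vertex-transitive map of type `{3, 7}` with reflections has one flag orbit. -/
theorem isRegular_or_isChiral_of_r_one (h : M.IsEquivelar 3 7) (hv : M.IsVertexTransitive) {y : X}
    (hy : M.SameOrbit y (M.r 1 y)) : M.IsRegular ∨ M.IsChiral := by
  by_contra hn
  have hne : ∀ v w : Fin 14, (v.val + w.val) % 2 = 0 →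
      M.SameOrbit (M.around y v) (M.around y w) → v = w := fun v w hp e => by
    by_contra hvw
    exact hn (isRegular_or_isChiral_of_even h hv hvw hp e)
  have hs : ∀ u, M.SameOrbit (M.around y u) (M.around y (1 - u)) :=
    sameOrbit_around_forall h (g := fun u => 1 - u) (v := 0) (by decide) hy
  -- One flag from each pair exchanged by `u ↦ 1 - u`. The wheel is folded to a path with a
  -- `1`-semi-edge at one end and a `2`-semi-edge at the other.
  let q : Fin 7 → Fin 14 := ![0, 13, 12, 11, 10, 9, 8]
  have hsur : ∀ v, ∃ i, v = q i ∨ 1 - v = q i := by decide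
  obtain ⟨-, l, hl, hl'⟩ := exists_orbit_label (M := M) (fun i => M.around y (q i)) (by
      intro x
      obtain ⟨v, hx⟩ := hv.exists_around h y x
      obtain ⟨i, hi | hi⟩ := hsur v
      · exact ⟨i, hi ▸ hx⟩
      · exact ⟨i, hi ▸ hx.trans (hs v)⟩) (by
      intro i j e
      have h1 := hne (q i) (q j)
      have h2 := hne (q i) (1 - q j)
      have e' := e.trans (hs _)
      have key : ∀ i j : Fin 7, (((q i).val + (q j).val) % 2 = 0 → q i = q j) →
        (((q i).val + (1 - q j).val) % 2 = 0 → q i = 1 - q j) → i = j := by decide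
      exact key i j (fun hp => h1 hp e) fun hp => h2 hp e')
  have hlr : ∀ i x, l (M.r i x) = l (M.r i (M.around y (q (l x)))) := fun i x =>
    (hl' _ _).2 (((hl' _ _).1 (hl (l x)).symm).r i)
  have hl1 : ∀ x, l (M.r 1 x) = ![0, 2, 1, 4, 3, 6, 5] (l x) := by
    intro x
    rw [hlr, ← hl (![0, 2, 1, 4, 3, 6, 5] (l x)), hl', ← around_wheelOne h]
    generalize l x = i
    have key : ∀ i, wheelOne (q i) = q (![0, 2, 1, 4, 3, 6, 5] i) ∨
      wheelOne (q i) = 1 - q (![0, 2, 1, 4, 3, 6, 5] i) := by decide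
    rcases key i with e | e
    · rw [e]; exact SameOrbit.refl M _
    · rw [e]; exact (hs _).symm
  have hl2 : ∀ x, l (M.r 2 x) = ![1, 0, 3, 2, 5, 4, 6] (l x) := by
    intro x
    rw [hlr, ← hl (![1, 0, 3, 2, 5, 4, 6] (l x)), hl', ← around_wheelTwo h]
    generalize l x = i
    have key : ∀ i, wheelTwo (q i) = q (![1, 0, 3, 2, 5, 4, 6] i) ∨
      wheelTwo (q i) = 1 - q (![1, 0, 3, 2, 5, 4, 6] i) := by decide
    rcases key i with e | e
    · rw [e]; exact SameOrbit.refl M _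
    · rw [e]; exact (hs _).symm
  obtain ⟨f, hf⟩ : ∃ f : Fin 7 → Fin 7, ∀ x, l (M.r 0 x) = f (l x) :=
    ⟨fun i => l (M.r 0 (M.around y (q i))), hlr 0⟩
  refine seven_false f (fun i => ?_) (fun i => ?_) fun i => ?_
  · have := congrArg l (M.r_r 0 (M.around y (q i)))
    simpa only [hf, hl] using this
  · have := congrArg l (M.comm (M.around y (q i)))
    simpa only [hf, hl2, hl] using this
  · have := congrArg l (triangle_relation (h (M.around y (q i))).1)
    simpa only [hf, hl1, hl] using this

/-- A vertex-transitive map of type `{3, 7}` is regular, chiral, or has `14` flag orbits, which are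
met in cyclic order around each vertex. -/
theorem IsVertexTransitive.trichotomy (hv : M.IsVertexTransitive) (h : M.IsEquivelar 3 7) :
    (M.IsRegular ∨ M.IsChiral) ∨
      ∀ y v w, M.SameOrbit (M.around y v) (M.around y w) → v = w := by
  by_contra! hn
  obtain ⟨hn, y, v, w, e, hne⟩ := hn
  have hn' : ¬ (M.IsRegular ∨ M.IsChiral) := by tauto
  rcases Nat.mod_two_eq_zero_or_one (v.val + w.val) with hp | hp
  · exact hn' (isRegular_or_isChiral_of_even h hv hne hp e)
  · obtain ⟨z, hz⟩ := exists_sameOrbit_r_one h hp e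
    exact hn' (isRegular_or_isChiral_of_r_one h hv hz)

/-- A labelling by one of the fourteen-vertex graphs makes the map vertex-transitive. -/
theorem IsLabelling.isVertexTransitive {c : Case} {l : X → Fin 14} (hl : M.IsLabelling c.graph l) :
    M.IsVertexTransitive := by
  intro f g
  have key : ∀ v, ∃ z, M.cell 0 z g ∧ l z = v := by
    refine forall_of_succ (P := fun v => ∃ z, M.cell 0 z g ∧ l z = v) ⟨_, g, M.cell_refl g, rfl⟩ ?_
    rintro _ ⟨z, hz, rfl⟩
    rcases graphTable_succ c (l z) with e | e
    · exact ⟨M.r 1 z, M.cell_symm (M.cell_step (by decide) (M.cell_symm hz)),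
        by rw [hl.1, graph_apply, e]⟩
    · exact ⟨M.r 2 z, M.cell_symm (M.cell_step (by decide) (M.cell_symm hz)),
        by rw [hl.1, graph_apply, e]⟩
  obtain ⟨z, hz, e⟩ := key (l f)
  obtain ⟨φ, hφ, rfl⟩ := hl.2 f z e.symm
  exact ⟨φ, hφ, hz⟩

end FlagMap

/-! ### Classification of the fourteen-vertex type graphs -/

theorem wheel_eq (c : Case) (v : Fin 14) : wheelOne v = graphTable c 1 v ∧
    wheelTwo v = graphTable c 2 v := by
  cases c <;> revert v <;> decide

/-- A permutation of the wheel commuting with `wheelTwo`, given by four of its values. -/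
def wheelPerm (x y z w : Fin 14) : Fin 14 → Fin 14 :=
  ![11, x, wheelTwo x, y, wheelTwo y, z, wheelTwo z, w, wheelTwo w, wheelTwo (wheelOne x),
    wheelOne x, 0, 13, 12]

set_option synthInstance.maxSize 1024 in
set_option synthInstance.maxHeartbeats 200000 in
/-- The involutions of the wheel with fourteen vertices that, together with the adjacencies of
the wheel, satisfy the relations of a map of type `{3, 7}`, and that have a triangle invariant under
rotation at the vertices `12`, `13`. -/
theorem wheel_classification (f : Fin 14 → Fin 14) (hf : ∀ v, f (f v) = v)
    (h2 : ∀ v, f (wheelTwo v) = wheelTwo (f v))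
    (h3 : ∀ v, f (wheelOne (f v)) = wheelOne (f (wheelOne v))) (h12 : f 12 = 13) :
    ∃ c : Case, f = graphTable c 0 ∨ f = fun v => 11 - graphTable c 0 (11 - v) := by
  have e13 : f 13 = 12 := h12 ▸ hf 12
  have e0 : f 0 = 11 := by
    have := h2 13
    rw [e13] at this
    exact this
  have e11 : f 11 = 0 := e0 ▸ hf 0
  have e10 : f 10 = wheelOne (f 1) := by
    have := h3 0
    rw [e0] at this
    exact this
  have e2 : f 2 = wheelTwo (f 1) := h2 1
  have e4 : f 4 = wheelTwo (f 3) := h2 3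
  have e8 : f 8 = wheelTwo (f 7) := h2 7
  have e6 : f 6 = wheelTwo (f 5) := h2 5
  have e9 : f 9 = wheelTwo (wheelOne (f 1)) := by
    rw [← e10]
    exact h2 10
  have e : f = wheelPerm (f 1) (f 3) (f 5) (f 7) := by
    funext v
    fin_cases v
    exacts [e0, rfl, e2, rfl, e4, rfl, e6, rfl, e8, e9, e10, e11, h12, e13]
  -- Four values determine `f`. The side conditions, each forced by the relations, prune the search.
  -- The solutions are the three graphs and their images under `v ↦ 11 - v`, the reflection of the
  -- wheel exchanging `12` and `13`.
  have key : ∀ x : Fin 14, x ∈ [2, 4, 5, 7, 8] →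
      ∀ y : Fin 14, y ∉ [0, 11, 12, 13] → (x = 2 → y = 10) ∧ (x = 4 → y = 2) ∧ (x = 7 → y = 4) →
      ∀ z : Fin 14, z ∉ [0, 11, 12, 13] → (x = 5 → z = 1) ∧ (x = 8 → y = wheelOne (wheelTwo z)) →
      ∀ w : Fin 14, w ∉ [0, 11, 12, 13] → (x = 7 → w = 1) ∧ (x = 8 → wheelTwo w = 1) →
      (∀ v, wheelPerm x y z w (wheelPerm x y z w v) = v) →
      (∀ v, wheelPerm x y z w (wheelOne (wheelPerm x y z w v)) =
        wheelOne (wheelPerm x y z w (wheelOne v))) →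
      ∃ s : Fin 6, ∀ v, wheelPerm x y z w v = ![graphTable Case.B 0 v, graphTable Case.C 0 v,
        graphTable Case.D 0 v, 11 - graphTable Case.B 0 (11 - v),
        11 - graphTable Case.C 0 (11 - v), 11 - graphTable Case.D 0 (11 - v)] s := by
    decide +kernel
  have hinv : ∀ u v, f u = v → f v = u := fun u v huv => huv ▸ hf u
  have hne : ∀ u, u ∉ [0, 11, 12, 13] → f u ∉ [0, 11, 12, 13] := by
    intro u hu
    simp only [List.mem_cons, List.not_mem_nil, or_false, not_or] at hu ⊢
    exact ⟨fun h => hu.2.1 ((hinv _ _ h).symm.trans e0),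
      fun h => hu.1 ((hinv _ _ h).symm.trans e11),
      fun h => hu.2.2.2 ((hinv _ _ h).symm.trans h12),
      fun h => hu.2.2.1 ((hinv _ _ h).symm.trans e13)⟩
  have hy : f 3 = wheelOne (f (wheelOne (wheelTwo (f 1)))) := by
    have h4 : f (wheelOne (wheelTwo (f 1))) = wheelOne (f 3) := e2 ▸ h3 2
    rw [h4]
    generalize f 3 = y
    revert y
    decide
  have h1 : f 1 ∈ [2, 4, 5, 7, 8] := by
    have m1 := hne 1 (by decide)
    have m10 := hne 10 (by decide)
    rw [e10] at m10
    have m3 : f 1 ≠ 3 := fun h => by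
      have h10 := hinv _ _ (e10.trans (congrArg wheelOne h))
      rw [show wheelOne 3 = 2 from rfl, e2, h] at h10
      exact absurd h10 (by decide)
    have m9 : f 1 ≠ 9 := fun h => by
      have h9 := hinv _ _ h
      rw [e9, h] at h9
      exact absurd h9 (by decide)
    have m6 : f 1 ≠ 6 := fun h => by
      rw [h, show wheelOne (wheelTwo 6) = 4 from rfl, e4] at hy
      generalize f 3 = y at hy
      revert y
      decide
    generalize f 1 = x at m1 m10 m3 m9 m6
    revert x
    decide
  have res := key (f 1) h1 (f 3) (hne 3 (by decide)) ⟨fun h => ?_, fun h => ?_, fun h => ?_⟩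
    (f 5) (hne 5 (by decide)) ⟨hinv _ _, fun h => ?_⟩ (f 7) (hne 7 (by decide))
    ⟨hinv _ _, fun h => e8 ▸ hinv _ _ h⟩
  rotate_left
  · rw [hy, h]
    exact congrArg wheelOne e0
  · rw [hy, h]
    exact congrArg wheelOne (e2.trans (congrArg wheelTwo h))
  · rw [hy, h]
    exact congrArg wheelOne (e9.trans (congrArg (fun x => wheelTwo (wheelOne x)) h))
  · rw [hy, h]
    exact congrArg wheelOne e6
  rw [← e] at res
  obtain ⟨s, hs⟩ := res hf h3
  fin_cases s
  exacts [⟨Case.B, Or.inl (funext hs)⟩, ⟨Case.C, Or.inl (funext hs)⟩,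
    ⟨Case.D, Or.inl (funext hs)⟩, ⟨Case.B, Or.inr (funext hs)⟩, ⟨Case.C, Or.inr (funext hs)⟩,
    ⟨Case.D, Or.inr (funext hs)⟩]

namespace FlagMap

variable {X : Type*} {M : FlagMap X}

/-- The type graph determines the case. -/
theorem IsTypeLabelling.case_unique {c c' : Case} {l l' : X → Fin 14}
    (h : M.IsTypeLabelling c.graph l) (h' : M.IsTypeLabelling c'.graph l') : c = c' := by
  have tr : ∀ {c : Case} {l : X → Fin 14}, M.IsTypeLabelling c.graph l →
      ((∃ v, graphTable c 0 (graphTable c 2 v) = v ∧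
        graphTable c 0 (graphTable c 2 (graphTable c 1 (graphTable c 2 v))) =
          graphTable c 1 (graphTable c 2 v)) ↔
      ∃ x, M.SameOrbit (M.r 0 (M.r 2 x)) x ∧
        M.SameOrbit (M.r 0 (M.r 2 (M.r 1 (M.r 2 x)))) (M.r 1 (M.r 2 x))) ∧
      ((∃ v, graphTable c 0 (graphTable c 1 v) = v ∧
        graphTable c 0 (graphTable c 2 (graphTable c 1 (graphTable c 2 v))) =
          graphTable c 1 (graphTable c 2 v)) ↔
      ∃ x, M.SameOrbit (M.r 0 (M.r 1 x)) x ∧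
        M.SameOrbit (M.r 0 (M.r 2 (M.r 1 (M.r 2 x)))) (M.r 1 (M.r 2 x))) := by
    intro c l h
    simp only [← h.2.2, h.2.1, graph_apply]
    exact ⟨h.1.exists, h.1.exists⟩
  -- The first invariant, two consecutive edges at a vertex both reversed by half turns, occurs only
  -- in (B). The second, an edge reversed by a half turn following an edge of a rotation-invariant
  -- triangle, separates (C) from (D).
  have h1 := (tr h).1.trans (tr h').1.symm
  have h2 := (tr h).2.trans (tr h').2.symm
  clear h h' tr
  cases c <;> cases c' <;> first
    | rfl
    | (exfalso; revert h1; decide)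
    | (exfalso; revert h2; decide)

/-- A vertex-transitive map of type `{3, 7}` that is neither regular nor chiral has fourteen flag
orbits and one of the three type graphs. -/
theorem IsVertexTransitive.exists_case (hv : M.IsVertexTransitive) (h : M.IsEquivelar 3 7)
    (hr : ¬ M.IsRegular) (hc : ¬ M.IsChiral) :
    M.numOrbits = 14 ∧ ∃ c : Case, M.IsOfType c.graph := by
  have hinj := (hv.trichotomy h).resolve_left (by tauto)
  have lab := fun y => exists_orbit_label (M.around y) (hv.exists_around h y) (hinj y)
  have rel : ∀ y (l : X → Fin 14), (∀ v, l (M.around y v) = v) →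
      (∀ x y, l x = l y ↔ M.SameOrbit x y) → ∃ f : Fin 14 → Fin 14,
      (∀ x, l (M.r 0 x) = f (l x)) ∧ (∀ x, l (M.r 1 x) = wheelOne (l x)) ∧
      ∀ x, l (M.r 2 x) = wheelTwo (l x) := by
    intro y l hl hl'
    have hlr : ∀ i x, l (M.r i x) = l (M.r i (M.around y (l x))) := fun i x =>
      (hl' _ _).2 (((hl' _ _).1 (hl (l x)).symm).r i)
    refine ⟨fun i => l (M.r 0 (M.around y i)), hlr 0, fun x => ?_, fun x => ?_⟩
    · rw [hlr, ← around_wheelOne h, hl]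
    · rw [hlr, ← around_wheelTwo h, hl]
  obtain ⟨y⟩ := M.nonempty
  obtain ⟨z, hz⟩ : ∃ z, M.SameOrbit (M.r 0 (M.r 1 z)) z := by
    obtain ⟨-, l, hl, hl'⟩ := lab y
    obtain ⟨f, hf0, hf1, hf2⟩ := rel y l hl hl'
    have h3 : ∀ v, f (wheelOne (f (wheelOne (f (wheelOne v))))) = v := fun v => by
      have := congrArg l (triangle_relation (h (M.around y v)).1)
      simpa only [hf0, hf1, hl] using this
    -- The rotation of triangles acts on the 14 orbits with trivial cube, and 14 is not divisible by
    -- 3, so some orbit is fixed.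
    have hp := Fact.mk Nat.prime_three
    let g : Function.End (Fin 14) := fun v => f (wheelOne v)
    have hg : g ^ 3 ^ 1 = 1 := by
      funext v
      exact h3 v
    have hcard := Equiv.Perm.card_fixedPoints_modEq hg
    have hne : Nonempty (Function.fixedPoints g) := by
      rw [← Fintype.card_pos_iff]
      by_contra h0
      rw [Nat.eq_zero_of_not_pos h0] at hcard
      exact absurd hcard (by decide)
    obtain ⟨v, hv⟩ := hne
    refine ⟨M.around y v, (hl' _ _).1 ?_⟩
    rw [hf0, hf1, hl]
    exact hv
  -- Starting the wheel at `M.r 2 z` gives the rotation-invariant triangle at `z` the labels `12`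
  -- and `13`.
  obtain ⟨hn, l, hl, hl'⟩ := lab (M.r 2 z)
  obtain ⟨f, hf0, hf1, hf2⟩ := rel _ l hl hl'
  have hff : ∀ v, f (f v) = v := fun v => by
    have := congrArg l (M.r_r 0 (M.around (M.r 2 z) v))
    simpa only [hf0, hl] using this
  have lz : l z = 13 := by
    have := around_wheelTwo h (M.r 2 z) 0
    rw [← hl 13]
    refine congrArg l (Eq.symm (this.trans ?_))
    exact M.r_r 2 z
  have hsur : Function.Surjective l := fun v => ⟨_, hl v⟩
  obtain ⟨c, hc⟩ := wheel_classification f hff (fun v => by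
      have := congrArg l (M.comm (M.around (M.r 2 z) v))
      simpa only [hf0, hf2, hl] using this) (fun v => by
      have := congrArg l (triangle_braid (h (M.around (M.r 2 z) v)).1)
      simpa only [hf0, hf1, hl] using this.symm) (by
      have := (hl' _ _).2 hz
      rw [hf0, hf1, lz] at this
      exact this)
  refine ⟨hn, c, ?_⟩
  rcases hc with rfl | rfl
  · refine ⟨l, hsur, fun i x => ?_, hl'⟩
    rw [graph_apply]
    fin_cases i
    exacts [hf0 x, (hf1 x).trans (wheel_eq c _).1, (hf2 x).trans (wheel_eq c _).2]
  · refine ⟨fun x => 11 - l x, fun v => ?_, fun i x => ?_, fun x y => ?_⟩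
    · obtain ⟨x, hx⟩ := hsur (11 - v)
      exact ⟨x, by simp [hx]⟩
    · rw [graph_apply]
      fin_cases i
      · change 11 - l (M.r 0 x) = _
        rw [hf0, sub_sub_cancel]
        rfl
      · change 11 - l (M.r 1 x) = graphTable c 1 _
        rw [hf1, ← (wheel_eq c _).1]
        beta_reduce
        generalize l x = v
        revert v
        decide
      · change 11 - l (M.r 2 x) = graphTable c 2 _
        rw [hf2, ← (wheel_eq c _).2]
        beta_reduce
        generalize l x = v
        revert v
        decide
    · rw [← hl', sub_right_inj]

end FlagMap

/-! ### Assembly: from a map of type {3,7} to its construction -/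

theorem three_mul_eq_of_card {F : Type*} (M : FlagMap F) {χ : ℤ} {n : ℕ} (h : 6 * χ = -(n : ℤ))
    (hF : Nat.card F = n * 2) : 3 * χ = -(M.numCells 1 : ℤ) := by
  have := M.card_eq_four_mul_numCells
  omega

/-- The label of the split places of the construction in standard form. -/
def splitLabel : Case → Fin 14
  | Case.D => 1
  | _ => 12

theorem splitFlags_eightLabel (c : Case) (G : Type*) :
    splitFlags c (fun x : G × Fin 8 => eightLabel c x.2) (splitLabel c) =
      {x | x.2 ∈ eightSplit c} := by
  ext ⟨g, v⟩
  simp only [splitFlags, Set.mem_ofPred_eq, mem_eightSplit]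
  cases c <;> revert v <;> decide

namespace FlagMap

/-- A map of one of the three types arises from the construction. -/
theorem IsTypeLabelling.exists_construction {X : Type u} {Mbar : FlagMap X} {c : Case}
    {lbar : X → Fin 14} (hl : Mbar.IsTypeLabelling c.graph lbar) (he : Mbar.IsEquivelar 3 7)
    (h14 : Mbar.numOrbits = 14) :
    ∃ (F : Type u) (M : FlagMap F) (l : F → Fin 2)
      (Y : Type u) (M₃ : FlagMap Y) (B : Set Y) (l₃ : Y → Fin 14) (k : Fin 14) (e : Y → X),
      M.IsLabelling c.graphTwo l ∧ c.StartRelation M ∧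
      IsUnbelted M M₃ B ∧ IsCaseLabelling c M₃ B l₃ ∧ k ∈ c.splitLabels ∧
      IsCollapsing Mbar Mbar.aut {x | lbar x ∈ c.deleted} M₃ (splitFlags c l₃ k) e ∧
      (∀ y, l₃ y = lbar (e y)) ∧
      Nonempty (Mbar.aut ≃* M.labelGroup l) ∧
      6 * Mbar.eulerChar = -(Nat.card (M.labelGroup l) : ℤ) ∧
      3 * Mbar.eulerChar = -(M.numCells 1 : ℤ) := by
  have := Mbar.finite
  have hcard := Mbar.card_eq_numOrbits_mul
  rw [h14] at hcard
  have haut := hl.labelGroup_eq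
  obtain ⟨a, b, d, h, ψ, hψ, hlψ⟩ := hl.isLabelling.exists_datum_bar he
  have iso := voltageMapLabelGroup h.two_isVoltage (L := id) Function.injective_id
  have hn : Nat.card (h.two.labelGroup fun x => x.2) = Nat.card Mbar.aut := by
    rw [← haut]
    exact (Nat.card_congr iso.toEquiv).symm
  have h6 : 6 * Mbar.eulerChar = -(Nat.card (h.two.labelGroup fun x => x.2) : ℤ) := by
    rw [hn]
    exact he.eulerChar hcard
  refine ⟨_, h.two, fun x => x.2, _, h.eight, _, fun x => eightLabel c x.2, splitLabel c,
    ψ ∘ fun x => (x.1, eightLabel c x.2), h.two_isLabelling, h.two_startRelation,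
    ⟨_, h.isRebelting⟩, h.eight_isCaseLabelling, ?_, ?_,
    fun y => (hlψ (y.1, eightLabel c y.2)).symm,
    ⟨(MulEquiv.subgroupCongr haut.symm).trans iso⟩, h6, three_mul_eq_of_card _ h6 ?_⟩
  · cases c <;> simp [splitLabel, Case.splitLabels]
  · rw [splitFlags_eightLabel]
    refine h.isCollapsing.map hψ le_rfl (fun φ => ?_) fun x => ?_
    · rw [← haut]
      constructor
      · intro hφ
        refine ⟨?_, fun x => ?_⟩
        · have e : ψ.symm.permCongr (ψ.permCongr φ) = φ := Equiv.ext fun x => by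
            simp only [Equiv.permCongr_apply, Equiv.symm_symm, Equiv.symm_apply_apply]
          exact e ▸ hψ.symm.conj_mem hφ.1
        · have := hφ.2 (ψ x)
          simpa [hlψ] using this
      · intro hφ
        refine ⟨hψ.conj_mem hφ.1, fun x => ?_⟩
        have := hφ.2 (ψ.symm x)
        simpa [← hlψ] using this
    · simp [hlψ]
  · rw [Nat.card_prod, Nat.card_fin, hn, haut]

end FlagMap

/-! ### Assembly: every outcome of the construction has standard form -/

/-- The reflection of the eight-vertex graphs, fixing the deleted labels. -/
def eightReflection (c : Case) : Fin 14 → Fin 14 :=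
  match c with
  | Case.D => ![11, 10, 2, 3, 5, 4, 6, 7, 8, 9, 1, 0, 13, 12]
  | _ => ![0, 1, 2, 3, 9, 8, 7, 6, 5, 4, 10, 11, 13, 12]

/-- The reflection exchanges the two admissible split labels, so choosing the other `k` amounts to
reflecting the labelling. -/
theorem graphEight_reflection (c : Case) (i : Fin 3) (v : Fin 14) :
    c.graphEight i (eightReflection c v) = eightReflection c (c.graphEight i v) := by
  cases c <;> revert i v <;> decide

namespace FlagMap

variable {F : Type*} {M : FlagMap F}

/-- The labels of a two-vertex labelling can be exchanged. -/
theorem IsLabelling.exists_label_eq_zero {c : Case} {l : F → Fin 2}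
    (hl : M.IsLabelling c.graphTwo l) (f₀ : F) :
    ∃ l' : F → Fin 2, M.IsLabelling c.graphTwo l' ∧ M.labelGroup l' = M.labelGroup l ∧
      l' f₀ = 0 := by
  refine ⟨fun f => l f - l f₀, ⟨fun i f => ?_, fun f g e => hl.2 f g ?_⟩, ?_, ?_⟩
  · simp only [hl.1, twoTable_apply]
    generalize l f = x, l f₀ = y
    cases c <;> revert i x y <;> decide
  · simpa using e
  · ext φ
    simp [labelGroup]
  · simp

end FlagMap

namespace Datum

variable {G : Type*} [Group G] [Finite G] {c : Case} {a b d : G} {F : Type*} {M : FlagMap F}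
  {ψ : G × Fin 2 ≃ F}

/-- The inverse rebelting of a map given by a datum. -/
theorem isRebelting_of_isIso (h : Datum c a b d) (hψ : h.two.IsIso M ψ) :
    IsRebelting h.eight {x | x.2 ∉ eightOff c} M.truncation.petrial.dual (inheritedFlags F)
      (beltMap c a b d ∘ (ψ.symm.prodCongr (Equiv.refl (Fin 3)))) :=
  h.isRebelting.congr hψ.symm.nine

variable {Y : Type*} {M₃ : FlagMap Y} {B : Set Y} {e : F × Fin 3 → Y}

/-- Uniqueness of the inverse of rebelting brings an arbitrary `M₃` to standard form, belts
included. -/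
theorem exists_isIso_eight (h : Datum c a b d) (hψ : h.two.IsIso M ψ)
    (hB : IsRebelting M₃ B M.truncation.petrial.dual (inheritedFlags F) e) :
    ∃ χ : G × Fin 8 ≃ Y, h.eight.IsIso M₃ χ ∧ (∀ x, χ x ∈ B ↔ x.2 ∉ eightOff c) ∧
      ∀ x j, χ (beltMap c a b d (x, j)) = e (ψ x, j) := by
  have h₀ := h.isRebelting_of_isIso hψ
  obtain ⟨χ, hχ, hχe⟩ := h₀.exists_isIso hB
  refine ⟨χ, hχ, fun x => ?_, fun x j => ?_⟩
  · constructor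
    · intro hx
      obtain ⟨y, hy⟩ := hB.exists_eq hx
      rw [← hχe] at hy
      have := h₀.e_mem y
      rwa [χ.injective hy] at this
    · intro hx
      obtain ⟨y, rfl⟩ := h₀.exists_eq (x := x) hx
      rw [hχe]
      exact hB.e_mem y
  · rw [← hχe]
    simp

theorem exists_isCaseLabelling (h : Datum c a b d) {χ : G × Fin 8 ≃ Y} (hχ : h.eight.IsIso M₃ χ)
    (hB : ∀ x, χ x ∈ B ↔ x.2 ∉ eightOff c) : ∃ l₃, IsCaseLabelling c M₃ B l₃ := by
  obtain ⟨h1, h2, h3⟩ := h.eight_isCaseLabelling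
  refine ⟨_, hχ.symm.isLabelling h1, fun y => h2 _, fun y => ?_⟩
  have := h3 (χ.symm y)
  simp only [Set.mem_ofPred_eq, ← hB, Equiv.apply_symm_apply] at this
  exact this

/-- If the labelling takes the appropriate value at one flag outside the belts, the split places are
those of the standard form. -/
theorem preimage_splitFlags (h : Datum c a b d) {χ : G × Fin 8 ≃ Y} (hχ : h.eight.IsIso M₃ χ)
    {l₃ : Y → Fin 14} (hl : M₃.IsLabelling c.graphEight l₃) {k : Fin 14} (hk : k ∈ c.splitLabels)
    {x₀ : G × Fin 8} (h₀ : l₃ (χ x₀) = if k = splitLabel c then eightLabel c x₀.2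
      else eightReflection c (eightLabel c x₀.2)) :
    χ ⁻¹' splitFlags c l₃ k = {x | x.2 ∈ eightSplit c} := by
  have key : ∀ x, l₃ (χ x) = if k = splitLabel c then eightLabel c x.2
      else eightReflection c (eightLabel c x.2) := by
    intro x
    refine h.eight.connected_induction (P := fun x => l₃ (χ x) = if k = splitLabel c then
      eightLabel c x.2 else eightReflection c (eightLabel c x.2)) ?_ h₀ x
    rintro i ⟨g, v⟩ hx
    rw [hχ, hl.1, hx, eight_r]
    simp only [eightLabel_table]
    split_ifs
    · rfl
    · exact graphEight_reflection c i _
  ext ⟨g, v⟩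
  simp only [splitFlags, Set.mem_preimage, Set.mem_ofPred_eq, mem_eightSplit, key]
  clear key h₀
  cases c <;> simp only [Case.splitLabels, Set.mem_insert_iff, Set.mem_singleton_iff] at hk <;>
    rcases hk with rfl | rfl <;> revert v <;> decide

end Datum

namespace FlagMap

variable {F Y : Type*} {M : FlagMap F} {M₃ : FlagMap Y} {B : Set Y} {e : F × Fin 3 → Y}

/-- The labels `12` and `13` both occur next to the bounding edges. -/
theorem exists_bounding_label {c : Case} {l₃ : Y → Fin 14}
    (hB : IsRebelting M₃ B M.truncation.petrial.dual (inheritedFlags F) e)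
    (hl : IsCaseLabelling c M₃ B l₃) (k : Fin 14) (hk : k = 12 ∨ k = 13) :
    ∃ f, l₃ (M₃.r 2 (e (f, 0))) = k := by
  obtain ⟨f⟩ := M.nonempty
  have h1 := (hl.2.2 _).1 ((hB.mem_bounding (f, 0)).1 rfl)
  have h2 : l₃ (M₃.r 2 (e (M.r 2 f, 0))) = c.graphEight 0 (l₃ (M₃.r 2 (e (f, 0)))) := by
    rw [← nine_zero_zero, hB.map_zero, ← M₃.comm, hl.1.1]
  have h3 : c.graphEight 0 12 = 13 ∧ c.graphEight 0 13 = 12 := by cases c <;> decide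
  rcases hk with rfl | rfl <;> rcases h1 with h1 | h1
  · exact ⟨f, h1⟩
  · exact ⟨_, h2.trans (h1 ▸ h3.2)⟩
  · exact ⟨_, h2.trans (h1 ▸ h3.1)⟩
  · exact ⟨f, h1⟩

/-- The standard form of the whole construction with given labelling and split label. -/
theorem exists_standard_form {c : Case} {l : F → Fin 2} (hl : M.IsLabelling c.graphTwo l)
    (hs : c.StartRelation M) {l₃ : Y → Fin 14}
    (hB : IsRebelting M₃ B M.truncation.petrial.dual (inheritedFlags F) e)
    (hl₃ : IsCaseLabelling c M₃ B l₃) {k : Fin 14} (hk : k ∈ c.splitLabels)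
    [Finite F] :
    ∃ (a b d : M.labelGroup l) (h : Datum c a b d) (χ : M.labelGroup l × Fin 8 ≃ Y),
      h.eight.IsIso M₃ χ ∧ χ ⁻¹' splitFlags c l₃ k = {x | x.2 ∈ eightSplit c} := by
  -- In the standard form the flag across the base from the base flag is labelled `13`, and the
  -- reflection turns this into `12`. Choosing `f₀` accordingly aligns the given labelling and `k`
  -- with the standard split places.
  obtain ⟨f₀, hf₀⟩ := exists_bounding_label hB hl₃ (if k = splitLabel c then 13 else 12)
    (by split_ifs <;> simp)
  obtain ⟨l', hl', hg, h0⟩ := hl.exists_label_eq_zero f₀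
  rw [← hg]
  obtain ⟨a, b, d, h, ψ, hψ, hψ0, -⟩ := hl'.exists_datum_two (hl.walk_walk_walk hs) f₀ h0
  obtain ⟨χ, hχ, -, hχe⟩ := h.exists_isIso_eight hψ hB
  refine ⟨a, b, d, h, χ, hχ, h.preimage_splitFlags hχ hl₃.1 hk
    (x₀ := h.eight.r 2 (beltMap c a b d ((1, 0), 0))) ?_⟩
  rw [hχ, hχe, hψ0, hf₀]
  have : (h.eight.r 2 (beltMap c a b d ((1, 0), 0))).2 =
    eightTable c 2 (beltVertex c 0 0) := rfl
  rw [this]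
  split_ifs <;> cases c <;> decide

/-- The properties of the maps given by the construction. -/
theorem IsIso.bar_properties {G : Type*} [Group G] [Finite G] {c : Case} {a b d : G}
    (h : Datum c a b d) {X : Type*} {Mbar : FlagMap X} {Ψ : G × Fin 14 ≃ X}
    (hΨ : h.bar.IsIso Mbar Ψ) :
    Mbar.IsEquivelar 3 7 ∧ Mbar.IsVertexTransitive ∧ Mbar.IsAdmissible c.graph ∧
    (∃ ι : G →* Mbar.aut, Function.Injective ι) ∧
    ((Mbar.IsOfType c.graph ∧ Mbar.numOrbits = 14 ∧ Nat.card Mbar.aut = Nat.card G) ∨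
      (Mbar.IsChiral ∧ Nat.card Mbar.aut = 7 * Nat.card G) ∨
      (Mbar.IsRegular ∧ Nat.card Mbar.aut = 14 * Nat.card G)) ∧
    6 * Mbar.eulerChar = -(Nat.card G : ℤ) := by
  have fin := Mbar.finite
  have he := hΨ.symm.isEquivelar h.bar_isEquivelar
  have hl := hΨ.symm.isLabelling h.bar_isLabelling
  have hv := hl.isVertexTransitive
  have iso : G ≃* Mbar.labelGroup ((fun x => x.2) ∘ Ψ.symm) :=
    (voltageMapLabelGroup h.bar_isVoltage (L := id) Function.injective_id).trans
      (hΨ.symm.labelGroupEquiv _).symm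
  have hcard : Nat.card X = 14 * Nat.card G := by
    rw [← Nat.card_congr Ψ, Nat.card_prod, Nat.card_fin, mul_comm]
  have horb := Mbar.card_eq_numOrbits_mul
  rw [hcard] at horb
  refine ⟨he, hv, ⟨_, hl⟩, ⟨(Subgroup.inclusion labelGroup_le_aut).comp iso.toMonoidHom,
    (Subgroup.inclusion_injective labelGroup_le_aut).comp iso.injective⟩, ?_, he.eulerChar hcard⟩
  rcases hv.trichotomy he with (hr | hc) | hi
  · right; right
    rw [show Mbar.numOrbits = 1 from hr] at horb
    exact ⟨hr, by omega⟩
  · right; left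
    rw [hc.1] at horb
    exact ⟨hc, by omega⟩
  · left
    obtain ⟨y⟩ := Mbar.nonempty
    have hn := (exists_orbit_label _ (hv.exists_around he y) (hi y)).1
    rw [hn] at horb
    have hc : Nat.card Mbar.aut = Nat.card G := by omega
    refine ⟨⟨_, fun v => ⟨Ψ (1, v), by simp⟩, hl.1, fun f g => ⟨hl.2 f g, ?_⟩⟩, hn, hc⟩
    rintro ⟨φ, hφ, rfl⟩
    -- With 14 orbits the orders agree, so all automorphisms preserve labels and different labels
    -- are different orbits.
    have heq : Mbar.labelGroup ((fun x => x.2) ∘ Ψ.symm) = Mbar.aut :=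
      Subgroup.eq_of_le_of_card_ge labelGroup_le_aut
        (by rw [hc, Nat.card_congr iso.toEquiv])
    rw [← heq] at hφ
    exact (hφ.2 f).symm

end FlagMap

theorem mainTheorem4 :
    -- every vertex-transitive map of type `{3, 7}` that is neither regular nor chiral
    (∀ (X : Type u) (Mbar : FlagMap X), Mbar.IsEquivelar 3 7 → Mbar.IsVertexTransitive →
      ¬ Mbar.IsRegular → ¬ Mbar.IsChiral →
      Mbar.numOrbits = 14 ∧
      (∃! c : Case, Mbar.IsOfType c.graph) ∧
      ∀ (c : Case) (lbar : X → Fin 14), Mbar.IsTypeLabelling c.graph lbar →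
        ∃ (F : Type u) (M : FlagMap F) (l : F → Fin 2)
          (Y : Type u) (M₃ : FlagMap Y) (B : Set Y) (l₃ : Y → Fin 14) (k : Fin 14) (e : Y → X),
          M.IsLabelling c.graphTwo l ∧ c.StartRelation M ∧
          IsUnbelted M M₃ B ∧ IsCaseLabelling c M₃ B l₃ ∧ k ∈ c.splitLabels ∧
          IsCollapsing Mbar Mbar.aut {x | lbar x ∈ c.deleted} M₃ (splitFlags c l₃ k) e ∧
          (∀ y, l₃ y = lbar (e y)) ∧
          Nonempty (Mbar.aut ≃* M.labelGroup l) ∧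
          6 * Mbar.eulerChar = -(Nat.card (M.labelGroup l) : ℤ) ∧
          3 * Mbar.eulerChar = -(M.numCells 1 : ℤ)) ∧
    -- conversely, the construction applies to every admissible map satisfying the relation
    (∀ (c : Case) (F : Type u) (M : FlagMap F) (l : F → Fin 2),
      M.IsLabelling c.graphTwo l → c.StartRelation M →
      M.truncation.petrial.dual.IsEquivelar 3 9 ∧
      (∃ (Y : Type u) (M₃ : FlagMap Y) (B : Set Y), IsUnbelted M M₃ B) ∧
      ∀ (Y : Type u) (M₃ : FlagMap Y) (B : Set Y), IsUnbelted M M₃ B →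
        (∃ l₃ : Y → Fin 14, IsCaseLabelling c M₃ B l₃) ∧
        ∀ (l₃ : Y → Fin 14) (k : Fin 14), IsCaseLabelling c M₃ B l₃ → k ∈ c.splitLabels →
          (∃ (X : Type u) (Mbar : FlagMap X) (H : Subgroup (Equiv.Perm X)) (T : Set X)
            (e : Y → X), IsCollapsing Mbar H T M₃ (splitFlags c l₃ k) e ∧
              Nonempty (H ≃* M.labelGroup l)) ∧
          ∀ (X : Type u) (Mbar : FlagMap X) (H : Subgroup (Equiv.Perm X)) (T : Set X)
            (e : Y → X), IsCollapsing Mbar H T M₃ (splitFlags c l₃ k) e →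
            Mbar.IsEquivelar 3 7 ∧ Mbar.IsVertexTransitive ∧ Mbar.IsAdmissible c.graph ∧
            (∃ ι : M.labelGroup l →* Mbar.aut, Function.Injective ι) ∧
            ((Mbar.IsOfType c.graph ∧ Mbar.numOrbits = 14 ∧
                Nat.card Mbar.aut = Nat.card (M.labelGroup l)) ∨
              (Mbar.IsChiral ∧ Nat.card Mbar.aut = 7 * Nat.card (M.labelGroup l)) ∨
              (Mbar.IsRegular ∧ Nat.card Mbar.aut = 14 * Nat.card (M.labelGroup l))) ∧
            6 * Mbar.eulerChar = -(Nat.card (M.labelGroup l) : ℤ) ∧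
            3 * Mbar.eulerChar = -(M.numCells 1 : ℤ)) := by
  refine ⟨fun X Mbar he hv hr hc => ?_, fun c F M l hl hs => ?_⟩
  · obtain ⟨h14, c, hT⟩ := hv.exists_case he hr hc
    refine ⟨h14, ⟨c, hT, fun c' hT' => ?_⟩, fun c lbar hl => hl.exists_construction he h14⟩
    obtain ⟨l, hl⟩ := hT
    obtain ⟨l', hl'⟩ := hT'
    exact hl'.case_unique hl
  · have fin := M.finite
    have hw := hl.walk_walk_walk hs
    obtain ⟨f₀⟩ := M.nonempty
    obtain ⟨l', hl', hg, h0⟩ := hl.exists_label_eq_zero f₀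
    obtain ⟨a, b, d, h, ψ, hψ, -, -⟩ := hl'.exists_datum_two hw f₀ h0
    have hcF : Nat.card F = Nat.card (M.labelGroup l) * 2 := by
      rw [← Nat.card_congr ψ, Nat.card_prod, Nat.card_fin, hg]
    refine ⟨M.nine_isEquivelar (fun f => (hw f).1) (fun f => (hw f).2),
      ⟨_, h.eight, _, _, h.isRebelting_of_isIso hψ⟩, ?_⟩
    rintro Y M₃ B ⟨e, hB⟩
    obtain ⟨χ, hχ, hχB, -⟩ := h.exists_isIso_eight hψ hB
    refine ⟨h.exists_isCaseLabelling hχ hχB, fun l₃ k hl₃ hk => ?_⟩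
    -- This datum need not fit the given `l₃` and `k`; one adapted to them replaces it.
    clear hχB hχ χ hψ ψ h a b d
    obtain ⟨a, b, d, h, χ, hχ, hS⟩ := exists_standard_form hl hs hB hl₃ hk
    constructor
    · refine ⟨_, h.bar, _, {x | x.2 ∈ c.deleted}, (fun x => (x.1, eightLabel c x.2)) ∘ χ.symm, ?_,
        ⟨(voltageMapLabelGroup h.bar_isVoltage (L := id) Function.injective_id).symm⟩⟩
      have := h.isCollapsing.congr hχ.symm
      rwa [← hS, ← Set.preimage_comp, Equiv.self_comp_symm, Set.preimage_id] at this
    · intro X Mbar H T e' hcol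
      have hcol' := hcol.congr hχ
      rw [hS] at hcol'
      -- Both maps now collapse to the same map with the same split places, so they are isomorphic.
      obtain ⟨Ψ, hΨ, -⟩ := h.isCollapsing.exists_isIso hcol' h.eight_next
      obtain ⟨p1, p2, p3, p4, p5, p6⟩ := hΨ.bar_properties
      exact ⟨p1, p2, p3, p4, p5, p6, three_mul_eq_of_card M p6 hcF⟩
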